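/- All Lie algebras are $\mathbb Z$-graded over $\mathbb Q$. A complete differential graded Lie algebra (cDGL) is a differential graded Lie algebra $(L,d)$, $d$ of degree $-1$, such that, degree by degree, $L\to\varprojlim_n L/\Gamma^nL$ is an isomorphism, where $\Gamma^\bullet L$ is the lower central series. For a graded vector space $V$, $\widehat{\mathbb L}(V)=\varprojlim_n\mathbb L(V)/\mathbb L^{>n}(V)$ is the complete free graded Lie algebra. A Maurer–Cartan (MC) element is an $a\in L_{-1}$ with $da=-\frac12[a,a]$. **Models.** Let $s^{-1}C_*(\Delta^n)$ have one generator $a_{i_0\ldots i_p}$ of degree $p-1$ for every simplex $0\le i_0<\dots<i_p\le n$. Let $(\mathcal L_{\Delta^n})_{n\ge0}=(\widehat{\mathbb L}(s^{-1}C_*(\Delta^n)),\partial)_{n\geq 0}$ be cDGLs that model the simplices, that is: (i) every increasing injection $\{0,\dots,m\}\to\{0,\dots,n\}$ induces, on generators, a cDGL morphism $\mathcal L_{\Delta^m}\to\mathcal L_{\Delta^n}$; (ii) $\mathcal L_{\Delta^0}=(\widehat{\mathbb L}(a),\partial)$ with $a$ an MC element; (iii) the linear part of $\partial$ is the desuspended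 simplicial boundary $\partial_1a_{i_0\ldots i_p}=\sum_j(-1)^ja_{i_0\ldots\widehat{i_j}\ldots i_p}$ (which is zero for $p=0$). For a finite simplicial complex $X$, regarded as a subcomplex of some $\Delta^n$, its model $\mathcal L_X=(\widehat{\mathbb L}(s^{-1}C_*(X)),\partial)$ carries the restriction of the differential of $\mathcal L_{\Delta^n}$. **Cylinder.** Let $(L,d)=(\widehat{\mathbb L}(V),d)$. Extend $d$ to $\widehat{\mathbb L}(V\oplus V'\oplus sV')$, where $V'$ is a copy of $V$ and $sV'$ its suspension, by $dv'=0$, $d(sv')=v'$. Let $i$ be the derivation of degree $1$ with $i(v)=sv'$, $i(v')=i(sv')=0$, and let $\theta=id+di$. Let $\widehat V\cong V$ and $\overline V\cong sV$ be new copies. Then $\mathrm{Cyl}(L)=(\widehat{\mathbb L}(V\oplus\widehat V\oplus\overline V),D)$ with $D=\psi^{-1}d\psi$ for the isomorphism $\psi(v)=v$, $\psi(\hat v)=e^\theta(v)$, $\psi(\overline v)=sv'$, and $\iota_1\colon L\to\mathrm{Cyl}(L)$ is the morphism $v\mapsto\hat v$. **Cone.** The projection $X\to\{*\}$ induces $\rho\colon\mathcal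 L_X\to\mathcal L_{\Delta^0}=(\mathbb L(a),\partial)$, which sends the generators of vertices to $a$ and all other generators to $0$. $\mathrm{Cone}(\mathcal L_X)$ is the pushout of $\mathrm{Cyl}(\mathcal L_X)\xleftarrow{\ \iota_1\ }\mathcal L_X\xrightarrow{\ \rho\ }(\mathbb L(a),\partial)$ in the category of cDGLs. **Theorem.** For every $n\ge1$ the cone on $\mathcal L_{\Delta^{n-1}}$ exists, and $$\mathcal L_{\Delta^n}\cong\mathrm{Cone}(\mathcal L_{\Delta^{n-1}}).$$ Moreover, for every finite simplicial complex $X\subseteq\Delta^n$, the model $\mathcal L_X$ and its cone exist, and $$\mathrm{Cone}(\mathcal L_X)\cong\mathcal L_{\mathrm{Cone}(X)},$$ where $\mathrm{Cone}(X)\subseteq\Delta^{n+1}$ is the simplicial cone on $X$ with the last vertex of $\Delta^{n+1}$ as its apex. The isomorphisms are isomorphisms of cDGLs. -/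

import Mathlib

open CategoryTheory

noncomputable section

/-! ## Graded Lie algebras, derivations, completeness -/

/-- A `ℤ`-graded Lie algebra over `ℚ`. Degrees are carried along by equations, so the bracket of
elements of degrees `p` and `q` lands in any `r` for which a proof of `p + q = r` is given. -/
structure GradedLie where
  obj : ℤ → Type
  [addCommGroup : ∀ p, AddCommGroup (obj p)]
  [module : ∀ p, Module ℚ (obj p)]
  bracket : ∀ {p q r : ℤ}, p + q = r → obj p →ₗ[ℚ] obj q →ₗ[ℚ] obj r
  antisymm : ∀ {p q r : ℤ} (h : p + q = r) (h' : q + p = r) (x : obj p) (y : obj q),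
    bracket h x y = -((p * q).negOnePow • bracket h' y x)
  jacobi : ∀ {p q r qr pq pr s : ℤ} (hqr : q + r = qr) (hpq : p + q = pq) (hpr : p + r = pr)
    (h₁ : p + qr = s) (h₂ : pq + r = s) (h₃ : q + pr = s) (x : obj p) (y : obj q) (z : obj r),
    bracket h₁ x (bracket hqr y z) =
      bracket h₂ (bracket hpq x y) z + (p * q).negOnePow • bracket h₃ y (bracket hpr x z)

attribute [instance] GradedLie.addCommGroup GradedLie.module

namespace GradedLie

/-- The lower central series: `lcs 0 = L` and `lcs (n + 1) = [L, lcs n]`. -/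
def lcs (L : GradedLie) : ℕ → ∀ p : ℤ, Submodule ℚ (L.obj p)
  | 0, _ => ⊤
  | n + 1, r => Submodule.span ℚ
      {z | ∃ (p q : ℤ) (h : p + q = r) (x : L.obj p) (y : L.obj q),
        y ∈ lcs L n q ∧ z = L.bracket h x y}

/-- `L` is complete: in every degree the map from `L` to the inverse limit of the quotients of `L`
by the terms of its lower central series is injective and surjective. -/
def IsComplete (L : GradedLie) : Prop :=
  ∀ p : ℤ, (∀ x : L.obj p, (∀ n, x ∈ L.lcs n p) → x = 0) ∧
    ∀ u : ℕ → L.obj p, (∀ n, u (n + 1) - u n ∈ L.lcs n p) →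
      ∃ x : L.obj p, ∀ n, x - u n ∈ L.lcs n p

/-- Derivations of degree `k`. -/
structure Derivation (L : GradedLie) (k : ℤ) where
  toFun : ∀ {p q : ℤ}, p + k = q → L.obj p →ₗ[ℚ] L.obj q
  leibniz : ∀ {p q r p' q' r' : ℤ} (h : p + q = r) (hr : r + k = r') (hp : p + k = p')
    (hq : q + k = q') (h₁ : p' + q = r') (h₂ : p + q' = r') (x : L.obj p) (y : L.obj q),
    toFun hr (L.bracket h x y) =
      L.bracket h₁ (toFun hp x) y + (k * p).negOnePow • L.bracket h₂ x (toFun hq y)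

/-- Differentials: derivations of degree `-1` and square zero. -/
structure Differential (L : GradedLie) extends Derivation L (-1) where
  square_zero : ∀ {p q r : ℤ} (h : p + -1 = q) (h' : q + -1 = r) (x : L.obj p),
    toFun h' (toFun h x) = 0

/-- `y = e^θ(v) = ∑ θᵏ(v) / k!`, a convergent series for the lower central series topology. -/
def HasExp (L : GradedLie) {p : ℤ} (θ : Module.End ℚ (L.obj p)) (v y : L.obj p) : Prop :=
  ∀ n : ℕ, ∃ N₀ : ℕ, ∀ N ≥ N₀,
    y - ∑ k ∈ Finset.range N, ((k.factorial : ℚ)⁻¹) • (θ ^ k) v ∈ L.lcs n p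

end GradedLie

/-! ## The category of complete differential graded Lie algebras -/

/-- Complete differential graded Lie algebras. -/
structure CDGL where
  toGradedLie : GradedLie
  complete : toGradedLie.IsComplete
  d : toGradedLie.Differential

namespace CDGL

/-- Morphisms: linear maps of degree zero which commute with brackets and differentials. -/
@[ext]
structure Hom (L M : CDGL) where
  toFun : ∀ p : ℤ, L.toGradedLie.obj p →ₗ[ℚ] M.toGradedLie.obj p
  map_bracket : ∀ {p q r : ℤ} (h : p + q = r) (x : L.toGradedLie.obj p)
    (y : L.toGradedLie.obj q),
    toFun r (L.toGradedLie.bracket h x y) = M.toGradedLie.bracket h (toFun p x) (toFun q y)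
  map_d : ∀ {p q : ℤ} (h : p + -1 = q) (x : L.toGradedLie.obj p),
    toFun q (L.d.toFun h x) = M.d.toFun h (toFun p x)

instance : Category CDGL where
  Hom := Hom
  id L :=
    { toFun := fun _ => LinearMap.id
      map_bracket := fun _ _ _ => rfl
      map_d := fun _ _ => rfl }
  comp f g :=
    { toFun := fun p => (g.toFun p).comp (f.toFun p)
      map_bracket := fun h x y => by simp [f.map_bracket, g.map_bracket]
      map_d := fun h x => by simp [f.map_d, g.map_d] }

/-- Maurer-Cartan elements: `d a = -½ [a, a]` with `a` of degree `-1`. -/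
def IsMC (L : CDGL) (a : L.toGradedLie.obj (-1)) : Prop :=
  L.d.toFun (show (-1 : ℤ) + -1 = -2 by norm_num) a =
    -((1 / 2 : ℚ) • L.toGradedLie.bracket (show (-1 : ℤ) + -1 = -2 by norm_num) a a)

end CDGL

/-! ## The complete free graded Lie algebra

The free graded Lie algebra on a graded set `X` is the Lie subalgebra, generated by `X`, of the
tensor algebra (noncommutative polynomials in `X`) with its graded commutator. Its completion
consists, degree by degree, of the noncommutative power series all of whose homogeneous parts with
respect to word length are Lie polynomials. -/

namespace FreeLie

variable {X : Type}

/-- Noncommutative power series. -/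
abbrev Series (X : Type) : Type := List X → ℚ

/-- The product (concatenation of words). -/
def mul : Series X →ₗ[ℚ] Series X →ₗ[ℚ] Series X :=
  LinearMap.mk₂ ℚ
    (fun f g w => ∑ i ∈ Finset.range (w.length + 1), f (w.take i) * g (w.drop i))
    (fun f f' g => by funext w; simp [add_mul, Finset.sum_add_distrib])
    (fun c f g => by funext w; simp [Finset.mul_sum, mul_assoc])
    (fun f g g' => by funext w; simp [mul_add, Finset.sum_add_distrib])
    (fun c f g => by funext w; simp [Finset.mul_sum, mul_left_comm])

/-- The graded commutator of series of degrees `p` and `q`. -/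
def comm (p q : ℤ) : Series X →ₗ[ℚ] Series X →ₗ[ℚ] Series X :=
  mul - (p * q).negOnePow • mul.flip

open Classical in
/-- The series which consists of the single letter `x`. -/
def letter (x : X) : Series X := fun w => if w = [x] then 1 else 0

/-- The part of a series that is supported on words of length `k`. -/
def part (k : ℕ) : Series X →ₗ[ℚ] Series X where
  toFun f := fun w => if w.length = k then f w else 0
  map_add' f g := by funext w; by_cases h : w.length = k <;> simp [h]
  map_smul' c f := by funext w; by_cases h : w.length = k <;> simp [h]

/-- Lie polynomials of word length `k` and degree `p`, i.e. the elements of degree `p` of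
`𝕃ᵏ(V)`, where `V` is the graded vector space with basis `X`. -/
inductive IsLiePoly (deg : X → ℤ) : ℕ → ℤ → Series X → Prop
  | zero (k : ℕ) (p : ℤ) : IsLiePoly deg k p 0
  | add {k : ℕ} {p : ℤ} {f g : Series X} :
      IsLiePoly deg k p f → IsLiePoly deg k p g → IsLiePoly deg k p (f + g)
  | smul {k : ℕ} {p : ℤ} {f : Series X} (c : ℚ) :
      IsLiePoly deg k p f → IsLiePoly deg k p (c • f)
  | letter (x : X) : IsLiePoly deg 1 (deg x) (letter x)
  | bracket {j k : ℕ} {p q : ℤ} {f g : Series X} :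
      IsLiePoly deg j p f → IsLiePoly deg k q g → IsLiePoly deg (j + k) (p + q) (comm p q f g)

/-- The Lie series of degree `p`. -/
def lieSeries (deg : X → ℤ) (p : ℤ) : Submodule ℚ (Series X) where
  carrier := {f | ∀ k, IsLiePoly deg k p (part k f)}
  zero_mem' k := by simpa using IsLiePoly.zero k p
  add_mem' hf hg k := by simpa using (hf k).add (hg k)
  smul_mem' c f hf k := by simpa using (hf k).smul c

/-! ### Helper facts -/

lemma mul_apply (f g : Series X) (w : List X) :
    mul f g w = ∑ i ∈ Finset.range (w.length + 1), f (w.take i) * g (w.drop i) := rfl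

lemma comm_apply (p q : ℤ) (f g : Series X) :
    comm p q f g = mul f g - (p * q).negOnePow • mul g f := rfl

lemma part_apply (k : ℕ) (f : Series X) (w : List X) :
    part k f w = if w.length = k then f w else 0 := rfl

lemma mul_nil (f g : Series X) : mul f g [] = f [] * g [] := by simp [mul_apply]

lemma mul_cons (f g : Series X) (x : X) (w : List X) :
    mul f g (x :: w) = f [] * g (x :: w) + mul (fun v => f (x :: v)) g w := by
  rw [mul_apply, mul_apply, List.length_cons, Finset.sum_range_succ']
  simp [add_comm]

lemma mul_assoc' (f g h : Series X) : mul (mul f g) h = mul f (mul g h) := by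
  funext w
  induction w generalizing f with
  | nil => simp [mul_nil, mul_assoc]
  | cons x w ih =>
    have e : (fun v => mul f g (x :: v)) =
        f [] • (fun v => g (x :: v)) + mul (fun v => f (x :: v)) g := by
      funext v; simp [mul_cons]
    rw [mul_cons, e, map_add, LinearMap.add_apply, Pi.add_apply, ih, mul_cons f, mul_cons g,
      map_smul, LinearMap.smul_apply, Pi.smul_apply, mul_nil, smul_eq_mul]
    ring

lemma comm_antisymm (p q : ℤ) (f g : Series X) :
    comm p q f g = -((p * q).negOnePow • comm q p g f) := by
  rw [comm_apply, comm_apply, mul_comm q p]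
  rcases Int.units_eq_one_or (p * q).negOnePow with h | h <;> rw [h] <;> simp [add_comm]

lemma comm_jacobi (p q r : ℤ) (f g h : Series X) :
    comm p (q + r) f (comm q r g h) =
      comm (p + q) r (comm p q f g) h + (p * q).negOnePow • comm q (p + r) g (comm p r f h) := by
  simp only [comm_apply, mul_add, add_mul, Int.negOnePow_add, mul_comm q p]
  rcases Int.units_eq_one_or (p * q).negOnePow with h1 | h1 <;>
  rcases Int.units_eq_one_or (p * r).negOnePow with h2 | h2 <;>
  rcases Int.units_eq_one_or (q * r).negOnePow with h3 | h3 <;>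
  simp [h1, h2, h3, mul_assoc'] <;> abel

lemma mul_part (k : ℕ) (f g : Series X) :
    part k (mul f g) = ∑ ij ∈ Finset.HasAntidiagonal.antidiagonal k, mul (part ij.1 f) (part ij.2 g) := by
  funext w
  rw [Finset.sum_apply, part_apply]
  split_ifs with hw
  · subst hw
    rw [mul_apply, Finset.Nat.sum_antidiagonal_eq_sum_range_succ
      (fun i j => mul (part i f) (part j g) w)]
    refine Finset.sum_congr rfl fun i hi => ?_
    have hi' : i ≤ w.length := Nat.lt_succ_iff.mp (Finset.mem_range.mp hi)
    rw [mul_apply, Finset.sum_eq_single i]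
    · simp [part_apply, hi']
    · intro j hj hji
      have hj' : j ≤ w.length := Nat.lt_succ_iff.mp (Finset.mem_range.mp hj)
      simp [part_apply, hj', hji]
    · intro hi2; exact absurd hi hi2
  · symm
    refine Finset.sum_eq_zero fun ij hij => ?_
    rw [mul_apply]
    refine Finset.sum_eq_zero fun i hi => ?_
    have hi' : i ≤ w.length := Nat.lt_succ_iff.mp (Finset.mem_range.mp hi)
    have := Finset.HasAntidiagonal.mem_antidiagonal.mp hij
    simp only [part_apply, List.length_take, List.length_drop, min_eq_left hi']
    by_cases h1 : i = ij.1
    · have : ¬ (w.length - i = ij.2) := by omega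
      simp [this]
    · simp [h1]

lemma comm_part (k : ℕ) (p q : ℤ) (f g : Series X) :
    part k (comm p q f g) =
      ∑ ij ∈ Finset.HasAntidiagonal.antidiagonal k, comm p q (part ij.1 f) (part ij.2 g) := by
  have hs : part k ((p * q).negOnePow • mul g f) = (p * q).negOnePow • part k (mul g f) := by
    rcases Int.units_eq_one_or (p * q).negOnePow with h | h <;> rw [h] <;> simp
  simp only [comm_apply, map_sub, hs, Finset.sum_sub_distrib, mul_part, Finset.smul_sum]
  congr 1
  exact (Finset.Nat.sum_antidiagonal_swap
    (f := fun ij => (p * q).negOnePow • mul (part ij.1 g) (part ij.2 f))).symm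

lemma IsLiePoly.sum {deg : X → ℤ} {k : ℕ} {p : ℤ} {ι : Type*} (s : Finset ι) (f : ι → Series X)
    (h : ∀ i ∈ s, IsLiePoly deg k p (f i)) : IsLiePoly deg k p (∑ i ∈ s, f i) :=
  Finset.sum_induction f _ (fun _ _ => .add) (.zero k p) h

lemma comm_mem {deg : X → ℤ} {p q r : ℤ} (h : p + q = r) {f g : Series X}
    (hf : f ∈ lieSeries deg p) (hg : g ∈ lieSeries deg q) : comm p q f g ∈ lieSeries deg r := by
  subst h
  intro k
  rw [comm_part]
  refine IsLiePoly.sum _ _ fun ij hij => ?_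
  have := (hf ij.1).bracket (hg ij.2)
  rwa [Finset.HasAntidiagonal.mem_antidiagonal.mp hij] at this

lemma part_letter (k : ℕ) (x : X) : part k (letter x) = if k = 1 then letter x else 0 := by
  funext w
  by_cases hw : w = [x]
  · subst hw
    by_cases hk : k = 1
    · simp [part_apply, hk]
    · simp [part_apply, hk, Ne.symm hk]
  · by_cases hk : k = 1 <;> simp [part_apply, letter, hw, hk]

lemma letter_mem {deg : X → ℤ} {p : ℤ} {x : X} (h : deg x = p) :
    letter x ∈ lieSeries deg p := by
  subst h
  intro k
  rw [part_letter]
  split_ifs with hk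
  · subst hk; exact .letter x
  · exact .zero _ _

end FreeLie

open FreeLie in
/-- The complete free graded Lie algebra on the graded set `(X, deg)`. -/
def freeLie {X : Type} (deg : X → ℤ) : GradedLie where
  obj p := lieSeries deg p
  bracket {p q r} h := LinearMap.mk₂ ℚ
    (fun f g => (⟨comm p q f.1 g.1, comm_mem h f.2 g.2⟩ : lieSeries deg r))
    (fun f f' g => Subtype.ext (by simp))
    (fun c f g => Subtype.ext (by simp))
    (fun f g g' => Subtype.ext (by simp))
    (fun c f g => Subtype.ext (by simp))
  antisymm {p q r} h h' x y := Subtype.ext (by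
    have := comm_antisymm p q x.1 y.1
    rcases Int.units_eq_one_or (p * q).negOnePow with e | e <;> rw [e] at this ⊢ <;>
      simpa using this)
  jacobi {p q r qr pq pr s} hqr hpq hpr h₁ h₂ h₃ x y z := Subtype.ext (by
    subst hqr hpq hpr
    have := comm_jacobi p q r x.1 y.1 z.1
    rcases Int.units_eq_one_or (p * q).negOnePow with e | e <;> rw [e] at this ⊢ <;>
      simpa using this)

namespace FreeLie

variable {X : Type} {deg : X → ℤ}

/-- The generator `x`, in the degree `p` equal to `deg x`. -/
def gen (x : X) (p : ℤ) (h : deg x = p) : (freeLie deg).obj p :=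
  ⟨letter x, letter_mem h⟩

/-- The coefficient of a word. -/
def coeff {p : ℤ} (f : (freeLie deg).obj p) (w : List X) : ℚ := f.1 w

/-! ### Completeness of the complete free graded Lie algebra -/

lemma bracket_val {p q r : ℤ} (h : p + q = r) (f : (freeLie deg).obj p)
    (g : (freeLie deg).obj q) :
    ((freeLie deg).bracket h f g).1 = comm p q f.1 g.1 := rfl

lemma IsLiePoly.nil {k : ℕ} {p : ℤ} {f : Series X} (h : IsLiePoly deg k p f) : f [] = 0 := by
  induction h with
  | zero => rfl
  | add _ _ h1 h2 => simp [h1, h2]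
  | smul c _ h => simp [h]
  | letter x => simp [FreeLie.letter]
  | @bracket j k p q f g _ _ h1 h2 =>
    rw [comm_apply]
    rcases Int.units_eq_one_or (p * q).negOnePow with e | e <;> simp [e, mul_nil, h1]

lemma lieSeries_nil {p : ℤ} {f : Series X} (h : f ∈ lieSeries deg p) : f [] = 0 := by
  have := (h 0).nil
  rwa [part_apply, if_pos List.length_nil] at this

/-- Lie polynomials that are written with right-normed brackets. -/
inductive IsRightNormed (deg : X → ℤ) : ℕ → ℤ → Series X → Prop
  | zero (k : ℕ) (p : ℤ) : IsRightNormed deg k p 0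
  | add {k : ℕ} {p : ℤ} {f g : Series X} :
      IsRightNormed deg k p f → IsRightNormed deg k p g → IsRightNormed deg k p (f + g)
  | smul {k : ℕ} {p : ℤ} {f : Series X} (c : ℚ) :
      IsRightNormed deg k p f → IsRightNormed deg k p (c • f)
  | letter (x : X) : IsRightNormed deg 1 (deg x) (letter x)
  | ad {k : ℕ} {q : ℤ} {g : Series X} (x : X) :
      IsRightNormed deg k q g →
        IsRightNormed deg (k + 1) (deg x + q) (comm (deg x) q (FreeLie.letter x) g)

lemma IsRightNormed.bracket {j : ℕ} {p : ℤ} {f : Series X} (hf : IsRightNormed deg j p f) :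
    ∀ {k : ℕ} {q : ℤ} {g : Series X}, IsRightNormed deg k q g →
      IsRightNormed deg (j + k) (p + q) (comm p q f g) := by
  induction hf with
  | zero =>
    intro k q g _
    rw [map_zero, LinearMap.zero_apply]
    exact .zero _ _
  | add _ _ h1 h2 => intro k q g hg; simpa using (h1 hg).add (h2 hg)
  | smul c _ h => intro k q g hg; simpa using (h hg).smul c
  | letter x => intro k q g hg; rw [add_comm 1 k]; exact hg.ad x
  | @ad j r f x _ ih =>
    intro k q g hg
    have e := comm_jacobi (deg x) r q (FreeLie.letter x) f g
    rw [← sub_eq_iff_eq_add] at e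
    rw [← e]
    have h1 := (ih hg).ad x
    have h2 := ih (hg.ad x)
    have e1 : j + k + 1 = j + 1 + k := by omega
    have e2 : j + (k + 1) = j + 1 + k := by omega
    have e3 : deg x + (r + q) = deg x + r + q := by ring
    have e4 : r + (deg x + q) = deg x + r + q := by ring
    have h1' : IsRightNormed deg (j + 1 + k) (deg x + r + q)
        (comm (deg x) (r + q) (FreeLie.letter x) (comm r q f g)) := by
      rw [← e1, ← e3]; exact h1
    have h2' : IsRightNormed deg (j + 1 + k) (deg x + r + q)
        (comm r (deg x + q) f (comm (deg x) q (FreeLie.letter x) g)) := by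
      rw [← e2, ← e4]; exact h2
    rcases Int.units_eq_one_or (deg x * r).negOnePow with s | s
    · rw [s]; simpa [sub_eq_add_neg] using h1'.add (h2'.smul (-1))
    · rw [s]; simpa [sub_eq_add_neg] using h1'.add h2'

lemma IsLiePoly.isRightNormed {k : ℕ} {p : ℤ} {f : Series X} (h : IsLiePoly deg k p f) :
    IsRightNormed deg k p f := by
  induction h with
  | zero => exact .zero _ _
  | add _ _ h1 h2 => exact h1.add h2
  | smul c _ h => exact h.smul c
  | letter x => exact .letter x
  | bracket _ _ h1 h2 => exact h1.bracket h2

lemma IsRightNormed.isLiePoly {k : ℕ} {p : ℤ} {f : Series X} (h : IsRightNormed deg k p f) :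
    IsLiePoly deg k p f := by
  induction h with
  | zero => exact .zero _ _
  | add _ _ h1 h2 => exact h1.add h2
  | smul c _ h => exact h.smul c
  | letter x => exact .letter x
  | @ad k q g x _ h => rw [add_comm k 1]; exact (IsLiePoly.letter x).bracket h

lemma IsRightNormed.exists_sum [Fintype X] {m : ℕ} {p : ℤ} {f : Series X}
    (h : IsRightNormed deg m p f) :
    ∀ k, m = k + 1 → 1 ≤ k → ∃ u : X → Series X, (∀ x, IsLiePoly deg k (p - deg x) (u x)) ∧
      f = ∑ x, comm (deg x) (p - deg x) (FreeLie.letter x) (u x) := by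
  classical
  induction h with
  | zero => intro k _ _; exact ⟨fun _ => 0, fun _ => .zero _ _, by simp⟩
  | add _ _ h1 h2 =>
    intro k hk hk1
    obtain ⟨u, hu, rfl⟩ := h1 k hk hk1
    obtain ⟨v, hv, rfl⟩ := h2 k hk hk1
    exact ⟨fun x => u x + v x, fun x => (hu x).add (hv x), by simp [Finset.sum_add_distrib]⟩
  | smul c _ h =>
    intro k hk hk1
    obtain ⟨u, hu, rfl⟩ := h k hk hk1
    exact ⟨fun x => c • u x, fun x => (hu x).smul c, by simp [Finset.smul_sum]⟩
  | letter x => intro k hk hk1; omega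
  | @ad m q g y hg _ =>
    intro k hk hk1
    obtain rfl : m = k := by omega
    refine ⟨fun x => if x = y then g else 0, fun x => ?_, ?_⟩
    · dsimp only
      split_ifs with hx
      · subst hx; simpa using hg.isLiePoly
      · exact .zero _ _
    · rw [Finset.sum_eq_single y]
      · simp
      · intro x _ hx; simp [hx]
      · simp

lemma part_comm_letter (m : ℕ) (p q : ℤ) (x : X) (g : Series X) :
    part (m + 1) (comm p q (letter x) g) = comm p q (letter x) (part m g) := by
  rw [comm_part, Finset.sum_eq_single (1, m)]
  · simp [part_letter]
  · rintro ⟨i, j⟩ hij hne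
    have := Finset.HasAntidiagonal.mem_antidiagonal.mp hij
    have hi : i ≠ 1 := by
      rintro rfl
      apply hne
      simp only [Prod.mk.injEq, true_and]
      simp at this; omega
    simp [part_letter, hi]
  · intro h
    exact absurd (Finset.HasAntidiagonal.mem_antidiagonal.mpr (add_comm _ _)) h

lemma vanish_of_mem_lcs : ∀ (n : ℕ) (p : ℤ) (f : (freeLie deg).obj p),
    f ∈ (freeLie deg).lcs n p → ∀ w : List X, w.length ≤ n → f.1 w = 0 := by
  intro n
  induction n with
  | zero =>
    intro p f _ w hw
    rw [List.length_eq_zero_iff.mp (Nat.le_zero.mp hw)]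
    exact lieSeries_nil f.2
  | succ n ih =>
    intro r f hf w hw
    refine Submodule.span_induction (p := fun (f : (freeLie deg).obj r) _ => f.1 w = 0)
      ?_ rfl ?_ ?_ hf
    · rintro _ ⟨p, q, h, x, y, hy, rfl⟩
      have hv := ih q y hy
      have hx := lieSeries_nil x.2
      have h1 : mul x.1 y.1 w = 0 := by
        rw [mul_apply]
        refine Finset.sum_eq_zero fun i _ => ?_
        rcases Nat.eq_zero_or_pos i with rfl | hi
        · simp [hx]
        · rw [hv (w.drop i) (by simp; omega), mul_zero]
      have h2 : mul y.1 x.1 w = 0 := by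
        rw [mul_apply]
        refine Finset.sum_eq_zero fun i hi => ?_
        have hi' : i ≤ w.length := Nat.lt_succ_iff.mp (Finset.mem_range.mp hi)
        rcases Nat.eq_or_lt_of_le hi' with rfl | hi
        · simp [hx]
        · rw [hv (w.take i) (by simp; omega), zero_mul]
      rw [bracket_val, comm_apply]
      rcases Int.units_eq_one_or (p * q).negOnePow with e | e <;> simp [e, h1, h2]
    · intro a b _ _ ha hb
      change a.1 w + b.1 w = 0
      rw [ha, hb, add_zero]
    · intro c a _ ha
      change c * a.1 w = 0
      rw [ha, mul_zero]

lemma mem_lcs_of_vanish [Finite X] : ∀ (n : ℕ) (p : ℤ) (f : (freeLie deg).obj p),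
    (∀ w : List X, w.length ≤ n → f.1 w = 0) → f ∈ (freeLie deg).lcs n p := by
  classical
  cases nonempty_fintype X
  intro n
  induction n with
  | zero => intro p f _; exact Submodule.mem_top
  | succ n ih =>
    intro p f hf
    have key : ∀ k : ℕ, ∃ u : X → Series X, (∀ x, IsLiePoly deg k (p - deg x) (u x)) ∧
        (k ≤ n → u = 0) ∧
        part (k + 1) f.1 = ∑ x, comm (deg x) (p - deg x) (letter x) (u x) := by
      intro k
      by_cases hk : k ≤ n
      · refine ⟨0, fun _ => .zero _ _, fun _ => rfl, ?_⟩
        funext w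
        simp only [part_apply, Pi.zero_apply, map_zero, Finset.sum_const_zero]
        split_ifs with hw
        · exact hf w (by omega)
        · rfl
      · obtain ⟨u, hu, he⟩ := (f.2 (k + 1)).isRightNormed.exists_sum k rfl (by omega)
        exact ⟨u, hu, fun h => absurd h hk, he⟩
    choose u hu hu0 hsum using key
    -- each `u k x` may be replaced by its part of length `k`
    let v : X → Series X := fun x w => u w.length x w
    have hpart : ∀ k x, part k (v x) = part k (u k x) := by
      intro k x
      funext w
      simp only [part_apply]
      split_ifs with hw
      · subst hw; rfl
      · rfl
    have hpoly : ∀ k x, part k (u k x) = u k x := by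
      intro k x
      have aux : ∀ {j : ℕ} {q : ℤ} {g : Series X}, IsLiePoly deg j q g → part j g = g := by
        intro j q g hg
        induction hg with
        | zero => simp
        | add _ _ h1 h2 => rw [map_add, h1, h2]
        | smul c _ h => rw [map_smul, h]
        | letter x => simp [part_letter]
        | @bracket j k p q f g _ _ h1 h2 =>
          rw [comm_part, Finset.sum_eq_single (j, k)]
          · dsimp only; rw [h1, h2]
          · rintro ⟨a, b⟩ hab hne
            have hab' := Finset.HasAntidiagonal.mem_antidiagonal.mp hab
            have ha : a ≠ j := by
              rintro rfl
              apply hne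
              simp at hab'
              simp [hab']
            have hz : part a f = 0 := by
              rw [← h1]
              funext w
              simp only [part_apply, Pi.zero_apply]
              split_ifs with e1 e2
              · exact absurd (e1.symm.trans e2) ha
              · rfl
              · rfl
            simp [hz]
          · intro h; exact absurd (by simp) h
      exact aux (hu k x)
    have hv : ∀ x, v x ∈ lieSeries deg (p - deg x) := by
      intro x k
      rw [hpart, hpoly]
      exact hu k x
    have hvan : ∀ x, ∀ w : List X, w.length ≤ n → v x w = 0 := by
      intro x w hw
      change u w.length x w = 0
      rw [hu0 _ hw]; rfl
    have hf' : f = ∑ x, (freeLie deg).bracket (add_sub_cancel (deg x) p)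
        (gen x (deg x) rfl) (⟨v x, hv x⟩ : (freeLie deg).obj (p - deg x)) := by
      apply Subtype.ext
      have hval : ((∑ x, (freeLie deg).bracket (add_sub_cancel (deg x) p)
          (gen x (deg x) rfl) (⟨v x, hv x⟩ : (freeLie deg).obj (p - deg x)) :
            lieSeries deg p) : Series X) =
          ∑ x, comm (deg x) (p - deg x) (letter x) (v x) := by
        refine (AddSubmonoidClass.coe_finsetSum _ _).trans ?_
        rfl
      refine Eq.trans ?_ hval.symm
      have hparts : ∀ k, part k f.1 =
          part k (∑ x, comm (deg x) (p - deg x) (letter x) (v x)) := by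
        intro k
        cases k with
        | zero =>
          funext w
          simp only [part_apply]
          split_ifs with hw
          · rw [List.length_eq_zero_iff.mp hw, lieSeries_nil f.2, Finset.sum_apply]
            symm
            refine Finset.sum_eq_zero fun x _ => ?_
            exact lieSeries_nil (comm_mem (add_sub_cancel (deg x) p) (letter_mem rfl) (hv x))
          · rfl
        | succ k =>
          rw [hsum k, map_sum]
          refine Finset.sum_congr rfl fun x _ => ?_
          rw [part_comm_letter, hpart, hpoly]
      funext w
      have := congrFun (hparts w.length) w
      simpa [part_apply] using this
    rw [hf']
    refine Submodule.sum_mem _ fun x _ => Submodule.subset_span ?_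
    exact ⟨deg x, p - deg x, add_sub_cancel _ _, gen x (deg x) rfl, ⟨v x, hv x⟩,
      ih _ _ (hvan x), rfl⟩

end FreeLie

open FreeLie in
lemma freeLie_isComplete {X : Type} [Finite X] (deg : X → ℤ) : (freeLie deg).IsComplete := by
  intro p
  refine ⟨fun f hf => Subtype.ext ?_, fun u hu => ?_⟩
  · funext w
    exact vanish_of_mem_lcs w.length p f (hf _) w le_rfl
  · have hstep : ∀ (n : ℕ) (w : List X), w.length ≤ n → (u (n + 1)).1 w = (u n).1 w :=
      fun n w hw => sub_eq_zero.mp (vanish_of_mem_lcs n p _ (hu n) w hw)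
    have hstab : ∀ (w : List X) (n : ℕ), w.length ≤ n → (u w.length).1 w = (u n).1 w := by
      intro w n hn
      induction n, hn using Nat.le_induction with
      | base => rfl
      | succ n hn ih => rw [ih, hstep n w hn]
    have hmem : (fun w => (u w.length).1 w) ∈ lieSeries deg p := by
      intro k
      have : part k (fun w => (u w.length).1 w) = part k (u k).1 := by
        funext w
        simp only [part_apply]
        split_ifs with hw
        · subst hw; rfl
        · rfl
      rw [this]
      exact (u k).2 k
    refine ⟨⟨_, hmem⟩, fun n => mem_lcs_of_vanish n p _ fun w hw => ?_⟩
    exact sub_eq_zero.mpr (hstab w n hw)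

/-- The complete free graded Lie algebra on a finite graded set, with a given differential. -/
def freeCDGL {X : Type} [Finite X] {deg : X → ℤ} (δ : (freeLie deg).Differential) : CDGL where
  toGradedLie := freeLie deg
  complete := freeLie_isComplete deg
  d := δ

/-! ## The cylinder -/

section Cylinder

variable {X : Type} {deg : X → ℤ}

/-- Degrees of the generators of `𝕃̂(V ⊕ V' ⊕ sV')`, which are `v`, `v'` and `sv'`, and of
`𝕃̂(V ⊕ V̂ ⊕ V̄)`, which are `v`, `v̂` and `v̄`, one triple for each generator `v` of degree
`deg v`. -/
def cylDeg (deg : X → ℤ) : X ⊕ X ⊕ X → ℤ :=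
  Sum.elim deg (Sum.elim deg fun x => deg x + 1)

/-- The generator `v`. -/
def cylGen₀ (v : X) (p : ℤ) (h : deg v = p) : (freeLie (cylDeg deg)).obj p :=
  FreeLie.gen (deg := cylDeg deg) (Sum.inl v) p h

/-- The generator `v'`, respectively `v̂`. -/
def cylGen₁ (v : X) (p : ℤ) (h : deg v = p) : (freeLie (cylDeg deg)).obj p :=
  FreeLie.gen (deg := cylDeg deg) (Sum.inr (Sum.inl v)) p h

/-- The generator `sv'`, respectively `v̄`. -/
def cylGen₂ (v : X) (p : ℤ) (h : deg v + 1 = p) : (freeLie (cylDeg deg)).obj p :=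
  FreeLie.gen (deg := cylDeg deg) (Sum.inr (Sum.inr v)) p h

/-- The cylinder construction on the complete free differential graded Lie algebra `(𝕃̂(V), δ)`,
where `V` has the basis `X`. -/
structure Cylinder [Finite X] (δ : (freeLie deg).Differential) where
  /-- the differential `d` of `𝕃̂(V ⊕ V' ⊕ sV')` -/
  d : (freeLie (cylDeg deg)).Differential
  /-- `d` is `δ` on `𝕃̂(V)`: the inclusion `λ₀` with `λ₀ v = v` is a morphism -/
  lam₀ : freeCDGL δ ⟶ freeCDGL d
  lam₀_gen : ∀ (v : X) (p : ℤ) (h : deg v = p),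
    lam₀.toFun p (FreeLie.gen v p h) = cylGen₀ v p h
  /-- `d v' = 0` -/
  d_prime : ∀ (v : X) {p q : ℤ} (hp : deg v = p) (h : p + -1 = q),
    d.toFun h (cylGen₁ v p hp) = 0
  /-- `d (sv') = v'` -/
  d_susp : ∀ (v : X) {p q : ℤ} (hp : deg v + 1 = p) (hq : deg v = q) (h : p + -1 = q),
    d.toFun h (cylGen₂ v p hp) = cylGen₁ v q hq
  /-- the derivation `i` of degree `1` with `i v = sv'`, `i v' = 0`, `i (sv') = 0` -/
  i : (freeLie (cylDeg deg)).Derivation 1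
  i_base : ∀ (v : X) {p q : ℤ} (hp : deg v = p) (hq : deg v + 1 = q) (h : p + 1 = q),
    i.toFun h (cylGen₀ v p hp) = cylGen₂ v q hq
  i_prime : ∀ (v : X) {p q : ℤ} (hp : deg v = p) (h : p + 1 = q),
    i.toFun h (cylGen₁ v p hp) = 0
  i_susp : ∀ (v : X) {p q : ℤ} (hp : deg v + 1 = p) (h : p + 1 = q),
    i.toFun h (cylGen₂ v p hp) = 0
  /-- the differential `D` of `𝕃̂(V ⊕ V̂ ⊕ V̄)` -/
  D : (freeLie (cylDeg deg)).Differential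
  /-- the isomorphism `ψ` with `D = ψ⁻¹ d ψ`, `ψ v = v`, `ψ v̂ = e^θ v`, `ψ v̄ = sv'`, where
  `θ = i d + d i` -/
  ψ : freeCDGL D ≅ freeCDGL d
  ψ_base : ∀ (v : X) (p : ℤ) (h : deg v = p),
    ψ.hom.toFun p (cylGen₀ v p h) = cylGen₀ v p h
  ψ_hat : ∀ (v : X) (p : ℤ) (h : deg v = p),
    (freeLie (cylDeg deg)).HasExp
      (i.toFun (neg_add_cancel_right p 1) ∘ₗ d.toFun rfl +
        d.toFun (add_neg_cancel_right p 1) ∘ₗ i.toFun rfl)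
      (cylGen₀ v p h) (ψ.hom.toFun p (cylGen₁ v p h))
  ψ_bar : ∀ (v : X) (p : ℤ) (h : deg v + 1 = p),
    ψ.hom.toFun p (cylGen₂ v p h) = cylGen₂ v p h
  /-- the inclusion `ι₁` with `ι₁ v = v̂` -/
  ι₁ : freeCDGL δ ⟶ freeCDGL D
  ι₁_gen : ∀ (v : X) (p : ℤ) (h : deg v = p),
    ι₁.toFun p (FreeLie.gen v p h) = cylGen₁ v p h

end Cylinder

/-! ## Models of simplices and of finite simplicial complexes

A finite simplicial complex is given as a subcomplex of a simplex `Δⁿ`, the complex of all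
nonempty subsets of `Fin (n + 1)`. -/

/-- A simplex `σ` of dimension `p` gives a generator `a_σ` of degree `p - 1`. -/
def simplexDeg {n : ℕ} (K : PreAbstractSimplicialComplex (Fin (n + 1))) (σ : K.faces) : ℤ :=
  (σ.1.card : ℤ) - 2

/-- The standard simplex `Δⁿ`. -/
abbrev fullSimplex (n : ℕ) : PreAbstractSimplicialComplex (Fin (n + 1)) := ⊤

/-- The only simplex of `Δ⁰`. -/
def point : (fullSimplex 0).faces := ⟨{0}, Finset.singleton_nonempty 0⟩

/-- The generator of `𝕃̂(s⁻¹C_*(Δ⁰))`. -/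
def pointGen : (freeLie (simplexDeg (fullSimplex 0))).obj (-1) :=
  FreeLie.gen point (-1) (by simp [simplexDeg, point])

/-- The simplicial cone on `K ⊆ Δⁿ`, a subcomplex of `Δⁿ⁺¹` whose apex is the last vertex: a
nonempty set of vertices is a simplex of the cone if the vertices other than the apex form a
simplex of `K` or the empty set. -/
def coneComplex {n : ℕ} (K : PreAbstractSimplicialComplex (Fin (n + 1))) :
    PreAbstractSimplicialComplex (Fin (n + 1 + 1)) where
  faces := {s | s.Nonempty ∧
    ∀ t : Finset (Fin (n + 1)), t.Nonempty → t.map Fin.castSuccEmb ⊆ s → t ∈ K.faces}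
  isRelLowerSet_faces := fun _ hs =>
    ⟨hs.1, fun _ hts ht => ⟨ht, fun u hu hut => hs.2 u hu (hut.trans hts)⟩⟩

/-- The models of the simplices `Δⁿ`: differentials on the complete free graded Lie algebras
`𝕃̂(s⁻¹C_*(Δⁿ))` such that the generator of `Δ⁰` is a Maurer-Cartan element, the linear part is
the desuspension of the simplicial boundary, and the injections of faces induce morphisms. -/
structure SimplexModels where
  diff : ∀ n : ℕ, (freeLie (simplexDeg (fullSimplex n))).Differential
  isMC : (freeCDGL (diff 0)).IsMC pointGen
  linear : ∀ (n : ℕ) (σ τ : (fullSimplex n).faces) {q : ℤ} (h : simplexDeg _ σ + -1 = q),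
    FreeLie.coeff ((diff n).toFun h (FreeLie.gen σ _ rfl)) [τ] =
      ∑ v ∈ σ.1, if τ.1 = σ.1.erase v then (-1 : ℚ) ^ (σ.1.filter (· < v)).card else 0
  natural : ∀ (m n : ℕ) (e : Fin (m + 1) ↪o Fin (n + 1)),
    ∃ φ : freeCDGL (diff m) ⟶ freeCDGL (diff n),
      ∀ (σ : (fullSimplex m).faces) (τ : (fullSimplex n).faces), τ.1 = σ.1.map e.toEmbedding →
        ∀ (p : ℤ) (hσ : simplexDeg _ σ = p) (hτ : simplexDeg _ τ = p),
          φ.toFun p (FreeLie.gen σ p hσ) = FreeLie.gen τ p hτ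

namespace SimplexModels

variable (M : SimplexModels)

/-- The model of `Δⁿ`. -/
def simplex (n : ℕ) : CDGL := freeCDGL (M.diff n)

/-- `(𝕃̂(s⁻¹C_*(K)), δ)` is the model of `K ⊆ Δⁿ`: `δ` is the restriction of the differential of
the model of `Δⁿ`. -/
def IsModelOf {n : ℕ} (K : PreAbstractSimplicialComplex (Fin (n + 1)))
    (δ : (freeLie (simplexDeg K)).Differential) : Prop :=
  ∃ φ : freeCDGL δ ⟶ M.simplex n,
    ∀ (σ : K.faces) (τ : (fullSimplex n).faces), τ.1 = σ.1 →
      ∀ (p : ℤ) (hσ : simplexDeg _ σ = p) (hτ : simplexDeg _ τ = p),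
        φ.toFun p (FreeLie.gen σ p hσ) = FreeLie.gen (deg := simplexDeg (fullSimplex n)) τ p hτ

/-- The morphism that is induced by the projection of `K` to a point: the generators of vertices
go to the Maurer-Cartan element of the model of `Δ⁰`, all others to zero. -/
def IsCollapse {n : ℕ} {K : PreAbstractSimplicialComplex (Fin (n + 1))}
    {δ : (freeLie (simplexDeg K)).Differential} (ρ : freeCDGL δ ⟶ M.simplex 0) : Prop :=
  (∀ (σ : K.faces) (hσ : simplexDeg _ σ = -1),
    ρ.toFun (-1) (FreeLie.gen σ (-1) hσ) = pointGen) ∧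
  ∀ (σ : K.faces) (p : ℤ) (hσ : simplexDeg _ σ = p), p ≠ -1 →
    ρ.toFun p (FreeLie.gen σ p hσ) = 0

/-- `C` is the cone on `(𝕃̂(s⁻¹C_*(K)), δ)`, the pushout of the collapse map along the inclusion
`ι₁` into the cylinder. -/
def IsCone {n : ℕ} {K : PreAbstractSimplicialComplex (Fin (n + 1))}
    (δ : (freeLie (simplexDeg K)).Differential) (C : CDGL) : Prop :=
  ∃ (Z : Cylinder δ) (ρ : freeCDGL δ ⟶ M.simplex 0) (f : freeCDGL Z.D ⟶ C)
    (g : M.simplex 0 ⟶ C), M.IsCollapse ρ ∧ IsPushout Z.ι₁ ρ f g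

end SimplexModels

end

noncomputable section

namespace GradedLie

/-! Both isomorphisms pass through one algebra that depends only on the degrees of the simplices of
`K`: the algebra `canDiff`, free on a Maurer-Cartan element `a` and on a pair `w_σ`, `z_σ = d w_σ`
for each simplex `σ`.

Cylinder side. The generators `v, v̂, v̄` of the cylinder are traded for `v̂, D v̄, v̄`. This is
allowed because `v` occurs in the linear part of `D v̄`: `ψ` sends `D v̄` to `d (sv') = v'`, whereas
`e^θ v` is `v + v'` modulo brackets and the generators `su'`, so the coefficient of `u` in `D v̄` is
`-1` for `u = v` and `0` otherwise (`linCoeff_D_bar`). No more of `D v̄` needs to be known. In the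
new generators `D` is the old differential on the `v̂`, and the pairs `v̄, D v̄` split off. Hence,
as an algebra under `𝕃̂(V)`, the cylinder along `ι₁` is `𝕃̂(V ⊕ V' ⊕ sV')` along `lam₀`
(`Cylinder.unroll`). Pushing out along the collapse replaces `𝕃̂(V)` by `𝕃̂(a)` and keeps the pairs
(`isPushout_ι₁`).

Simplicial side. In the model of the simplicial cone, `a` goes to the apex, `w_σ` to the generator
of the join of `σ` with the apex, and `z_σ` to the boundary of that generator. The only facet of the
join without the apex is `σ`, so the linear part of this boundary is `±a_σ` plus generators of
simplices that contain the apex (`iso_cone_model`).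

Both changes of generators are instances of `bijective_of_triangular`: a morphism with triangular
linear part has an inverse up to brackets, and an endomorphism that is the identity modulo brackets
is bijective by successive approximation (`LieMap.bijective_of_sub_mem`).

Existence. The cylinder exists because `θ²` takes everything into brackets, so that `e^θ` converges
and commutes with `d` (`theta_nilpotent`, `d_expTheta`). The model of `K` exists because naturality
confines the boundary of a generator to the faces of its simplex (`exists_diff`). The collapse is a
morphism because the algebra on one generator of degree `-1` vanishes in degrees `≥ 0`, and the
boundary coefficients of an edge add up to zero. -/

lemma units_smul_mem {V : Type*} [AddCommGroup V] [Module ℚ V] (S : Submodule ℚ V) (e : ℤˣ) {x : V}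
    (hx : x ∈ S) : e • x ∈ S := by
  rcases Int.units_eq_one_or e with h | h <;> simp [h, hx]

lemma map_units_smul {V W : Type*} [AddCommGroup V] [Module ℚ V] [AddCommGroup W] [Module ℚ W]
    (f : V →ₗ[ℚ] W) (e : ℤˣ) (x : V) : f (e • x) = e • f x := by
  rcases Int.units_eq_one_or e with h | h <;> simp [h]

/-- Morphisms of graded Lie algebras. -/
structure LieMap (L M : GradedLie) where
  toFun : ∀ p : ℤ, L.obj p →ₗ[ℚ] M.obj p
  map_bracket : ∀ {p q r : ℤ} (h : p + q = r) (x : L.obj p) (y : L.obj q),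
    toFun r (L.bracket h x y) = M.bracket h (toFun p x) (toFun q y)

/-- The composition of morphisms. -/
def LieMap.comp {L M N : GradedLie} (g : LieMap M N) (f : LieMap L M) : LieMap L N where
  toFun p := (g.toFun p).comp (f.toFun p)
  map_bracket h x y := by simp [f.map_bracket, g.map_bracket]

/-- The identity. -/
def LieMap.id (L : GradedLie) : LieMap L L where
  toFun _ := LinearMap.id
  map_bracket _ _ _ := rfl

/-! ### The lower central series filtration -/

section lcs

variable {L M : GradedLie}

lemma mem_lcs_zero {p : ℤ} (x : L.obj p) : x ∈ L.lcs 0 p := Submodule.mem_top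

lemma bracket_mem_lcs_succ {n : ℕ} {p q r : ℤ} (h : p + q = r) (x : L.obj p) {y : L.obj q}
    (hy : y ∈ L.lcs n q) : L.bracket h x y ∈ L.lcs (n + 1) r :=
  Submodule.subset_span ⟨p, q, h, x, y, hy, rfl⟩

/-- Induction over the generators of a term of the lower central series. -/
lemma lcs_succ_le {n : ℕ} {r : ℤ} {S : Submodule ℚ (L.obj r)}
    (H : ∀ {p q : ℤ} (h : p + q = r) (x : L.obj p) (y : L.obj q), y ∈ L.lcs n q →
      L.bracket h x y ∈ S) : L.lcs (n + 1) r ≤ S := by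
  refine Submodule.span_le.mpr ?_
  rintro _ ⟨p, q, h, x, y, hy, rfl⟩
  exact H h x y hy

lemma lcs_succ_le_lcs (n : ℕ) : ∀ p, L.lcs (n + 1) p ≤ L.lcs n p := by
  induction n with
  | zero => intro p; exact le_top
  | succ n ih => intro p; exact lcs_succ_le fun h x y hy => bracket_mem_lcs_succ h x (ih _ hy)

/-- Induction on the left index: the Jacobi identity rewrites `[[u, v], y]` through `[u, [v, y]]`
and `[v, [u, y]]`, and both use only the lower index of `v`. The `+ 1` reflects the convention `lcs
0 = L`. -/
lemma bracket_mem_lcs (m : ℕ) : ∀ {n : ℕ} {p q r : ℤ} (h : p + q = r) {x : L.obj p} {y : L.obj q},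
    x ∈ L.lcs m p → y ∈ L.lcs n q → L.bracket h x y ∈ L.lcs (m + n + 1) r := by
  induction m with
  | zero => intro n p q r h x y _ hy; rw [zero_add]; exact bracket_mem_lcs_succ h x hy
  | succ m ih =>
    intro n p q r h x y hx hy
    suffices H : L.lcs (m + 1) p ≤ (L.lcs (m + 1 + n + 1) r).comap ((L.bracket h).flip y) from H hx
    refine lcs_succ_le fun {a b} hab u v hv => ?_
    rw [Submodule.mem_comap, LinearMap.flip_apply]
    have e := L.jacobi (rfl : b + q = b + q) hab (rfl : a + q = a + q) (by omega) h
      (by omega : b + (a + q) = r) u v y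
    rw [← sub_eq_iff_eq_add] at e
    rw [← e]
    refine Submodule.sub_mem _ ?_ (units_smul_mem _ _ ?_)
    · have := bracket_mem_lcs_succ (by omega : a + (b + q) = r) u (ih rfl hv hy)
      rwa [show m + n + 1 + 1 = m + 1 + n + 1 by omega] at this
    · have := ih (by omega : b + (a + q) = r) hv (bracket_mem_lcs_succ (rfl : a + q = a + q) u hy)
      rwa [show m + (n + 1) + 1 = m + 1 + n + 1 by omega] at this

lemma bracket_mem_lcs_left {n : ℕ} {p q r : ℤ} (h : p + q = r) {x : L.obj p} (y : L.obj q)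
    (hx : x ∈ L.lcs n p) : L.bracket h x y ∈ L.lcs (n + 1) r :=
  bracket_mem_lcs n (n := 0) h hx (mem_lcs_zero y)

/-- Morphisms, like derivations below, are automatically continuous. This is why identities between
them may be checked on generators of a complete free algebra. -/
lemma LieMap.map_lcs (f : LieMap L M) (n : ℕ) :
    ∀ {p : ℤ} {x : L.obj p}, x ∈ L.lcs n p → f.toFun p x ∈ M.lcs n p := by
  induction n with
  | zero => intro p x _; exact mem_lcs_zero _
  | succ n ih =>
    intro p x hx
    suffices H : L.lcs (n + 1) p ≤ (M.lcs (n + 1) p).comap (f.toFun p) from H hx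
    refine lcs_succ_le fun h x y hy => ?_
    rw [Submodule.mem_comap, f.map_bracket]
    exact bracket_mem_lcs_succ h _ (ih hy)

lemma Derivation.map_lcs {k : ℤ} (D : L.Derivation k) (n : ℕ) :
    ∀ {p q : ℤ} (h : p + k = q) {x : L.obj p}, x ∈ L.lcs n p → D.toFun h x ∈ L.lcs n q := by
  induction n with
  | zero => intro p q h x _; exact mem_lcs_zero _
  | succ n ih =>
    intro p q h x hx
    suffices H : L.lcs (n + 1) p ≤ (L.lcs (n + 1) q).comap (D.toFun h) from H hx
    refine lcs_succ_le fun {a b} hab x y hy => ?_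
    rw [Submodule.mem_comap, D.leibniz hab h (rfl : a + k = a + k) (rfl : b + k = b + k) (by omega)
      (by omega)]
    exact Submodule.add_mem _ (bracket_mem_lcs_succ _ _ hy)
      (units_smul_mem _ _ (bracket_mem_lcs_succ _ _ (ih rfl hy)))

end lcs

lemma IsComplete.eq_of_sub_mem {L : GradedLie} (hL : L.IsComplete) {p : ℤ} {x y : L.obj p}
    (h : ∀ n, x - y ∈ L.lcs n p) : x = y :=
  sub_eq_zero.mp ((hL p).1 _ h)

/-! ### Endomorphisms that are the identity modulo brackets -/

section unipotent

variable {L : GradedLie}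

/-- By the telescoping `[ux, uy] - [x, y] = [ux - x, uy] + [x, uy - y]`, the gain of one level at
the top of the filtration propagates to every level. -/
lemma LieMap.sub_mem_lcs (u : LieMap L L) (hu : ∀ p (x : L.obj p), u.toFun p x - x ∈ L.lcs 1 p)
    (n : ℕ) : ∀ {p : ℤ} {x : L.obj p}, x ∈ L.lcs n p → u.toFun p x - x ∈ L.lcs (n + 1) p := by
  induction n with
  | zero => intro p x _; exact hu p x
  | succ n ih =>
    intro p x hx
    suffices H : L.lcs (n + 1) p ≤ (L.lcs (n + 1 + 1) p).comap (u.toFun p - LinearMap.id) from H hx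
    refine lcs_succ_le fun h x y hy => ?_
    rw [Submodule.mem_comap, LinearMap.sub_apply, u.map_bracket, LinearMap.id_apply]
    have e : L.bracket h (u.toFun _ x) (u.toFun _ y) - L.bracket h x y =
        L.bracket h (u.toFun _ x - x) (u.toFun _ y) + L.bracket h x (u.toFun _ y - y) := by
      simp
    rw [e]
    refine Submodule.add_mem _ ?_ (bracket_mem_lcs_succ h x (ih hy))
    have := bracket_mem_lcs 1 h (hu _ x) (u.map_lcs n hy)
    rwa [show 1 + n + 1 = n + 1 + 1 by omega] at this

/-- An endomorphism that is the identity modulo brackets is bijective. -/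
lemma LieMap.bijective_of_sub_mem (hL : L.IsComplete) (u : LieMap L L)
    (hu : ∀ p (x : L.obj p), u.toFun p x - x ∈ L.lcs 1 p) (p : ℤ) :
    Function.Bijective (u.toFun p) := by
  constructor
  · rw [injective_iff_map_eq_zero]
    intro x hx
    -- If `u x = 0` then `x = -(u x - x)`, so membership in `lcs n` improves to `lcs (n + 1)`.
    refine (hL p).1 x fun n => ?_
    induction n with
    | zero => exact mem_lcs_zero _
    | succ n ih => simpa [hx] using u.sub_mem_lcs hu n ih
  · intro y
    -- Successive approximation: the current error `y - u x` is added to `x`. The new error is `-(u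
    -- - 1)` applied to the old one, hence one level deeper.
    let s : ℕ → L.obj p := fun n => Nat.rec 0 (fun _ x => x + (y - u.toFun p x)) n
    have hs : ∀ n, s (n + 1) = s n + (y - u.toFun p (s n)) := fun n => rfl
    have hr : ∀ n, y - u.toFun p (s n) ∈ L.lcs n p := by
      intro n
      induction n with
      | zero => exact mem_lcs_zero _
      | succ n ih =>
        have := u.sub_mem_lcs hu n ih
        rw [hs, map_add, ← Submodule.neg_mem_iff]
        convert this using 1
        abel
    obtain ⟨x, hx⟩ := (hL p).2 s fun n => by rw [hs, add_sub_cancel_left]; exact hr n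
    refine ⟨x, hL.eq_of_sub_mem fun n => ?_⟩
    have h1 := u.map_lcs n (hx n)
    rw [map_sub] at h1
    have h2 := Submodule.sub_mem _ h1 (hr n)
    convert h2 using 1
    abel

/-- The inverse of a bijective morphism. -/
def LieMap.inverse {M : GradedLie} (f : LieMap L M)
    (hf : ∀ p, Function.Bijective (f.toFun p)) : LieMap M L where
  toFun p := (LinearEquiv.ofBijective (f.toFun p) (hf p)).symm
  map_bracket {p q r} h x y := by
    refine (hf r).1 ?_
    rw [f.map_bracket]
    have e : ∀ p (x : M.obj p),
        f.toFun p ((LinearEquiv.ofBijective (f.toFun p) (hf p)).symm x) = x :=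
      fun p x => (LinearEquiv.ofBijective (f.toFun p) (hf p)).apply_symm_apply x
    erw [e, e, e]

lemma LieMap.apply_inverse {M : GradedLie} (f : LieMap L M)
    (hf : ∀ p, Function.Bijective (f.toFun p)) (p : ℤ) (x : M.obj p) :
    f.toFun p ((f.inverse hf).toFun p x) = x :=
  (LinearEquiv.ofBijective (f.toFun p) (hf p)).apply_symm_apply x

end unipotent

/-! ### Exponentials of derivations of degree zero -/

section exp

variable {L : GradedLie}

lemma HasExp.unique (hL : L.IsComplete) {p : ℤ} {θ : Module.End ℚ (L.obj p)} {v y y' : L.obj p}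
    (h : L.HasExp θ v y) (h' : L.HasExp θ v y') : y = y' := by
  refine hL.eq_of_sub_mem fun n => ?_
  obtain ⟨N, hN⟩ := h n
  obtain ⟨N', hN'⟩ := h' n
  simpa using Submodule.sub_mem _ (hN (max N N') (le_max_left _ _))
    (hN' (max N N') (le_max_right _ _))

lemma HasExp.add {p : ℤ} {θ : Module.End ℚ (L.obj p)} {v v' y y' : L.obj p}
    (h : L.HasExp θ v y) (h' : L.HasExp θ v' y') : L.HasExp θ (v + v') (y + y') := by
  intro n
  obtain ⟨N, hN⟩ := h n
  obtain ⟨N', hN'⟩ := h' n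
  refine ⟨max N N', fun k hk => ?_⟩
  convert Submodule.add_mem _ (hN k (le_trans (le_max_left _ _) hk))
    (hN' k (le_trans (le_max_right _ _) hk)) using 1
  simp only [map_add, smul_add, Finset.sum_add_distrib]
  abel

lemma HasExp.smul {p : ℤ} {θ : Module.End ℚ (L.obj p)} {v y : L.obj p}
    (h : L.HasExp θ v y) (c : ℚ) : L.HasExp θ (c • v) (c • y) := by
  intro n
  obtain ⟨N, hN⟩ := h n
  refine ⟨N, fun k hk => ?_⟩
  convert Submodule.smul_mem _ c (hN k hk) using 1
  simp only [map_smul, smul_sub, Finset.smul_sum, smul_comm c]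

/-- A linear map that respects the lower central series and intertwines two endomorphisms
intertwines their exponentials. -/
lemma HasExp.map {M : GradedLie} {p q : ℤ} {θ : Module.End ℚ (L.obj p)}
    {η : Module.End ℚ (M.obj q)} {v y : L.obj p} (h : L.HasExp θ v y)
    (f : L.obj p →ₗ[ℚ] M.obj q) (hf : ∀ n x, x ∈ L.lcs n p → f x ∈ M.lcs n q)
    (hθ : ∀ x, f (θ x) = η (f x)) : M.HasExp η (f v) (f y) := by
  have hk : ∀ (k : ℕ) x, f ((θ ^ k) x) = (η ^ k) (f x) := by
    intro k
    induction k with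
    | zero => intro x; rfl
    | succ k ih => intro x; rw [pow_succ, pow_succ, Module.End.mul_apply, Module.End.mul_apply, ih, hθ]
  intro n
  obtain ⟨N, hN⟩ := h n
  refine ⟨N, fun k hk' => ?_⟩
  convert hf n _ (hN k hk') using 1
  simp [hk]

/-- Divided powers of an endomorphism. -/
def divPow {V : Type*} [AddCommGroup V] [Module ℚ V] (θ : Module.End ℚ V) (k : ℕ) :
    Module.End ℚ V := ((k.factorial : ℚ)⁻¹) • θ ^ k

lemma divPow_zero {V : Type*} [AddCommGroup V] [Module ℚ V] (θ : Module.End ℚ V) :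
    divPow θ 0 = 1 := by simp [divPow]

lemma divPow_succ {V : Type*} [AddCommGroup V] [Module ℚ V] (θ : Module.End ℚ V) (k : ℕ) (x : V) :
    ((k : ℚ) + 1) • divPow θ (k + 1) x = θ (divPow θ k x) := by
  simp only [divPow, LinearMap.smul_apply, map_smul, pow_succ', Module.End.mul_apply, smul_smul]
  congr 1
  rw [Nat.factorial_succ]
  have : (k.factorial : ℚ) ≠ 0 := by exact_mod_cast k.factorial_ne_zero
  have : (k : ℚ) + 1 ≠ 0 := by positivity
  push_cast
  field_simp

/-- Divided powers free the Leibniz rule of binomial coefficients. In the induction the factor `k +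
1 = i + j` is distributed over the two arguments, where `divPow_succ` absorbs it. -/
lemma divPow_bracket (θ : ∀ p : ℤ, Module.End ℚ (L.obj p))
    (hθ : ∀ {p q r : ℤ} (h : p + q = r) (x : L.obj p) (y : L.obj q),
      θ r (L.bracket h x y) = L.bracket h (θ p x) y + L.bracket h x (θ q y))
    (k : ℕ) {p q r : ℤ} (h : p + q = r) (x : L.obj p) (y : L.obj q) :
    divPow (θ r) k (L.bracket h x y) = ∑ ij ∈ Finset.HasAntidiagonal.antidiagonal k,
      L.bracket h (divPow (θ p) ij.1 x) (divPow (θ q) ij.2 y) := by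
  induction k with
  | zero => simp [divPow_zero]
  | succ k ih =>
    have hk : ((k : ℚ) + 1) ≠ 0 := by positivity
    apply smul_right_injective _ hk
    simp only
    rw [divPow_succ, ih, map_sum, Finset.smul_sum]
    simp only [hθ, ← divPow_succ, Finset.sum_add_distrib, map_smul, LinearMap.smul_apply]
    have e : ∀ ij ∈ Finset.HasAntidiagonal.antidiagonal (k + 1), ((k : ℚ) + 1) •
        L.bracket h (divPow (θ p) ij.1 x) (divPow (θ q) ij.2 y) =
        (ij.1 : ℚ) • L.bracket h (divPow (θ p) ij.1 x) (divPow (θ q) ij.2 y) +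
        (ij.2 : ℚ) • L.bracket h (divPow (θ p) ij.1 x) (divPow (θ q) ij.2 y) := by
      intro ij hij
      rw [← add_smul]
      congr 1
      have := Finset.HasAntidiagonal.mem_antidiagonal.mp hij
      exact_mod_cast this.symm
    rw [Finset.sum_congr rfl e, Finset.sum_add_distrib, Finset.Nat.sum_antidiagonal_succ,
      Finset.Nat.sum_antidiagonal_succ']
    simp

lemma divPow_mem_iff {p : ℤ} (θ : ∀ p : ℤ, Module.End ℚ (L.obj p)) (k : ℕ) (S : Submodule ℚ (L.obj p)) (x : L.obj p) :
    divPow (θ p) k x ∈ S ↔ (θ p ^ k) x ∈ S := by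
  have : ((k.factorial : ℚ)⁻¹) ≠ 0 := by
    have := k.factorial_ne_zero
    positivity
  rw [divPow, LinearMap.smul_apply, Submodule.smul_mem_iff _ this]

/-- The exponential of a derivation is compatible with brackets. -/
lemma HasExp.bracket (θ : ∀ p : ℤ, Module.End ℚ (L.obj p))
    (hθ : ∀ {p q r : ℤ} (h : p + q = r) (x : L.obj p) (y : L.obj q),
      θ r (L.bracket h x y) = L.bracket h (θ p x) y + L.bracket h x (θ q y))
    (hnil : ∀ n : ℕ, ∃ K : ℕ, ∀ k ≥ K, ∀ p (x : L.obj p), divPow (θ p) k x ∈ L.lcs n p)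
    {p q r : ℤ} (h : p + q = r) {x x' : L.obj p} {y y' : L.obj q}
    (hx : L.HasExp (θ p) x x') (hy : L.HasExp (θ q) y y') :
    L.HasExp (θ r) (L.bracket h x y) (L.bracket h x' y') := by
  intro n
  obtain ⟨K, hK⟩ := hnil n
  obtain ⟨N₁, h1⟩ := hx n
  obtain ⟨N₂, h2⟩ := hy n
  -- The bracket of two partial sums runs over the square `i, j < N`, the partial sum for the
  -- bracket over the triangle `i + j < N`. Off the triangle `i + j ≥ 2 * K`, so one of the indices
  -- is at least `K` and the term lies in `lcs n`.
  refine ⟨max (2 * K) (max N₁ N₂), fun N hN => ?_⟩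
  have h1 := h1 N (by omega)
  have h2 := h2 N (by omega)
  set A := ∑ k ∈ Finset.range N, ((k.factorial : ℚ)⁻¹) • (θ p ^ k) x with hA
  set B := ∑ k ∈ Finset.range N, ((k.factorial : ℚ)⁻¹) • (θ q ^ k) y with hB
  have e1 : L.bracket h x' y' - L.bracket h A B =
      L.bracket h (x' - A) y' + L.bracket h A (y' - B) := by simp
  have m1 : L.bracket h x' y' - L.bracket h A B ∈ L.lcs n r := by
    rw [e1]
    exact lcs_succ_le_lcs _ _ (Submodule.add_mem _ (bracket_mem_lcs_left h _ h1)
      (bracket_mem_lcs_succ h _ h2))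
  have e2 : L.bracket h A B = ∑ ij ∈ Finset.range N ×ˢ Finset.range N,
      L.bracket h (divPow (θ p) ij.1 x) (divPow (θ q) ij.2 y) := by
    rw [Finset.sum_product, hA, map_sum (L.bracket h), LinearMap.sum_apply]
    refine Finset.sum_congr rfl fun i _ => ?_
    rw [hB, map_sum]
    rfl
  have e3 : ∑ k ∈ Finset.range N, ((k.factorial : ℚ)⁻¹) • (θ r ^ k) (L.bracket h x y) =
      ∑ ij ∈ (Finset.range N ×ˢ Finset.range N).filter (fun ij => ij.1 + ij.2 < N),
        L.bracket h (divPow (θ p) ij.1 x) (divPow (θ q) ij.2 y) := by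
    have : ∀ k, ((k.factorial : ℚ)⁻¹) • (θ r ^ k) (L.bracket h x y) =
      divPow (θ r) k (L.bracket h x y) := fun _ => rfl
    simp only [this, divPow_bracket θ hθ]
    rw [Finset.sum_sigma']
    refine Finset.sum_bij' (fun a _ => a.2) (fun b _ => ⟨b.1 + b.2, b⟩) ?_ ?_ ?_ ?_ ?_
    · rintro ⟨k, i, j⟩ hk
      simp at hk ⊢
      omega
    · rintro ⟨i, j⟩ hk
      simp at hk ⊢
      omega
    · rintro ⟨k, i, j⟩ hk
      simp at hk ⊢
      omega
    · rintro ⟨i, j⟩ _; rfl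
    · rintro ⟨k, i, j⟩ _; rfl
  have e4 : L.bracket h A B -
      ∑ k ∈ Finset.range N, ((k.factorial : ℚ)⁻¹) • (θ r ^ k) (L.bracket h x y) ∈ L.lcs n r := by
    rw [e2, e3, ← Finset.sum_filter_add_sum_filter_not (Finset.range N ×ˢ Finset.range N)
      (fun ij => ij.1 + ij.2 < N), add_sub_cancel_left]
    refine Submodule.sum_mem _ fun ij hij => ?_
    have hij' := (Finset.mem_filter.mp hij).2
    by_cases hi : K ≤ ij.1
    · exact lcs_succ_le_lcs _ _ (bracket_mem_lcs_left h _ (hK _ hi _ _))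
    · exact lcs_succ_le_lcs _ _ (bracket_mem_lcs_succ h _ (hK _ (by omega) _ _))
  simpa using Submodule.add_mem _ m1 e4

/-- A derivation that is nilpotent on the abelianization is nilpotent modulo every term of the
lower central series. -/
lemma divPow_mem_lcs (θ : ∀ p : ℤ, Module.End ℚ (L.obj p))
    (hθ : ∀ {p q r : ℤ} (h : p + q = r) (x : L.obj p) (y : L.obj q),
      θ r (L.bracket h x y) = L.bracket h (θ p x) y + L.bracket h x (θ q y))
    {m : ℕ} (hm : ∀ k ≥ m, ∀ p (x : L.obj p), divPow (θ p) k x ∈ L.lcs 1 p)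
    (n : ℕ) : ∃ K : ℕ, ∀ k ≥ K, ∀ p (x : L.obj p), divPow (θ p) k x ∈ L.lcs n p := by
  have stab : ∀ n p (x : L.obj p), x ∈ L.lcs n p → θ p x ∈ L.lcs n p := by
    intro n
    induction n with
    | zero => intro p x _; exact mem_lcs_zero _
    | succ n ih =>
      intro p x hx
      suffices H : L.lcs (n + 1) p ≤ (L.lcs (n + 1) p).comap (θ p) from H hx
      refine lcs_succ_le fun h x y hy => ?_
      rw [Submodule.mem_comap, hθ]
      exact Submodule.add_mem _ (bracket_mem_lcs_succ _ _ hy) (bracket_mem_lcs_succ _ _ (ih _ _ hy))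
  have stabk : ∀ n k p (x : L.obj p), x ∈ L.lcs n p → divPow (θ p) k x ∈ L.lcs n p := by
    intro n k p x hx
    rw [divPow_mem_iff]
    induction k with
    | zero => exact hx
    | succ k ih => rw [pow_succ']; exact stab _ _ _ ih
  -- When `m + K` or more copies of `θ` are spread over `[x, y]`, either at least `m` fall on `x` or
  -- at least `K` fall on `y`; each alternative gains one level.
  have step : ∀ n, ∃ K : ℕ, ∀ k ≥ K, ∀ p (x : L.obj p), x ∈ L.lcs n p →
      divPow (θ p) k x ∈ L.lcs (n + 1) p := by
    intro n
    induction n with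
    | zero => exact ⟨m, fun k hk p x _ => hm k hk p x⟩
    | succ n ih =>
      obtain ⟨K, hK⟩ := ih
      refine ⟨m + K, fun k hk p x hx => ?_⟩
      suffices H : L.lcs (n + 1) p ≤ (L.lcs (n + 1 + 1) p).comap (divPow (θ p) k) from H hx
      refine lcs_succ_le fun h x y hy => ?_
      rw [Submodule.mem_comap, divPow_bracket θ hθ]
      refine Submodule.sum_mem _ fun ij hij => ?_
      have hij' := Finset.HasAntidiagonal.mem_antidiagonal.mp hij
      by_cases hi : m ≤ ij.1
      · have := bracket_mem_lcs 1 h (hm _ hi _ x) (stabk n ij.2 _ _ hy)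
        rwa [show 1 + n + 1 = n + 1 + 1 by omega] at this
      · exact bracket_mem_lcs_succ h _ (hK _ (by omega) _ _ hy)
  induction n with
  | zero => exact ⟨0, fun _ _ _ _ => mem_lcs_zero _⟩
  | succ n ih =>
    obtain ⟨K, hK⟩ := ih
    obtain ⟨K', hK'⟩ := step n
    refine ⟨K' + K, fun k hk p x => ?_⟩
    -- The composite of the divided powers of orders `K'` and `k - K'` is a nonzero multiple of the
    -- one of order `k`, so the factorials are stripped and restored.
    have h1 := hK' K' le_rfl p _ (hK (k - K') (by omega) p x)
    rw [divPow_mem_iff] at h1 ⊢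
    rw [divPow, LinearMap.smul_apply, map_smul, Submodule.smul_mem_iff _ (by
      have := (k - K').factorial_ne_zero
      positivity), ← Module.End.mul_apply, ← pow_add] at h1
    rwa [show K' + (k - K') = k by omega] at h1

lemma exists_hasExp (θ : ∀ p : ℤ, Module.End ℚ (L.obj p)) (hL : L.IsComplete)
    (hnil : ∀ n : ℕ, ∃ K : ℕ, ∀ k ≥ K, ∀ p (x : L.obj p), divPow (θ p) k x ∈ L.lcs n p)
    {p : ℤ} (x : L.obj p) : ∃ y, L.HasExp (θ p) x y := by
  choose K hK using hnil
  have tail : ∀ n N N', K n ≤ N → N ≤ N' →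
      ∑ k ∈ Finset.range N', divPow (θ p) k x - ∑ k ∈ Finset.range N, divPow (θ p) k x ∈
        L.lcs n p := by
    intro n N N' hN hN'
    rw [← Finset.sum_sdiff (Finset.range_mono hN'), add_sub_cancel_right]
    refine Submodule.sum_mem _ fun k hk => hK n k ?_ p x
    simp at hk
    omega
  -- Completeness asks that the `n`-th step lie in `lcs n`, so the partial sums are sampled along a
  -- monotone sequence that dominates `K`.
  let s : ℕ → ℕ := fun n => ∑ i ∈ Finset.range (n + 1), K i
  have hs : ∀ n, K n ≤ s n := fun n =>
    Finset.single_le_sum (f := K) (fun _ _ => Nat.zero_le _) (Finset.self_mem_range_succ n)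
  have hs' : ∀ n, s n ≤ s (n + 1) := fun n => by
    change _ ≤ ∑ i ∈ Finset.range (n + 1 + 1), K i
    rw [Finset.sum_range_succ]
    exact Nat.le_add_right _ _
  obtain ⟨y, hy⟩ := (hL p).2 (fun n => ∑ k ∈ Finset.range (s n), divPow (θ p) k x)
    fun n => tail n _ _ (hs n) (hs' n)
  refine ⟨y, fun n => ⟨s n, fun N hN => ?_⟩⟩
  have := Submodule.sub_mem _ (hy n) (tail n _ _ (hs n) hN)
  rw [sub_sub_sub_cancel_right] at this
  exact this

end exp

end GradedLie

namespace FreeLie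

open GradedLie

/-! ### Calculus of noncommutative power series -/

section series

variable {X Y : Type}

/-- The series vanishes on words of length at most `n`. -/
def Vanish (n : ℕ) : Submodule ℚ (Series X) where
  carrier := {f | ∀ w : List X, w.length ≤ n → f w = 0}
  zero_mem' _ _ := rfl
  add_mem' hf hg w hw := by simp [hf w hw, hg w hw]
  smul_mem' c f hf w hw := by simp [hf w hw]

/-- The series of the words that follow an initial letter `x`. -/
def tail (x : X) : Series X →ₗ[ℚ] Series X where
  toFun f := fun w => f (x :: w)
  map_add' _ _ := rfl
  map_smul' _ _ := rfl

/-- The unit series. -/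
def one : Series X := fun w => if w.length = 0 then 1 else 0

lemma tail_apply (x : X) (f : Series X) (w : List X) : tail x f w = f (x :: w) := rfl

lemma one_mul' (f : Series X) : mul one f = f := by
  funext w
  cases w with
  | nil => simp [mul_nil, one]
  | cons x w =>
    rw [mul_cons]
    have : (fun v => (one : Series X) (x :: v)) = 0 := by funext v; simp [one]
    rw [this, map_zero]
    simp [one]

lemma mul_one' (f : Series X) : mul f one = f := by
  funext w
  induction w generalizing f with
  | nil => simp [mul_nil, one]
  | cons x w ih =>
    rw [mul_cons, ih]
    simp [one]

lemma tail_mul (x : X) (f g : Series X) :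
    tail x (mul f g) = f [] • tail x g + mul (tail x f) g := by
  funext w
  simp only [tail_apply, mul_cons, Pi.add_apply, Pi.smul_apply, smul_eq_mul]
  rfl

open Classical in
lemma tail_letter (x y : X) : tail y (letter x) = if y = x then one else 0 := by
  funext w
  rw [tail_apply, letter]
  by_cases h : y = x
  · subst h; simp [one]
  · simp [h]

/-- A factor without constant term uses up at least one letter of `u`. This makes the recursions
below contract in word length. -/
lemma mul_apply_congr {f g g' : Series X} (hf : f [] = 0) {u : List X}
    (h : ∀ v : List X, v.length < u.length → g v = g' v) : mul f g u = mul f g' u := by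
  rw [mul_apply, mul_apply]
  refine Finset.sum_congr rfl fun i hi => ?_
  rcases Nat.eq_zero_or_pos i with rfl | hi0
  · simp [hf]
  · rcases Nat.eq_zero_or_pos u.length with hu | hu
    · rw [List.length_eq_zero_iff] at hu
      subst hu
      simp [hf]
    · rw [h]
      simp
      omega

lemma mul_vanish {f g : Series X} (hf : f [] = 0) {n : ℕ} (hg : ∀ w, w.length < n → g w = 0) :
    mul f g ∈ Vanish n := by
  intro w hw
  rw [mul_apply_congr (g' := 0) hf fun v hv => by rw [hg v (by omega)]; rfl]
  simp

/-! ### Substitution of series for letters -/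

section subst

variable [Fintype X] (g : X → Series Y)

/-- Approximations of the substitution of series for letters. -/
def substAux : ℕ → Series X →ₗ[ℚ] Series Y
  | 0 => (LinearMap.proj []).smulRight one
  | n + 1 => (LinearMap.proj []).smulRight one + ∑ x, (mul (g x)).comp ((substAux n).comp (tail x))

/-- The recursion substitutes into the decomposition `f = f [] · 1 + ∑ x · tail x f`. As the
substituted series will have no constant term, each round settles one more word length. -/
lemma substAux_succ (n : ℕ) (f : Series X) :
    substAux g (n + 1) f = f [] • one + ∑ x, mul (g x) (substAux g n (tail x f)) := by
  simp [substAux, LinearMap.sum_apply]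

/-- The substitution of series for letters. -/
def subst : Series X →ₗ[ℚ] Series Y where
  toFun f := fun u => substAux g u.length f u
  map_add' f f' := by funext u; simp
  map_smul' c f := by funext u; simp

variable {g}

lemma substAux_stable (hg : ∀ x, g x [] = 0) (n : ℕ) : ∀ (f : Series X) (u : List Y),
    u.length ≤ n → substAux g (n + 1) f u = substAux g n f u := by
  induction n with
  | zero =>
    intro f u hu
    obtain rfl := List.length_eq_zero_iff.mp (Nat.le_zero.mp hu)
    rw [substAux_succ]
    simp [mul_nil, hg, substAux]
  | succ n ih =>
    intro f u hu
    rw [substAux_succ, substAux_succ g n]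
    simp only [Pi.add_apply, Finset.sum_apply]
    congr 1
    exact Finset.sum_congr rfl fun x _ => mul_apply_congr (hg x) fun v hv => ih _ v (by omega)

lemma substAux_eq (hg : ∀ x, g x [] = 0) {n : ℕ} (f : Series X) (u : List Y) (h : u.length ≤ n) :
    substAux g n f u = subst g f u := by
  induction n, h using Nat.le_induction with
  | base => rfl
  | succ n hn ih => rw [substAux_stable hg n f u hn, ih]

lemma subst_eq (hg : ∀ x, g x [] = 0) (f : Series X) :
    subst g f = f [] • one + ∑ x, mul (g x) (subst g (tail x f)) := by
  funext u
  rw [← substAux_eq hg f u (Nat.le_succ _), substAux_succ]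
  simp only [Pi.add_apply, Finset.sum_apply]
  congr 1
  exact Finset.sum_congr rfl fun x _ => mul_apply_congr (hg x) fun v hv =>
    substAux_eq hg _ v hv.le

lemma subst_nil (hg : ∀ x, g x [] = 0) (f : Series X) : subst g f [] = f [] := by
  rw [subst_eq hg]
  simp [mul_nil, hg, one]

lemma subst_one (hg : ∀ x, g x [] = 0) : subst g (one : Series X) = one := by
  have : ∀ x : X, tail x one = 0 := fun x => by funext v; simp [one, tail_apply]
  rw [subst_eq hg]
  simp [this, one]

lemma subst_letter (hg : ∀ x, g x [] = 0) (x : X) : subst g (letter x) = g x := by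
  classical
  rw [subst_eq hg, Finset.sum_eq_single x]
  · simp [tail_letter, subst_one hg, mul_one', letter]
  · intro y _ hy; simp [tail_letter, hy]
  · simp

lemma subst_mul (hg : ∀ x, g x [] = 0) (f h : Series X) :
    subst g (mul f h) = mul (subst g f) (subst g h) := by
  -- Induction on the length of the output word: after one expansion by `subst_eq` the leading `g x`
  -- consumes a letter, so multiplicativity is needed only on shorter words.
  suffices H : ∀ (n : ℕ) (f : Series X) (u : List Y), u.length < n →
      subst g (mul f h) u = mul (subst g f) (subst g h) u by
    funext u; exact H _ f u (Nat.lt_succ_self _)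
  intro n
  induction n with
  | zero => intro f u hu; omega
  | succ n ih =>
    intro f u hu
    have e : mul (subst g f) (subst g h) =
        f [] • subst g h + ∑ x, mul (g x) (mul (subst g (tail x f)) (subst g h)) := by
      conv_lhs => rw [subst_eq hg f]
      simp [one_mul', LinearMap.sum_apply, mul_assoc']
    have e' : f [] • subst g h = (f [] * h []) • one +
        f [] • ∑ x, mul (g x) (subst g (tail x h)) := by
      conv_lhs => rw [subst_eq hg h]
      rw [smul_add, smul_smul]
    rw [e, e', subst_eq hg (mul f h)]
    simp only [tail_mul, map_add, map_smul, Finset.sum_add_distrib, mul_nil, ← Finset.smul_sum,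
      ← add_assoc]
    simp only [Pi.add_apply, Finset.sum_apply]
    congr 1
    exact Finset.sum_congr rfl fun x _ => mul_apply_congr (hg x) fun v hv => ih _ v (by omega)

lemma subst_comm (hg : ∀ x, g x [] = 0) (p q : ℤ) (f h : Series X) :
    subst g (comm p q f h) = comm p q (subst g f) (subst g h) := by
  rw [comm_apply, comm_apply, map_sub, map_units_smul, subst_mul hg, subst_mul hg]

lemma subst_vanish (hg : ∀ x, g x [] = 0) (n : ℕ) : ∀ {f : Series X}, f ∈ Vanish n →
    subst g f ∈ Vanish n := by
  induction n with
  | zero =>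
    intro f hf u hu
    obtain rfl := List.length_eq_zero_iff.mp (Nat.le_zero.mp hu)
    rw [subst_nil hg]
    exact hf [] le_rfl
  | succ n ih =>
    intro f hf
    rw [subst_eq hg, hf [] (Nat.zero_le _), zero_smul, zero_add]
    refine Submodule.sum_mem _ fun x _ => mul_vanish (hg x) fun w hw => ?_
    exact ih (f := tail x f) (fun v hv => hf (x :: v) (by simpa using hv)) w (by omega)

end subst

/-! ### Derivations with prescribed values on letters -/

section der

/-- The automorphism of series that multiplies `w` by the sign of a derivation of degree `k` that
moves past `w`. -/
def signMap (deg : X → ℤ) (k : ℤ) (f : Series X) : Series X :=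
  fun w => (k * (w.map deg).sum).negOnePow • f w

lemma signMap_nil (deg : X → ℤ) (k : ℤ) (f : Series X) : signMap deg k f [] = f [] := by
  simp [signMap]

lemma tail_signMap (deg : X → ℤ) (k : ℤ) (f : Series X) (x : X) :
    tail x (signMap deg k f) = (k * deg x).negOnePow • signMap deg k (tail x f) := by
  funext w
  simp only [tail_apply, signMap, List.map_cons, List.sum_cons, mul_add, Int.negOnePow_add,
    Pi.smul_apply, smul_smul]

variable [Fintype X] (deg : X → ℤ) (k : ℤ) (g : X → Series X)

/-- Coefficients of the derivation with prescribed values on letters. -/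
def derAux : List X → Series X → ℚ
  | [], _ => 0
  | y :: u, f => ∑ x, mul (g x) (tail x f) (y :: u) + (k * deg y).negOnePow • derAux u (tail y f)

lemma derAux_add (u : List X) : ∀ f f' : Series X,
    derAux deg k g u (f + f') = derAux deg k g u f + derAux deg k g u f' := by
  induction u with
  | nil => intro f f'; simp [derAux]
  | cons y u ih =>
    intro f f'
    simp only [derAux, map_add, ih, smul_add, Pi.add_apply, Finset.sum_add_distrib]
    abel

lemma derAux_smul (u : List X) : ∀ (c : ℚ) (f : Series X),
    derAux deg k g u (c • f) = c * derAux deg k g u f := by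
  induction u with
  | nil => intro c f; simp [derAux]
  | cons y u ih =>
    intro c f
    simp only [derAux, map_smul, ih, Pi.smul_apply, smul_eq_mul, ← Finset.mul_sum, mul_add,
      mul_smul_comm]

/-- The derivation with prescribed values on letters. -/
def der : Series X →ₗ[ℚ] Series X where
  toFun f := fun u => derAux deg k g u f
  map_add' f f' := by funext u; exact derAux_add deg k g u f f'
  map_smul' c f := by funext u; exact derAux_smul deg k g u c f

variable {g}

lemma der_nil (f : Series X) : der deg k g f [] = 0 := rfl

/-- The recursion is the Leibniz rule `D (x f) = g x · f ± x · D f`; a leading letter `y` survives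
in the second summand only for `x = y`. -/
lemma tail_der (f : Series X) (y : X) : tail y (der deg k g f) =
    ∑ x, tail y (mul (g x) (tail x f)) + (k * deg y).negOnePow • der deg k g (tail y f) := by
  funext u
  simp only [Pi.add_apply, Finset.sum_apply]
  rfl

/-- For a general series the sign varies with the word that the derivation passes, hence `signMap`;
on a homogeneous Lie series it becomes a constant by `signMap_of_mem`. -/
lemma der_mul (hg : ∀ x, g x [] = 0) (f h : Series X) :
    der deg k g (mul f h) = mul (der deg k g f) h + mul (signMap deg k f) (der deg k g h) := by
  funext u
  induction u generalizing f with
  | nil => simp [der_nil, mul_nil]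
  | cons y u ih =>
    change tail y (der deg k g (mul f h)) u =
      tail y (mul (der deg k g f) h + mul (signMap deg k f) (der deg k g h)) u
    simp only [map_add, tail_mul, tail_der, der_nil, signMap_nil, zero_smul, zero_add,
      tail_signMap, Finset.sum_add_distrib, map_smul, LinearMap.add_apply, LinearMap.sum_apply,
      map_sum, hg, map_units_smul, Pi.add_apply, Finset.sum_apply, Pi.smul_apply, smul_add,
      mul_assoc', ← Finset.smul_sum, ih]
    simp only [smul_comm (f []) ((k * deg y).negOnePow)]
    abel

lemma der_letter (hg : ∀ x, g x [] = 0) (x : X) : der deg k g (letter x) = g x := by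
  classical
  have h1 : der deg k g (one : Series X) = 0 := by
    have ht : ∀ x : X, tail x one = 0 := fun x => by funext v; simp [one, tail_apply]
    funext u
    cases u with
    | nil => rfl
    | cons y u =>
      change tail y (der deg k g one) u = 0
      rw [tail_der]
      simp [ht]
  funext u
  cases u with
  | nil => rw [der_nil, hg]
  | cons y u =>
    change tail y (der deg k g (letter x)) u = tail y (g x) u
    rw [tail_der, Finset.sum_eq_single x]
    · rw [tail_letter, tail_letter, if_pos rfl, mul_one']
      have : der deg k g (if y = x then (one : Series X) else 0) = 0 := by
        split_ifs
        · exact h1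
        · simp
      rw [this]
      simp [tail_apply]
    · intro z _ hz; simp [tail_letter, hz]
    · simp

lemma der_vanish (hg : ∀ x, g x [] = 0) (n : ℕ) {f : Series X} (hf : f ∈ Vanish n) :
    der deg k g f ∈ Vanish n := by
  intro u
  induction u generalizing n f with
  | nil => intro _; rfl
  | cons y u ih =>
    intro hu
    obtain ⟨n, rfl⟩ : ∃ m, n = m + 1 := ⟨n - 1, by simp at hu; omega⟩
    have ht : ∀ x, tail x f ∈ Vanish n := fun x v hv => hf (x :: v) (by simpa using hv)
    have h1 : ∑ x, mul (g x) (tail x f) ∈ Vanish (n + 1) :=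
      Submodule.sum_mem _ fun x _ => mul_vanish (hg x) fun w hw => ht x w (by omega)
    have h1 := h1 (y :: u) hu
    rw [Finset.sum_apply] at h1
    change tail y (der deg k g f) u = 0
    rw [tail_der, Pi.add_apply, Pi.smul_apply, ih n (ht y) (by simpa using hu),
      Finset.sum_apply]
    simpa [tail_apply] using h1

end der

end series

/-! ### Lie series -/

section lie

variable {X Y : Type} {degX : X → ℤ} {degY : Y → ℤ}

lemma IsLiePoly.homogeneous {k : ℕ} {p : ℤ} {f : Series X} (h : IsLiePoly degX k p f) :
    ∀ w, f w ≠ 0 → (w.map degX).sum = p ∧ w.length = k := by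
  induction h with
  | zero => intro w hw; exact absurd rfl hw
  | @add _ _ f g _ _ h1 h2 =>
    intro w hw
    by_cases hf : f w = 0
    · exact h2 w fun hg => hw (by rw [Pi.add_apply, hf, hg, add_zero])
    · exact h1 w hf
  | @smul _ _ f c _ h => intro w hw; exact h w fun hf => hw (by rw [Pi.smul_apply, hf, smul_zero])
  | letter x =>
    intro w hw
    have : w = [x] := by
      by_contra hne
      exact hw (by simp [FreeLie.letter, hne])
    simp [this]
  | @bracket j k p q f g _ _ h1 h2 =>
    have hm : ∀ {a b : ℤ} {m l : ℕ} {f g : Series X},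
        (∀ w, f w ≠ 0 → (w.map degX).sum = a ∧ w.length = m) →
        (∀ w, g w ≠ 0 → (w.map degX).sum = b ∧ w.length = l) →
        ∀ w, mul f g w ≠ 0 → (w.map degX).sum = a + b ∧ w.length = m + l := by
      intro a b m l f g hf hg w hw
      rw [mul_apply] at hw
      obtain ⟨i, _, hi⟩ := Finset.exists_ne_zero_of_sum_ne_zero hw
      have ha := hf _ (left_ne_zero_of_mul hi)
      have hb := hg _ (right_ne_zero_of_mul hi)
      rw [← ha.1, ← ha.2, ← hb.1, ← hb.2, ← List.sum_append, ← List.map_append,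
        ← List.length_append, List.take_append_drop]
      exact ⟨rfl, rfl⟩
    intro w hw
    by_cases hf : mul f g w = 0
    · have hg : mul g f w ≠ 0 := by
        intro hg
        apply hw
        rw [comm_apply, Pi.sub_apply, Pi.smul_apply, hf, hg, smul_zero, sub_zero]
      have := hm h2 h1 w hg
      omega
    · exact hm h1 h2 w hf

lemma IsLiePoly.mem {k : ℕ} {p : ℤ} {f : Series X} (h : IsLiePoly degX k p f) :
    f ∈ lieSeries degX p := by
  intro j
  by_cases hj : j = k
  · subst hj
    have : part j f = f := by
      funext w
      rw [part_apply]
      split_ifs with hw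
      · rfl
      · by_contra hne
        exact hw (h.homogeneous w (Ne.symm hne)).2
    rwa [this]
  · have : part j f = 0 := by
      funext w
      rw [part_apply]
      split_ifs with hw
      · by_contra hne
        exact hj (hw ▸ (h.homogeneous w hne).2)
      · rfl
    rw [this]
    exact .zero _ _

lemma lieSeries_homogeneous {p : ℤ} {f : Series X} (h : f ∈ lieSeries degX p) {w : List X}
    (hw : f w ≠ 0) : (w.map degX).sum = p := by
  refine ((h w.length).homogeneous w ?_).1
  rwa [part_apply, if_pos rfl]

lemma signMap_of_mem {p : ℤ} {f : Series X} (h : f ∈ lieSeries degX p) (k : ℤ) :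
    signMap degX k f = (k * p).negOnePow • f := by
  funext w
  by_cases hw : f w = 0
  · simp [signMap, hw]
  · rw [signMap, lieSeries_homogeneous h hw]; rfl

lemma sub_sum_part_mem (n : ℕ) (f : Series X) :
    f - ∑ k ∈ Finset.range (n + 1), part k f ∈ Vanish n := by
  intro w hw
  rw [Pi.sub_apply, Finset.sum_apply, Finset.sum_eq_single w.length]
  · simp [part_apply]
  · intro k _ hk
    simp [part_apply, Ne.symm hk]
  · intro h
    exact absurd (Finset.mem_range.mpr (Nat.lt_succ_of_le hw)) h

lemma mem_lieSeries_of_vanish {p : ℤ} {f : Series X}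
    (h : ∀ n, ∃ g ∈ lieSeries degX p, f - g ∈ Vanish n) : f ∈ lieSeries degX p := by
  intro k
  obtain ⟨g, hg, hfg⟩ := h k
  have : part k f = part k g := by
    rw [← sub_eq_zero, ← map_sub]
    funext w
    rw [part_apply]
    split_ifs with hw
    · exact hfg w hw.le
    · rfl
  rw [this]
  exact hg k

/-- A Lie series is the limit of its truncations, which are sums of Lie polynomials, and `T` is
continuous for the word length filtration. -/
lemma map_mem_lieSeries {p q : ℤ} (T : Series X →ₗ[ℚ] Series Y)
    (hT : ∀ n f, f ∈ Vanish n → T f ∈ Vanish n)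
    (hp : ∀ k f, IsLiePoly degX k p f → T f ∈ lieSeries degY q) {f : Series X}
    (hf : f ∈ lieSeries degX p) : T f ∈ lieSeries degY q := by
  refine mem_lieSeries_of_vanish fun n => ⟨T (∑ k ∈ Finset.range (n + 1), part k f), ?_, ?_⟩
  · rw [map_sum]
    exact Submodule.sum_mem _ fun k _ => hp k _ (hf k)
  · rw [← map_sub]
    exact hT _ _ (sub_sum_part_mem n f)

/-! ### Existence of morphisms and derivations with given values on generators -/

section existence

variable [Fintype X]

lemma subst_mem {g : X → Series Y} (hg : ∀ x, g x ∈ lieSeries degY (degX x)) {p : ℤ}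
    {f : Series X} (hf : f ∈ lieSeries degX p) : subst g f ∈ lieSeries degY p := by
  have hg0 : ∀ x, g x [] = 0 := fun x => lieSeries_nil (hg x)
  refine map_mem_lieSeries _ (fun n f => subst_vanish hg0 n) (fun k f hf => ?_) hf
  clear * - hf hg hg0
  induction hf with
  | zero => rw [map_zero]; exact Submodule.zero_mem _
  | add _ _ h1 h2 => rw [map_add]; exact Submodule.add_mem _ h1 h2
  | smul c _ h => rw [map_smul]; exact Submodule.smul_mem _ c h
  | letter x => rw [subst_letter hg0]; exact hg x
  | bracket _ _ h1 h2 => rw [subst_comm hg0]; exact comm_mem rfl h1 h2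

lemma der_comm {g : X → Series X} (hg : ∀ x, g x [] = 0) (k : ℤ) {p q : ℤ} {f h : Series X}
    (hf : f ∈ lieSeries degX p) (hh : h ∈ lieSeries degX q) :
    der degX k g (comm p q f h) = comm (p + k) q (der degX k g f) h +
      (k * p).negOnePow • comm p (q + k) f (der degX k g h) := by
  have e : ∀ (e : ℤˣ) (f h : Series X), mul (e • f) h = e • mul f h := fun e f h => by
    simp
  rw [comm_apply, comm_apply, comm_apply, map_sub, map_units_smul, der_mul degX k hg,
    der_mul degX k hg, signMap_of_mem hf, signMap_of_mem hh, e, e]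
  simp only [add_mul, mul_add, Int.negOnePow_add, mul_comm p k]
  rcases Int.units_eq_one_or (p * q).negOnePow with h1 | h1 <;>
  rcases Int.units_eq_one_or (k * p).negOnePow with h2 | h2 <;>
  rcases Int.units_eq_one_or (k * q).negOnePow with h3 | h3 <;>
  simp [h1, h2, h3] <;> abel

lemma der_mem {g : X → Series X} {k : ℤ} (hg : ∀ x, g x ∈ lieSeries degX (degX x + k)) {p : ℤ}
    {f : Series X} (hf : f ∈ lieSeries degX p) : der degX k g f ∈ lieSeries degX (p + k) := by
  have hg0 : ∀ x, g x [] = 0 := fun x => lieSeries_nil (hg x)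
  refine map_mem_lieSeries _ (fun n f => der_vanish degX k hg0 n) (fun j f hf => ?_) hf
  clear * - hf hg hg0
  induction hf with
  | zero => rw [map_zero]; exact Submodule.zero_mem _
  | add _ _ h1 h2 => rw [map_add]; exact Submodule.add_mem _ h1 h2
  | smul c _ h => rw [map_smul]; exact Submodule.smul_mem _ c h
  | letter x => rw [der_letter degX k hg0]; exact hg x
  | bracket h1 h2 ih1 ih2 =>
    rw [der_comm hg0 k h1.mem h2.mem]
    exact Submodule.add_mem _ (comm_mem (by omega) ih1 h2.mem)
      (units_smul_mem _ _ (comm_mem (by omega) h1.mem ih2))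

/-- The morphism of complete free graded Lie algebras with prescribed values on generators. -/
def lift (g : ∀ x, (freeLie degY).obj (degX x)) : LieMap (freeLie degX) (freeLie degY) where
  toFun p := ((subst fun x => (g x).1).comp (lieSeries degX p).subtype).codRestrict
    (lieSeries degY p) fun f => subst_mem (fun x => (g x).2) f.2
  map_bracket {p q _} _ f h :=
    Subtype.ext (subst_comm (fun x => lieSeries_nil (g x).2) p q f.1 h.1)

lemma lift_gen (g : ∀ x, (freeLie degY).obj (degX x)) (x : X) :
    (lift g).toFun (degX x) (gen x _ rfl) = g x :=
  Subtype.ext (subst_letter (fun x => lieSeries_nil (g x).2) x)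

/-- The derivation of a complete free graded Lie algebra with prescribed values on generators. -/
def derivation (k : ℤ) (g : ∀ x, (freeLie degX).obj (degX x + k)) :
    (freeLie degX).Derivation k where
  toFun {p q} h := ((der degX k fun x => (g x).1).comp (lieSeries degX p).subtype).codRestrict
    (lieSeries degX q) fun f => h ▸ der_mem (fun x => (g x).2) f.2
  leibniz {p q r p' q' r'} h hr hp hq h₁ h₂ f e := Subtype.ext (by
    subst hp hq
    refine (der_comm (fun x => lieSeries_nil (g x).2) k f.2 e.2).trans ?_
    rcases Int.units_eq_one_or (k * p).negOnePow with e | e <;> rw [e] <;> simp <;> rfl)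

lemma derivation_gen (k : ℤ) (g : ∀ x, (freeLie degX).obj (degX x + k)) (x : X) :
    (derivation k g).toFun rfl (gen x _ rfl) = g x :=
  Subtype.ext (der_letter degX k (fun x => lieSeries_nil (g x).2) x)

end existence

/-! ### Reduction of identities to generators -/

section ext

variable [Finite X]

/-- Induction principle of complete free graded Lie algebras. -/
lemma freeLie_induction (S : ∀ p, Submodule ℚ ((freeLie degX).obj p))
    (hgen : ∀ x, gen x _ rfl ∈ S (degX x))
    (hbr : ∀ {p q r : ℤ} (h : p + q = r) (f : (freeLie degX).obj p) (g : (freeLie degX).obj q),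
      f ∈ S p → g ∈ S q → (freeLie degX).bracket h f g ∈ S r)
    (hcl : ∀ p (f : (freeLie degX).obj p),
      (∀ n, ∃ g ∈ S p, f - g ∈ (freeLie degX).lcs n p) → f ∈ S p)
    (p : ℤ) (f : (freeLie degX).obj p) : f ∈ S p := by
  have key : ∀ {k : ℕ} {p : ℤ} {f : Series X}, IsLiePoly degX k p f →
      ∃ h : f ∈ lieSeries degX p, (⟨f, h⟩ : (freeLie degX).obj p) ∈ S p := by
    intro k p f hf
    induction hf with
    | zero k p => exact ⟨Submodule.zero_mem _, Submodule.zero_mem (S p)⟩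
    | add _ _ h1 h2 =>
      obtain ⟨h1, h1'⟩ := h1
      obtain ⟨h2, h2'⟩ := h2
      exact ⟨_, Submodule.add_mem (S _) h1' h2'⟩
    | smul c _ h =>
      obtain ⟨h, h'⟩ := h
      exact ⟨_, Submodule.smul_mem (S _) c h'⟩
    | letter x => exact ⟨_, hgen x⟩
    | bracket _ _ h1 h2 =>
      obtain ⟨h1, h1'⟩ := h1
      obtain ⟨h2, h2'⟩ := h2
      exact ⟨_, hbr rfl _ _ h1' h2'⟩
  -- Lie polynomials are dense: truncation at word length `n` leaves a remainder that vanishes on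
  -- words of length at most `n`, hence lies in `lcs n`.
  refine hcl p f fun n => ?_
  have hf : ∀ k, ∃ h : part k f.1 ∈ lieSeries degX p,
      (⟨part k f.1, h⟩ : (freeLie degX).obj p) ∈ S p := fun k => key (f.2 k)
  choose h h' using hf
  refine ⟨∑ k ∈ Finset.range (n + 1), ⟨part k f.1, h k⟩, Submodule.sum_mem _ fun k _ => h' k, ?_⟩
  refine mem_lcs_of_vanish n p _ ?_
  have e : (f - ∑ k ∈ Finset.range (n + 1), ⟨part k f.1, h k⟩ : (freeLie degX).obj p).1 =
      f.1 - ∑ k ∈ Finset.range (n + 1), part k f.1 := by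
    refine congrArg (f.1 - ·) ((AddSubmonoidClass.coe_finsetSum _ _).trans ?_)
    rfl
  rw [e]
  exact sub_sum_part_mem n f.1

/-- Morphisms of graded Lie algebras to a complete one are determined by their values on
generators. -/
lemma lieMap_ext {L : GradedLie} (hL : L.IsComplete) (φ ψ : LieMap (freeLie degX) L)
    (h : ∀ x, φ.toFun _ (gen x (degX x) rfl) = ψ.toFun _ (gen x _ rfl)) (p : ℤ)
    (f : (freeLie degX).obj p) : φ.toFun p f = ψ.toFun p f := by
  refine freeLie_induction (fun p => LinearMap.eqLocus (φ.toFun p) (ψ.toFun p)) h ?_ ?_ p f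
  · intro p q r h f g hf hg
    simp only [LinearMap.mem_eqLocus] at hf hg ⊢
    rw [φ.map_bracket, ψ.map_bracket, hf, hg]
  · intro p f hf
    rw [LinearMap.mem_eqLocus]
    refine hL.eq_of_sub_mem fun n => ?_
    obtain ⟨g, hg, hfg⟩ := hf n
    rw [LinearMap.mem_eqLocus] at hg
    have := Submodule.sub_mem _ (φ.map_lcs n hfg) (ψ.map_lcs n hfg)
    rwa [map_sub, map_sub, hg, sub_sub_sub_cancel_right] at this

/-- A morphism of graded Lie algebras commutes with derivations if it does so on generators. -/
lemma lieMap_comm_derivation {L : GradedLie} (hL : L.IsComplete) (φ : LieMap (freeLie degX) L)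
    {k : ℤ} (D : (freeLie degX).Derivation k) (E : L.Derivation k)
    (h : ∀ x, φ.toFun _ (D.toFun rfl (gen x (degX x) rfl)) =
      E.toFun rfl (φ.toFun _ (gen x _ rfl))) {p q : ℤ} (hpq : p + k = q)
    (f : (freeLie degX).obj p) : φ.toFun q (D.toFun hpq f) = E.toFun hpq (φ.toFun p f) := by
  subst hpq
  refine freeLie_induction (fun p => LinearMap.eqLocus ((φ.toFun (p + k)).comp (D.toFun rfl))
    ((E.toFun rfl).comp (φ.toFun p))) h ?_ ?_ p f
  · intro p q r h f g hf hg
    simp only [LinearMap.mem_eqLocus, LinearMap.comp_apply] at hf hg ⊢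
    rw [D.leibniz h rfl rfl rfl (by omega) (by omega), φ.map_bracket,
      E.leibniz h rfl rfl rfl (by omega) (by omega), map_add, map_units_smul, φ.map_bracket,
      φ.map_bracket, hf, hg]
  · intro p f hf
    simp only [LinearMap.mem_eqLocus, LinearMap.comp_apply] at hf ⊢
    refine hL.eq_of_sub_mem fun n => ?_
    obtain ⟨g, hg, hfg⟩ := hf n
    have := Submodule.sub_mem _ (φ.map_lcs n (D.map_lcs n rfl hfg))
      (E.map_lcs n (rfl : p + k = p + k) (φ.map_lcs n hfg))
    rwa [map_sub, map_sub, map_sub, map_sub, hg, sub_sub_sub_cancel_right] at this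

/-- A derivation of odd degree has square zero if this holds on generators. -/
lemma square_zero_of_gen {k : ℤ} (hk : Odd k) (D : (freeLie degX).Derivation k)
    (h : ∀ x, D.toFun rfl (D.toFun rfl (gen x (degX x) rfl)) = 0) {p q r : ℤ} (hpq : p + k = q)
    (hqr : q + k = r) (f : (freeLie degX).obj p) : D.toFun hqr (D.toFun hpq f) = 0 := by
  subst hpq hqr
  refine freeLie_induction (fun p => LinearMap.ker ((D.toFun rfl).comp (D.toFun rfl))) h ?_ ?_ p f
  · intro p q r h f g hf hg
    simp only [LinearMap.mem_ker, LinearMap.comp_apply] at hf hg ⊢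
    rw [D.leibniz h rfl rfl rfl (by omega : p + k + q = r + k) (by omega), map_add, map_units_smul,
      D.leibniz _ rfl rfl rfl (by omega : p + k + k + q = r + k + k) (by omega),
      D.leibniz _ rfl rfl rfl (by omega : p + k + (q + k) = r + k + k) (by omega), hf, hg]
    -- Since `k` is odd, the two cross terms `[D f, D g]` in `D² [f, g]` carry opposite signs.
    have : (k * (p + k)).negOnePow = -(k * p).negOnePow := by
      rw [mul_add, Int.negOnePow_add, Int.negOnePow_odd (k * k) (hk.mul hk)]; simp
    rw [this]
    simp
  · intro p f hf
    simp only [LinearMap.mem_ker, LinearMap.comp_apply] at hf ⊢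
    refine (freeLie_isComplete degX _).1 _ fun n => ?_
    obtain ⟨g, hg, hfg⟩ := hf n
    have := D.map_lcs n (rfl : p + k + k = _) (D.map_lcs n rfl hfg)
    rwa [map_sub, map_sub, hg, sub_zero] at this

end ext

/-! ### Linear parts -/

section linear

/-- The coefficient of a word of length one. -/
def linCoeff (y : X) (p : ℤ) : (freeLie degX).obj p →ₗ[ℚ] ℚ where
  toFun f := coeff f [y]
  map_add' _ _ := rfl
  map_smul' _ _ := rfl

lemma linCoeff_eq_zero_of_mem {p : ℤ} {f : (freeLie degX).obj p}
    (hf : f ∈ (freeLie degX).lcs 1 p) (y : X) : linCoeff y p f = 0 :=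
  vanish_of_mem_lcs 1 p f hf [y] le_rfl

lemma linCoeff_gen [DecidableEq X] (x y : X) {p : ℤ} (h : degX x = p) :
    linCoeff y p (gen x p h) = if x = y then 1 else 0 := by
  classical
  change letter x [y] = _
  simp [letter, eq_comm]

lemma linCoeff_eq_zero_of_ne {p : ℤ} (f : (freeLie degX).obj p) {y : X} (h : degX y ≠ p) :
    linCoeff y p f = 0 := by
  by_contra hne
  exact h (by simpa using lieSeries_homogeneous f.2 hne)

variable [Finite X]

lemma mem_lcs_one_of_linCoeff {p : ℤ} {f : (freeLie degX).obj p}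
    (hf : ∀ y, linCoeff y p f = 0) : f ∈ (freeLie degX).lcs 1 p := by
  refine mem_lcs_of_vanish 1 p f fun w hw => ?_
  match w, hw with
  | [], _ => exact lieSeries_nil f.2
  | [y], _ => exact hf y

end linear

/-! ### Invertibility detected on linear parts -/

section inverse

/-- The linear combination of generators of degree `p` with given coefficients. -/
def linComb [Fintype X] (c : X → ℚ) (p : ℤ) : (freeLie degX).obj p :=
  ∑ x : {x // degX x = p}, c x.1 • gen x.1 p x.2

lemma linCoeff_linComb [Fintype X] (c : X → ℚ) (p : ℤ) (y : X) :
    linCoeff y p (linComb (degX := degX) c p) = if degX y = p then c y else 0 := by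
  classical
  rw [linComb, map_sum]
  simp only [map_smul, linCoeff_gen, smul_eq_mul, mul_ite, mul_one, mul_zero]
  split_ifs with h
  · rw [Finset.sum_eq_single ⟨y, h⟩]
    · simp
    · rintro ⟨x, hx⟩ _ hne
      rw [if_neg]
      rintro rfl
      exact hne rfl
    · simp
  · refine Finset.sum_eq_zero fun x _ => ?_
    rw [if_neg]
    rintro rfl
    exact h x.2

lemma sub_linComb_mem [Fintype X] {p : ℤ} (f : (freeLie degX).obj p) :
    f - linComb (fun x => linCoeff x p f) p ∈ (freeLie degX).lcs 1 p := by
  refine mem_lcs_one_of_linCoeff fun y => ?_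
  rw [map_sub, linCoeff_linComb]
  split_ifs with h
  · simp
  · simp [linCoeff_eq_zero_of_ne f h]

/-- The linear part of a map that respects the lower central series. -/
lemma linCoeff_map [Fintype X] {p q : ℤ} (T : (freeLie degX).obj p →ₗ[ℚ] (freeLie degY).obj q)
    (hT : ∀ f, f ∈ (freeLie degX).lcs 1 p → T f ∈ (freeLie degY).lcs 1 q)
    (f : (freeLie degX).obj p) (y : Y) :
    linCoeff y q (T f) =
      ∑ x : {x // degX x = p}, linCoeff x.1 p f * linCoeff y q (T (gen x.1 p x.2)) := by
  have := linCoeff_eq_zero_of_mem (hT _ (sub_linComb_mem f)) y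
  rw [map_sub, map_sub, sub_eq_zero] at this
  rw [this, linComb, map_sum, map_sum]
  simp

/-- Brackets lie in `lcs 1` anyway, so only the generators carry a condition. -/
lemma sub_mem_lcs_one_of_gen [Finite X] (u : LieMap (freeLie degX) (freeLie degX))
    (h : ∀ x, u.toFun _ (gen x (degX x) rfl) - gen x _ rfl ∈ (freeLie degX).lcs 1 (degX x))
    (p : ℤ) (f : (freeLie degX).obj p) : u.toFun p f - f ∈ (freeLie degX).lcs 1 p := by
  refine freeLie_induction (fun p => ((freeLie degX).lcs 1 p).comap (u.toFun p - LinearMap.id))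
    h ?_ ?_ p f
  · intro p q r h f g _ _
    rw [Submodule.mem_comap, LinearMap.sub_apply, u.map_bracket]
    exact Submodule.sub_mem _ (bracket_mem_lcs_succ h _ (mem_lcs_zero _))
      (bracket_mem_lcs_succ h _ (mem_lcs_zero _))
  · intro p f hf
    obtain ⟨g, hg, hfg⟩ := hf 1
    rw [Submodule.mem_comap] at hg ⊢
    have := Submodule.add_mem _ hg (Submodule.sub_mem _ (u.map_lcs 1 hfg) hfg)
    convert this using 1
    simp only [LinearMap.sub_apply, LinearMap.id_apply, map_sub]
    abel

lemma map_linComb [Fintype X] [Fintype Y] (φ : LieMap (freeLie degX) (freeLie degY)) (e : X ≃ Y)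
    (hdeg : ∀ x, degY (e x) = degX x) (c : X → ℚ) (p : ℤ)
    (h : ∀ x (hx : degX x = p), c x ≠ 0 →
      φ.toFun p (gen x p hx) = gen (e x) p ((hdeg x).trans hx)) :
    φ.toFun p (linComb c p) = linComb (c ∘ e.symm) p := by
  rw [linComb, linComb, map_sum]
  refine Fintype.sum_equiv (e.subtypeEquiv fun x => by rw [hdeg]) _ _ fun x => ?_
  rw [map_smul, Equiv.subtypeEquiv_apply, Function.comp_apply, e.symm_apply_apply]
  by_cases hc : c x.1 = 0
  · rw [hc, zero_smul, zero_smul]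
  · rw [h x.1 x.2 hc]

/-- A morphism of complete free graded Lie algebras whose linear part is triangular is
bijective. -/
lemma bijective_of_triangular [Finite X] [Finite Y] (φ : LieMap (freeLie degX) (freeLie degY)) (e : X ≃ Y)
    (hdeg : ∀ x, degY (e x) = degX x) (S : Set X)
    (hS : ∀ x, x ∉ S → ∀ p (h : degX x = p),
      φ.toFun p (gen x p h) = gen (e x) p ((hdeg x).trans h))
    (ε : X → ℚ) (hε : ∀ x ∈ S, ε x ≠ 0)
    (hdiag : ∀ x ∈ S, ∀ p (h : degX x = p), linCoeff (e x) p (φ.toFun p (gen x p h)) = ε x)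
    (hoff : ∀ x ∈ S, ∀ x' ∈ S, x' ≠ x → ∀ p (h : degX x = p),
      linCoeff (e x') p (φ.toFun p (gen x p h)) = 0)
    (p : ℤ) : Function.Bijective (φ.toFun p) := by
  classical
  cases nonempty_fintype X
  cases nonempty_fintype Y
  -- The off-diagonal part of the linear part: for `x ∈ S`, modulo brackets, `φ x` is `ε x • e x`
  -- plus the sum of `c x x' • e x'` over `x'` outside `S`.
  let c : X → X → ℚ := fun x x' =>
    if x' ∈ S then 0 else linCoeff (e x') _ (φ.toFun _ (gen x (degX x) rfl))
  -- The inverse of a triangular matrix: the correction involves only generators outside `S`, where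
  -- `φ` already agrees with `e`.
  let g : ∀ (x : X) (p : ℤ), degX x = p → (freeLie degX).obj p := fun x p h =>
    if x ∈ S then (ε x)⁻¹ • (gen x p h - linComb (c x) p) else gen x p h
  have hdeg' : ∀ y, degX (e.symm y) = degY y := fun y => by rw [← hdeg, e.apply_symm_apply]
  let χ : LieMap (freeLie degY) (freeLie degX) := lift fun y => g (e.symm y) _ (hdeg' y)
  have hχ : ∀ x p (h : degX x = p), χ.toFun p (gen (e x) p ((hdeg x).trans h)) = g x p h := by
    intro x p h
    obtain rfl : degY (e x) = p := (hdeg x).trans h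
    have : ∀ z (hz : z = x) (h' : degX z = degY (e x)), g z _ h' = g x _ h := by
      rintro _ rfl _; rfl
    exact (lift_gen _ (e x)).trans (this _ (e.symm_apply_apply x) _)
  have hcS : ∀ x x', c x x' ≠ 0 → x' ∉ S := fun x x' h hx => h (if_pos hx)
  have hφc : ∀ x p, φ.toFun p (linComb (c x) p) = linComb (c x ∘ e.symm) p := fun x p =>
    map_linComb φ e hdeg _ _ fun x' h hc => hS x' (hcS x x' hc) p h
  have hχc : ∀ x p, χ.toFun p (linComb (c x ∘ e.symm) p) = linComb (c x) p := by
    intro x p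
    have := map_linComb χ e.symm hdeg' (c x ∘ e.symm) p fun y h hc => by
      obtain ⟨x', rfl⟩ := e.surjective y
      have hx' : x' ∉ S := hcS x x' (by simpa using hc)
      rw [hχ x' p ((hdeg x').symm.trans h)]
      simp only [g, if_neg hx', e.symm_apply_apply]
    rw [this]
    congr 1
    funext x'
    simp
  have hlin : ∀ x ∈ S, ∀ p (h : degX x = p), φ.toFun p (gen x p h) -
      (ε x • gen (e x) p ((hdeg x).trans h) + linComb (c x ∘ e.symm) p) ∈
        (freeLie degY).lcs 1 p := by
    rintro x hx _ rfl
    refine mem_lcs_one_of_linCoeff fun y => ?_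
    obtain ⟨x', rfl⟩ := e.surjective y
    rw [map_sub, map_add, map_smul, linCoeff_gen, linCoeff_linComb]
    by_cases hd : degY (e x') = degX x
    · by_cases hx' : x' ∈ S
      · by_cases hxx : x' = x
        · subst hxx
          simp [c, hx', hdiag x' hx']
        · simp [c, hx', hoff x hx x' hx' hxx, Ne.symm hxx]
      · have : x ≠ x' := by rintro rfl; exact hx' hx
        simp [c, hx', hd, this]
    · have : x ≠ x' := by rintro rfl; exact hd (hdeg x)
      rw [linCoeff_eq_zero_of_ne _ hd]
      simp [this, hd]
  have h1 := (χ.comp φ).bijective_of_sub_mem (freeLie_isComplete degX)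
    (sub_mem_lcs_one_of_gen (χ.comp φ) fun x => by
      change χ.toFun _ (φ.toFun _ _) - _ ∈ _
      by_cases hx : x ∈ S
      · have := χ.map_lcs 1 (hlin x hx _ rfl)
        rw [map_sub, map_add, map_smul, hχ x _ rfl, hχc] at this
        simpa [g, hx, smul_smul, hε x hx] using this
      · rw [hS x hx, hχ x _ rfl]
        simp [g, hx])
  have h2 := (φ.comp χ).bijective_of_sub_mem (freeLie_isComplete degY)
    (sub_mem_lcs_one_of_gen (φ.comp χ) fun y => by
      change φ.toFun _ (χ.toFun _ _) - _ ∈ _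
      obtain ⟨x, rfl⟩ := e.surjective y
      rw [hχ x _ (hdeg x).symm]
      by_cases hx : x ∈ S
      · have := Submodule.smul_mem _ (ε x)⁻¹ (hlin x hx _ (hdeg x).symm)
        rw [← hφc, ← sub_sub, sub_right_comm, smul_sub, smul_smul, inv_mul_cancel₀ (hε x hx),
          one_smul] at this
        simp only [g, if_pos hx, map_smul, map_sub]
        exact this
      · simp only [g, if_neg hx]
        rw [hS x hx]
        simp)
  exact ⟨Function.Injective.of_comp (f := χ.toFun p) (h1 p).1,
    Function.Surjective.of_comp (g := χ.toFun p) (h2 p).2⟩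

end inverse

end lie

end FreeLie

open GradedLie FreeLie CDGL

/-! ### Morphisms of complete differential graded Lie algebras -/

namespace CDGL

variable {L M : CDGL}

/-- A morphism of graded Lie algebras that commutes with the differentials. -/
def homMk (φ : LieMap L.toGradedLie M.toGradedLie)
    (h : ∀ {p q : ℤ} (h : p + -1 = q) (x : L.toGradedLie.obj p),
      φ.toFun q (L.d.toFun h x) = M.d.toFun h (φ.toFun p x)) : L ⟶ M :=
  { toFun := φ.toFun, map_bracket := φ.map_bracket, map_d := h }

/-- The underlying morphism of graded Lie algebras. -/
def lieMap (f : L ⟶ M) : LieMap L.toGradedLie M.toGradedLie where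
  toFun := f.toFun
  map_bracket := f.map_bracket

lemma hom_map_d (f : L ⟶ M) {p q : ℤ} (h : p + -1 = q) (x : L.toGradedLie.obj p) :
    f.toFun q (L.d.toFun h x) = M.d.toFun h (f.toFun p x) := f.map_d h x

lemma hom_map_bracket (f : L ⟶ M) {p q r : ℤ} (h : p + q = r) (x : L.toGradedLie.obj p)
    (y : L.toGradedLie.obj q) : f.toFun r (L.toGradedLie.bracket h x y) =
      M.toGradedLie.bracket h (f.toFun p x) (f.toFun q y) := f.map_bracket h x y

lemma hom_ext {f g : L ⟶ M} (h : ∀ p x, f.toFun p x = g.toFun p x) : f = g :=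
  Hom.ext (funext fun p => LinearMap.ext (h p))

/-- A bijective morphism is an isomorphism. -/
def isoOfBijective (f : L ⟶ M) (hf : ∀ p, Function.Bijective (f.toFun p)) : L ≅ M where
  hom := f
  inv := homMk ((lieMap f).inverse hf) fun {p q} h x => by
    have e : ∀ p x, f.toFun p (((lieMap f).inverse hf).toFun p x) = x :=
      (lieMap f).apply_inverse hf
    refine (hf q).1 ?_
    rw [e, hom_map_d, e]
  hom_inv_id := hom_ext fun p x => (hf p).1 ((lieMap f).apply_inverse hf p _)
  inv_hom_id := hom_ext fun p x => (lieMap f).apply_inverse hf p x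

end CDGL

section free

variable {X : Type} [Finite X] {deg : X → ℤ} {δ : (freeLie deg).Differential} {C : CDGL}

lemma freeCDGL_hom_ext {f g : freeCDGL δ ⟶ C}
    (h : ∀ x, f.toFun _ (gen x (deg x) rfl) = g.toFun _ (gen x _ rfl)) : f = g :=
  CDGL.hom_ext (lieMap_ext C.complete (lieMap f) (lieMap g) h)

/-- A morphism of graded Lie algebras on a complete free differential graded Lie algebra which
commutes with the differentials on generators. -/
def freeHomMk (φ : LieMap (freeLie deg) C.toGradedLie)
    (h : ∀ x, φ.toFun _ (δ.toFun rfl (gen x (deg x) rfl)) =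
      C.d.toFun rfl (φ.toFun _ (gen x _ rfl))) : freeCDGL δ ⟶ C :=
  homMk (L := freeCDGL δ) φ (lieMap_comm_derivation C.complete φ δ.toDerivation C.d.toDerivation h)

end free

/-! ### The derivation `θ = i d + d i` of the cylinder -/

/-- A differential and a derivation of degree `1` on `𝕃̂(V ⊕ V' ⊕ sV')` with the values that the
cylinder construction prescribes on the generators `v'` and `sv'`, and on `v` for `i`. -/
structure CylinderBase {X : Type} (deg : X → ℤ) where
  d : (freeLie (cylDeg deg)).Differential
  d_prime : ∀ (v : X) {p q : ℤ} (hp : deg v = p) (h : p + -1 = q),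
    d.toFun h (cylGen₁ v p hp) = 0
  d_susp : ∀ (v : X) {p q : ℤ} (hp : deg v + 1 = p) (hq : deg v = q) (h : p + -1 = q),
    d.toFun h (cylGen₂ v p hp) = cylGen₁ v q hq
  i : (freeLie (cylDeg deg)).Derivation 1
  i_base : ∀ (v : X) {p q : ℤ} (hp : deg v = p) (hq : deg v + 1 = q) (h : p + 1 = q),
    i.toFun h (cylGen₀ v p hp) = cylGen₂ v q hq
  i_prime : ∀ (v : X) {p q : ℤ} (hp : deg v = p) (h : p + 1 = q),
    i.toFun h (cylGen₁ v p hp) = 0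
  i_susp : ∀ (v : X) {p q : ℤ} (hp : deg v + 1 = p) (h : p + 1 = q),
    i.toFun h (cylGen₂ v p hp) = 0

namespace CylinderBase

variable {X : Type} {deg : X → ℤ} (B : CylinderBase deg)

/-- The derivation `θ = i d + d i` of degree zero. -/
def theta (p : ℤ) : Module.End ℚ ((freeLie (cylDeg deg)).obj p) :=
  B.i.toFun (neg_add_cancel_right p 1) ∘ₗ B.d.toFun rfl +
    B.d.toFun (add_neg_cancel_right p 1) ∘ₗ B.i.toFun rfl

lemma theta_apply {p : ℤ} (f : (freeLie (cylDeg deg)).obj p) {q r : ℤ} (hq : p + -1 = q)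
    (hq' : q + 1 = p) (hr : p + 1 = r) (hr' : r + -1 = p) :
    B.theta p f = B.i.toFun hq' (B.d.toFun hq f) + B.d.toFun hr' (B.i.toFun hr f) := by
  subst hq hr
  rfl

/-- The graded commutator of two derivations is a derivation: the terms `[dx, iy]` and `[ix, dy]`
each occur twice with opposite signs. -/
lemma theta_bracket {p q r : ℤ} (h : p + q = r) (x : (freeLie (cylDeg deg)).obj p)
    (y : (freeLie (cylDeg deg)).obj q) :
    B.theta r ((freeLie (cylDeg deg)).bracket h x y) =
      (freeLie (cylDeg deg)).bracket h (B.theta p x) y +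
        (freeLie (cylDeg deg)).bracket h x (B.theta q y) := by
  have hd := fun (x : (freeLie (cylDeg deg)).obj p) y => B.d.leibniz h (rfl : r + -1 = r + -1)
    (rfl : p + -1 = p + -1) (rfl : q + -1 = q + -1) (by omega) (by omega) x y
  have hi := fun (x : (freeLie (cylDeg deg)).obj p) y => B.i.leibniz h (rfl : r + 1 = r + 1)
    (rfl : p + 1 = p + 1) (rfl : q + 1 = q + 1) (by omega) (by omega) x y
  rw [B.theta_apply _ (rfl : r + -1 = r + -1) (by omega) (rfl : r + 1 = r + 1) (by omega), hd, hi,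
    B.theta_apply x (rfl : p + -1 = p + -1) (by omega) (rfl : p + 1 = p + 1) (by omega),
    B.theta_apply y (rfl : q + -1 = q + -1) (by omega) (rfl : q + 1 = q + 1) (by omega),
    map_add, map_add, map_units_smul, map_units_smul,
    B.i.leibniz (by omega : p + -1 + q = r + -1) (by omega : r + -1 + 1 = r)
      (by omega : p + -1 + 1 = p) (rfl : q + 1 = q + 1) h (by omega),
    B.i.leibniz (by omega : p + (q + -1) = r + -1) (by omega : r + -1 + 1 = r)
      (rfl : p + 1 = p + 1) (by omega : q + -1 + 1 = q) (by omega) h,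
    B.d.leibniz (by omega : p + 1 + q = r + 1) (by omega : r + 1 + -1 = r)
      (by omega : p + 1 + -1 = p) (rfl : q + -1 = q + -1) h (by omega),
    B.d.leibniz (by omega : p + (q + 1) = r + 1) (by omega : r + 1 + -1 = r)
      (rfl : p + -1 = p + -1) (by omega : q + 1 + -1 = q) (by omega) h]
  simp only [map_add, LinearMap.add_apply, smul_add, smul_smul]
  have e1 : (1 * (p + -1)).negOnePow = -p.negOnePow := by
    rw [one_mul, Int.negOnePow_add]; simp
  have e2 : (-1 * (p + 1)).negOnePow = -p.negOnePow := by
    rw [neg_one_mul, Int.negOnePow_neg, Int.negOnePow_add]; simp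
  have e3 : (-1 * p).negOnePow = p.negOnePow := by rw [neg_one_mul, Int.negOnePow_neg]
  rw [e1, e2, e3, one_mul]
  rcases Int.units_eq_one_or p.negOnePow with h | h <;> rw [h] <;> simp <;> abel

/-- Both sides reduce to `d i d f` because `d² = 0`. -/
lemma d_theta {p q : ℤ} (h : p + -1 = q) (f : (freeLie (cylDeg deg)).obj p) :
    B.d.toFun h (B.theta p f) = B.theta q (B.d.toFun h f) := by
  rw [B.theta_apply f h (by omega) (rfl : p + 1 = p + 1) (by omega), map_add, B.d.square_zero,
    B.theta_apply _ (rfl : q + -1 = q + -1) (by omega) (by omega : q + 1 = p) h, B.d.square_zero,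
    map_zero, zero_add, add_zero]

lemma theta_mem_lcs (n : ℕ) {p : ℤ} {f : (freeLie (cylDeg deg)).obj p}
    (hf : f ∈ (freeLie (cylDeg deg)).lcs n p) : B.theta p f ∈ (freeLie (cylDeg deg)).lcs n p :=
  Submodule.add_mem _ (B.i.map_lcs n _ (B.d.map_lcs n _ hf)) (B.d.map_lcs n _ (B.i.map_lcs n _ hf))

lemma theta_prime (v : X) (p : ℤ) (h : deg v = p) : B.theta p (cylGen₁ v p h) = 0 := by
  rw [B.theta_apply _ (rfl : p + -1 = p + -1) (by omega) (rfl : p + 1 = p + 1) (by omega),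
    B.d_prime, B.i_prime, map_zero, map_zero, zero_add]

lemma theta_susp (v : X) (p : ℤ) (h : deg v + 1 = p) : B.theta p (cylGen₂ v p h) = 0 := by
  rw [B.theta_apply _ (rfl : p + -1 = p + -1) (by omega) (rfl : p + 1 = p + 1) (by omega),
    B.d_susp v h (by omega), B.i_prime, B.i_susp, map_zero, zero_add]

lemma theta_base (v : X) (p : ℤ) (h : deg v = p) : B.theta p (cylGen₀ v p h) =
    B.i.toFun (neg_add_cancel_right p 1) (B.d.toFun rfl (cylGen₀ v p h)) + cylGen₁ v p h := by
  rw [B.theta_apply _ (rfl : p + -1 = p + -1) (by omega) (rfl : p + 1 = p + 1) (by omega),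
    B.i_base v h (by omega), B.d_susp v _ h]

variable [Finite X]

lemma i_square_zero {p q r : ℤ} (h : p + 1 = q) (h' : q + 1 = r)
    (f : (freeLie (cylDeg deg)).obj p) : B.i.toFun h' (B.i.toFun h f) = 0 := by
  refine square_zero_of_gen odd_one B.i ?_ h h' f
  rintro (v | v | v)
  · exact (congrArg _ (B.i_base v rfl rfl rfl)).trans (B.i_susp v rfl rfl)
  · exact (congrArg _ (B.i_prime v rfl rfl)).trans (map_zero _)
  · exact (congrArg _ (B.i_susp v rfl rfl)).trans (map_zero _)

/-- On linear parts `i` is nothing but `v ↦ sv'`. -/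
lemma linCoeff_i_eq_zero {p q : ℤ} (h : p + 1 = q) (f : (freeLie (cylDeg deg)).obj p)
    {y : X ⊕ X ⊕ X} (hf : ∀ v, y = Sum.inr (Sum.inr v) → linCoeff (Sum.inl v) p f = 0) :
    linCoeff y q (B.i.toFun h f) = 0 := by
  classical
  cases nonempty_fintype X
  rw [linCoeff_map _ (fun f hf => B.i.map_lcs 1 h hf)]
  refine Finset.sum_eq_zero ?_
  rintro ⟨v | v | v, hv⟩ _
  · have : B.i.toFun h (gen (Sum.inl v) p hv) = gen (Sum.inr (Sum.inr v)) q (by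
        rw [← h, ← hv]; rfl) := B.i_base v hv (by rw [← h, ← hv]; rfl) h
    rw [this, linCoeff_gen]
    split_ifs with hy
    · rw [hf v hy.symm, zero_mul]
    · rw [mul_zero]
  · have : B.i.toFun h (gen (Sum.inr (Sum.inl v)) p hv) = 0 := B.i_prime v hv h
    rw [this, map_zero, mul_zero]
  · have : B.i.toFun h (gen (Sum.inr (Sum.inr v)) p hv) = 0 := B.i_susp v hv h
    rw [this, map_zero, mul_zero]

/-- On linear parts `d` maps `V' ⊕ sV'` into `V'`, so nothing returns to `V`. -/
lemma linCoeff_d_eq_zero {p q : ℤ} (h : p + -1 = q) (f : (freeLie (cylDeg deg)).obj p) (u : X)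
    (hf : ∀ v, linCoeff (Sum.inl v) p f = 0) :
    linCoeff (Sum.inl u) q (B.d.toFun h f) = 0 := by
  classical
  cases nonempty_fintype X
  rw [linCoeff_map _ (fun f hf => B.d.map_lcs 1 h hf)]
  refine Finset.sum_eq_zero ?_
  rintro ⟨v | v | v, hv⟩ _
  · rw [hf, zero_mul]
  · have : B.d.toFun h (gen (Sum.inr (Sum.inl v)) p hv) = 0 := B.d_prime v hv h
    rw [this, map_zero, mul_zero]
  · have hq : cylDeg deg (Sum.inr (Sum.inl v)) = q := by
      have : deg v + 1 = p := hv
      change deg v = q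
      omega
    have : B.d.toFun h (gen (Sum.inr (Sum.inr v)) p hv) = gen (Sum.inr (Sum.inl v)) q hq :=
      B.d_susp v hv hq h
    rw [this, linCoeff_gen, if_neg (by simp), mul_zero]

/-- `θ v = i d v + v'` and `θ v' = 0`, while on the image of `i` the identity `i² = 0` leaves `θ = i
d`. From the second power on, everything stays in the image of `i`. -/
lemma theta_pow_base (v : X) (p : ℤ) (h : deg v = p) (k : ℕ) :
    ∃ f : (freeLie (cylDeg deg)).obj (p + -1),
      (B.theta p ^ (k + 2)) (cylGen₀ v p h) = B.i.toFun (neg_add_cancel_right p 1) f := by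
  have hi : ∀ f, B.theta p (B.i.toFun (neg_add_cancel_right p 1) f) =
      B.i.toFun (neg_add_cancel_right p 1)
        (B.d.toFun rfl (B.i.toFun (neg_add_cancel_right p 1) f)) := fun f => by
    rw [B.theta_apply _ (rfl : p + -1 = p + -1) (by omega) (rfl : p + 1 = p + 1) (by omega),
      B.i_square_zero, map_zero, add_zero]
  induction k with
  | zero =>
    refine ⟨B.d.toFun rfl (B.i.toFun (neg_add_cancel_right p 1)
      (B.d.toFun rfl (cylGen₀ v p h))), ?_⟩
    rw [zero_add, pow_two, Module.End.mul_apply, theta_base, map_add, theta_prime, add_zero, hi]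
  | succ k ih =>
    obtain ⟨f, hf⟩ := ih
    refine ⟨B.d.toFun rfl (B.i.toFun (neg_add_cancel_right p 1) f), ?_⟩
    rw [show k + 1 + 2 = (k + 2) + 1 by ring, pow_succ', Module.End.mul_apply, hf, hi]

/-- The linear part of `e^θ v`. -/
lemma linCoeff_hasExp (v : X) (p : ℤ) (h : deg v = p) {E : (freeLie (cylDeg deg)).obj p}
    (hE : (freeLie (cylDeg deg)).HasExp (B.theta p) (cylGen₀ v p h) E) {y : X ⊕ X ⊕ X}
    (hy : ∀ u, y ≠ Sum.inr (Sum.inr u)) :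
    linCoeff y p E = linCoeff y p (cylGen₀ v p h) + linCoeff y p (cylGen₁ v p h) := by
  have hi : ∀ f, linCoeff y p (B.i.toFun (neg_add_cancel_right p 1) f) = 0 := fun f =>
    B.linCoeff_i_eq_zero _ f fun u hu => absurd hu (hy u)
  obtain ⟨N, hN⟩ := hE 1
  -- At least two terms are kept so that those of index `0` and `1` can be split off. They
  -- contribute `v` and `v'`; the rest lies in the image of `i`, which linearly is contained in
  -- `sV'`.
  have := linCoeff_eq_zero_of_mem (hN (N + 2) (by omega)) y
  rw [map_sub, sub_eq_zero] at this
  rw [this, Finset.sum_range_succ', Finset.sum_range_succ', map_add, map_add, map_sum,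
    Finset.sum_eq_zero, zero_add, add_comm]
  · simp only [zero_add, pow_one, pow_zero, theta_base]
    simp [hi]
  · intro k _
    obtain ⟨f, hf⟩ := B.theta_pow_base v p h k
    rw [map_smul, hf, hi, smul_zero]

/-- Only `θ² v = i d i d v` needs an argument: linearly the inner `i` lands in `sV'`, then `d` in
`V'`, where `i` vanishes. Although `θ` itself need not raise the filtration, it is thus nilpotent
modulo brackets, which suffices for the convergence of `e^θ`. -/
lemma theta_sq_mem {p : ℤ} (f : (freeLie (cylDeg deg)).obj p) :
    (B.theta p ^ 2) f ∈ (freeLie (cylDeg deg)).lcs 1 p := by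
  cases nonempty_fintype X
  refine mem_lcs_one_of_linCoeff fun y => ?_
  rw [linCoeff_map _ (fun f hf => by
    rw [pow_two, Module.End.mul_apply]
    exact B.theta_mem_lcs 1 (B.theta_mem_lcs 1 hf))]
  refine Finset.sum_eq_zero ?_
  rintro ⟨v | v | v, hv⟩ _
  · have : (B.theta p ^ 2) (gen (Sum.inl v) p hv) = B.i.toFun (neg_add_cancel_right p 1)
        (B.d.toFun rfl (B.i.toFun (neg_add_cancel_right p 1)
          (B.d.toFun rfl (gen (Sum.inl v) p hv)))) := by
      have hv' : deg v = p := hv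
      change (B.theta p ^ 2) (cylGen₀ v p hv') = _
      rw [pow_two, Module.End.mul_apply, theta_base, map_add, theta_prime, add_zero, B.theta_apply _ (rfl : p + -1 = p + -1) (by omega)
        (rfl : p + 1 = p + 1) (by omega), B.i_square_zero, map_zero, add_zero]
      rfl
    rw [this, B.linCoeff_i_eq_zero, mul_zero]
    intro u _
    exact B.linCoeff_d_eq_zero _ _ _ fun w => B.linCoeff_i_eq_zero _ _ fun _ h => by simp at h
  · have : (B.theta p ^ 2) (gen (Sum.inr (Sum.inl v)) p hv) = 0 := by
      rw [pow_two, Module.End.mul_apply]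
      exact (congrArg _ (B.theta_prime v p hv)).trans (map_zero _)
    rw [this, map_zero, mul_zero]
  · have : (B.theta p ^ 2) (gen (Sum.inr (Sum.inr v)) p hv) = 0 := by
      rw [pow_two, Module.End.mul_apply]
      exact (congrArg _ (B.theta_susp v p hv)).trans (map_zero _)
    rw [this, map_zero, mul_zero]

lemma theta_nilpotent (n : ℕ) : ∃ K : ℕ, ∀ k ≥ K, ∀ p (f : (freeLie (cylDeg deg)).obj p),
    divPow (B.theta p) k f ∈ (freeLie (cylDeg deg)).lcs n p := by
  refine divPow_mem_lcs B.theta B.theta_bracket (m := 2) (fun k hk p f => ?_) n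
  rw [divPow_mem_iff]
  induction k, hk using Nat.le_induction with
  | base => exact B.theta_sq_mem f
  | succ k _ ih =>
    rw [pow_succ', Module.End.mul_apply]
    exact B.theta_mem_lcs 1 ih

/-- The automorphism `e^θ`. -/
def expTheta : LieMap (freeLie (cylDeg deg)) (freeLie (cylDeg deg)) :=
  have H := fun (p : ℤ) (f : (freeLie (cylDeg deg)).obj p) =>
    (exists_hasExp B.theta (freeLie_isComplete (cylDeg deg)) B.theta_nilpotent f).choose_spec
  { toFun := fun p =>
      { toFun := fun f => (exists_hasExp B.theta (freeLie_isComplete (cylDeg deg))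
          B.theta_nilpotent f).choose
        map_add' := fun f g =>
          (H p (f + g)).unique (freeLie_isComplete _) ((H p f).add (H p g))
        map_smul' := fun c f =>
          (H p (c • f)).unique (freeLie_isComplete _) ((H p f).smul c) }
    map_bracket := fun h f g => (H _ _).unique (freeLie_isComplete _)
      (HasExp.bracket B.theta B.theta_bracket B.theta_nilpotent h (H _ f) (H _ g)) }

lemma hasExp_expTheta {p : ℤ} (f : (freeLie (cylDeg deg)).obj p) :
    (freeLie (cylDeg deg)).HasExp (B.theta p) f (B.expTheta.toFun p f) :=
  (exists_hasExp B.theta (freeLie_isComplete (cylDeg deg)) B.theta_nilpotent f).choose_spec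

lemma d_expTheta {p q : ℤ} (h : p + -1 = q) (f : (freeLie (cylDeg deg)).obj p) :
    B.expTheta.toFun q (B.d.toFun h f) = B.d.toFun h (B.expTheta.toFun p f) :=
  (B.hasExp_expTheta _).unique (freeLie_isComplete _)
    ((B.hasExp_expTheta f).map (B.d.toFun h) (fun n _ hx => B.d.map_lcs n h hx) (B.d_theta h))

end CylinderBase

section cylinder

variable {X : Type} [Fintype X] {deg : X → ℤ}

/-! ### Existence of the cylinder -/

/-- The inclusion `𝕃̂(V) → 𝕃̂(V ⊕ V' ⊕ sV')`. -/
def cylInl (deg : X → ℤ) : LieMap (freeLie deg) (freeLie (cylDeg deg)) :=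
  lift fun v => cylGen₀ v _ rfl

lemma cylInl_gen (v : X) (p : ℤ) (h : deg v = p) :
    (cylInl deg).toFun p (gen v p h) = cylGen₀ v p h := by
  subst h
  exact lift_gen _ v

/-- The extension of the differential of `𝕃̂(V)` with `d v' = 0` and `d (sv') = v'`. -/
def cylDerivation (δ : (freeLie deg).Differential) :
    (freeLie (cylDeg deg)).Derivation (-1) :=
  derivation (-1) fun x => match x with
    | Sum.inl v => (cylInl deg).toFun _ (δ.toFun rfl (gen v (deg v) rfl))
    | Sum.inr (Sum.inl _) => 0
    | Sum.inr (Sum.inr v) => cylGen₁ v (deg v + 1 + -1) (by omega)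

lemma cylDerivation_cylInl (δ : (freeLie deg).Differential) {p q : ℤ} (h : p + -1 = q)
    (f : (freeLie deg).obj p) : (cylInl deg).toFun q (δ.toFun h f) =
      (cylDerivation δ).toFun h ((cylInl deg).toFun p f) :=
  lieMap_comm_derivation (freeLie_isComplete _) (cylInl deg) δ.toDerivation (cylDerivation δ)
    (fun v => by
      rw [cylInl_gen]
      have : (cylDerivation δ).toFun (rfl : deg v + -1 = deg v + -1) (cylGen₀ v (deg v) rfl) =
          (cylInl deg).toFun _ (δ.toFun rfl (gen v (deg v) rfl)) :=
        derivation_gen (degX := cylDeg deg) (-1) _ (Sum.inl v)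
      exact this.symm) h f

lemma cylDerivation_prime (δ : (freeLie deg).Differential) (v : X) {p q : ℤ}
    (hp : deg v = p) (h : p + -1 = q) : (cylDerivation δ).toFun h (cylGen₁ v p hp) = 0 := by
  subst hp h
  exact derivation_gen (-1) _ (Sum.inr (Sum.inl v))

lemma cylDerivation_susp (δ : (freeLie deg).Differential) (v : X) {p q : ℤ}
    (hp : deg v + 1 = p) (hq : deg v = q) (h : p + -1 = q) :
    (cylDerivation δ).toFun h (cylGen₂ v p hp) = cylGen₁ v q hq := by
  subst hp h
  exact derivation_gen (-1) _ (Sum.inr (Sum.inr v))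

/-- The differential on `𝕃̂(V ⊕ V' ⊕ sV')`. -/
def cylDifferential (δ : (freeLie deg).Differential) :
    (freeLie (cylDeg deg)).Differential where
  toDerivation := cylDerivation δ
  square_zero := fun h h' f => by
    refine square_zero_of_gen (by decide) (cylDerivation δ) ?_ h h' f
    rintro (v | v | v)
    · have := cylDerivation_cylInl δ (rfl : deg v + -1 = _) (gen v (deg v) rfl)
      rw [cylInl_gen] at this
      refine (congrArg _ this.symm).trans ?_
      refine (cylDerivation_cylInl δ (rfl : deg v + -1 + -1 = _) _).symm.trans ?_
      exact (congrArg _ (δ.square_zero _ _ _)).trans (map_zero _)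
    · exact (congrArg _ (cylDerivation_prime δ v rfl rfl)).trans (map_zero _)
    · exact (congrArg _ (cylDerivation_susp δ v rfl (by omega) rfl)).trans
        (cylDerivation_prime δ v _ rfl)

/-- The derivation `i` with `i v = sv'`. -/
def cylI (deg : X → ℤ) : (freeLie (cylDeg deg)).Derivation 1 :=
  derivation 1 fun x => match x with
    | Sum.inl v => cylGen₂ v (deg v + 1) rfl
    | Sum.inr (Sum.inl _) => 0
    | Sum.inr (Sum.inr _) => 0

/-- The data from which the cylinder is constructed. -/
def cylBase (δ : (freeLie deg).Differential) : CylinderBase deg where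
  d := cylDifferential δ
  d_prime v _ _ hp h := cylDerivation_prime δ v hp h
  d_susp v _ _ hp hq h := cylDerivation_susp δ v hp hq h
  i := cylI deg
  i_base v p q hp hq h := by
    subst hp h
    exact derivation_gen 1 _ (Sum.inl v)
  i_prime v p q hp h := by
    subst hp h
    exact derivation_gen 1 _ (Sum.inr (Sum.inl v))
  i_susp v p q hp h := by
    subst hp h
    exact derivation_gen 1 _ (Sum.inr (Sum.inr v))

namespace CylinderBase

variable (B : CylinderBase deg)

/-- The morphism `ψ` with `ψ v = v`, `ψ v̂ = e^θ v`, `ψ v̄ = sv'`. -/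
def psi : LieMap (freeLie (cylDeg deg)) (freeLie (cylDeg deg)) :=
  lift fun x => match x with
    | Sum.inl v => cylGen₀ v (deg v) rfl
    | Sum.inr (Sum.inl v) => B.expTheta.toFun _ (cylGen₀ v (deg v) rfl)
    | Sum.inr (Sum.inr v) => cylGen₂ v (deg v + 1) rfl

lemma psi_base (v : X) (p : ℤ) (h : deg v = p) :
    B.psi.toFun p (cylGen₀ v p h) = cylGen₀ v p h := by
  subst h
  exact lift_gen _ (Sum.inl v)

lemma psi_hat (v : X) (p : ℤ) (h : deg v = p) :
    B.psi.toFun p (cylGen₁ v p h) = B.expTheta.toFun p (cylGen₀ v p h) := by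
  subst h
  exact lift_gen _ (Sum.inr (Sum.inl v))

lemma psi_bar (v : X) (p : ℤ) (h : deg v + 1 = p) :
    B.psi.toFun p (cylGen₂ v p h) = cylGen₂ v p h := by
  subst h
  exact lift_gen _ (Sum.inr (Sum.inr v))

/-- The linear part is triangular: `ψ` fixes the `v` and the last block of generators, and by
`linCoeff_hasExp` the component of `ψ v̂` in `V'` is exactly `v'`. -/
lemma psi_bijective (p : ℤ) : Function.Bijective (B.psi.toFun p) := by
  classical
  have key : ∀ (v u : X) (p : ℤ) (h : cylDeg deg (Sum.inr (Sum.inl v)) = p),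
      linCoeff (Sum.inr (Sum.inl u)) p (B.psi.toFun p (gen (Sum.inr (Sum.inl v)) p h)) =
        if v = u then 1 else 0 := by
    intro v u p h
    have h' : deg v = p := h
    refine (congrArg _ (B.psi_hat v p h')).trans ?_
    rw [B.linCoeff_hasExp v p h' (B.hasExp_expTheta _) (by simp)]
    refine (congrArg₂ (· + ·) (linCoeff_gen (degX := cylDeg deg) (Sum.inl v) _ h)
      (linCoeff_gen (degX := cylDeg deg) (Sum.inr (Sum.inl v)) _ h)).trans ?_
    simp
  refine bijective_of_triangular B.psi (Equiv.refl _) (fun _ => rfl)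
    (Set.range fun v => Sum.inr (Sum.inl v)) ?_ (fun _ => 1) (by simp) ?_ ?_ p
  · rintro (v | v | v) hv p h
    · exact B.psi_base v p h
    · exact absurd ⟨v, rfl⟩ hv
    · exact B.psi_bar v p h
  · rintro _ ⟨v, rfl⟩ p h
    exact (key v v p h).trans (if_pos rfl)
  · rintro _ ⟨v, rfl⟩ _ ⟨u, rfl⟩ hne p h
    refine (key v u p h).trans (if_neg ?_)
    rintro rfl
    exact hne rfl

/-- The differential `ψ⁻¹ d ψ`. -/
def conj : (freeLie (cylDeg deg)).Differential where
  toFun h := ((B.psi.inverse B.psi_bijective).toFun _).comp ((B.d.toFun h).comp (B.psi.toFun _))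
  leibniz h hr hp hq h₁ h₂ x y := by
    simp only [LinearMap.comp_apply]
    rw [B.psi.map_bracket, B.d.leibniz h hr hp hq h₁ h₂, map_add, map_units_smul,
      LieMap.map_bracket, LieMap.map_bracket]
    have e : ∀ p (x : (freeLie (cylDeg deg)).obj p),
        (B.psi.inverse B.psi_bijective).toFun p (B.psi.toFun p x) = x := fun p x =>
      (B.psi_bijective p).1 (LieMap.apply_inverse _ _ _ _)
    rw [e, e]
  square_zero h h' x := by
    simp only [LinearMap.comp_apply]
    rw [LieMap.apply_inverse, B.d.square_zero, map_zero]

lemma psi_conj {p q : ℤ} (h : p + -1 = q) (x : (freeLie (cylDeg deg)).obj p) :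
    B.psi.toFun q (B.conj.toFun h x) = B.d.toFun h (B.psi.toFun p x) :=
  LieMap.apply_inverse _ B.psi_bijective _ _

end CylinderBase

/-- The inclusion `v ↦ v̂`. -/
def cylInr (deg : X → ℤ) : LieMap (freeLie deg) (freeLie (cylDeg deg)) :=
  lift fun v => cylGen₁ v _ rfl

lemma cylInr_gen (v : X) (p : ℤ) (h : deg v = p) :
    (cylInr deg).toFun p (gen v p h) = cylGen₁ v p h := by
  subst h
  exact lift_gen _ v

lemma psi_cylInr (B : CylinderBase deg) (p : ℤ) (f : (freeLie deg).obj p) :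
    B.psi.toFun p ((cylInr deg).toFun p f) = B.expTheta.toFun p ((cylInl deg).toFun p f) := by
  refine lieMap_ext (freeLie_isComplete _) (B.psi.comp (cylInr deg))
    (B.expTheta.comp (cylInl deg)) (fun v => ?_) p f
  refine (congrArg _ (cylInr_gen v _ rfl)).trans ((B.psi_hat v _ rfl).trans ?_)
  exact (congrArg (B.expTheta.toFun (deg v)) (cylInl_gen v _ rfl)).symm

theorem exists_cylinder (δ : (freeLie deg).Differential) : Nonempty (Cylinder δ) := by
  let B := cylBase δ
  let ψ : freeCDGL B.conj ⟶ freeCDGL B.d :=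
    homMk (L := freeCDGL B.conj) (M := freeCDGL B.d) B.psi B.psi_conj
  -- Tested after the injective `ψ`, the inclusion `v ↦ v̂` becomes `e^θ` composed with `v ↦ v`, and
  -- both of these commute with the differentials.
  have hι : ∀ {p q : ℤ} (h : p + -1 = q) (f : (freeLie deg).obj p),
      (cylInr deg).toFun q (δ.toFun h f) = B.conj.toFun h ((cylInr deg).toFun p f) := by
    intro p q h f
    refine (B.psi_bijective q).1 ?_
    rw [B.psi_conj, psi_cylInr, psi_cylInr, cylDerivation_cylInl]
    exact B.d_expTheta h _
  exact ⟨{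
    d := B.d
    lam₀ := homMk (L := freeCDGL δ) (M := freeCDGL B.d) (cylInl deg) (cylDerivation_cylInl δ)
    lam₀_gen := cylInl_gen
    d_prime := B.d_prime
    d_susp := B.d_susp
    i := B.i
    i_base := B.i_base
    i_prime := B.i_prime
    i_susp := B.i_susp
    D := B.conj
    ψ := isoOfBijective ψ B.psi_bijective
    ψ_base := B.psi_base
    ψ_hat := fun v p h => by
      have := B.hasExp_expTheta (cylGen₀ v p h)
      rw [← B.psi_hat v p h] at this
      exact this
    ψ_bar := B.psi_bar
    ι₁ := homMk (L := freeCDGL δ) (M := freeCDGL B.conj) (cylInr deg) hι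
    ι₁_gen := cylInr_gen }⟩

/-! ### The cylinder as a coproduct of `𝕃̂(V̂)` and an acyclic algebra -/

namespace Cylinder

variable {δ : (freeLie deg).Differential} (Z : Cylinder δ)

/-- The data on `𝕃̂(V ⊕ V' ⊕ sV')` that underlie a cylinder. -/
def base : CylinderBase deg where
  d := Z.d
  d_prime := Z.d_prime
  d_susp := Z.d_susp
  i := Z.i
  i_base := Z.i_base
  i_prime := Z.i_prime
  i_susp := Z.i_susp

open Classical in
/-- The coefficient of `u` in `D v̄`. -/
lemma linCoeff_D_bar (v u : X) {p q : ℤ} (h : deg v + 1 = p) (hq : p + -1 = q) :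
    linCoeff (Sum.inl u) q (Z.D.toFun hq (cylGen₂ v p h)) = if v = u then -1 else 0 := by
  set y := Z.D.toFun hq (cylGen₂ v p h) with hy
  have hv : cylDeg deg (Sum.inr (Sum.inl v)) = q := by change deg v = q; omega
  -- `Ψ` is `ψ` stripped of the category structure; its value on `D v̄` is `d (sv') = v'`.
  obtain ⟨Ψ, hψ, h0, h1, h2⟩ : ∃ Ψ : LieMap (freeLie (cylDeg deg)) (freeLie (cylDeg deg)),
      Ψ.toFun q y = gen (Sum.inr (Sum.inl v)) q hv ∧
      (∀ w hx, Ψ.toFun q (gen (Sum.inl w) q hx) = gen (Sum.inl w) q hx) ∧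
      (∀ w (hw : deg w = q), (freeLie (cylDeg deg)).HasExp (Z.base.theta q) (cylGen₀ w q hw)
        (Ψ.toFun q (cylGen₁ w q hw))) ∧
      ∀ w hx, Ψ.toFun q (gen (Sum.inr (Sum.inr w)) q hx) = gen (Sum.inr (Sum.inr w)) q hx := by
    refine ⟨lieMap Z.ψ.hom, ?_, fun w => Z.ψ_base w q, fun w => Z.ψ_hat w q, fun w => Z.ψ_bar w q⟩
    refine (hom_map_d Z.ψ.hom hq (cylGen₂ v p h)).trans ?_
    rw [Z.ψ_bar]
    exact Z.d_susp v h hv hq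
  by_cases hu : cylDeg deg (Sum.inl u) = q
  swap
  · rw [linCoeff_eq_zero_of_ne _ hu, if_neg]
    rintro rfl
    exact hu hv
  -- The difference of the coefficients of `u` and `u'`, taken after `ψ`, reads off the coefficient
  -- of `u` before `ψ`: on `ŵ` the two contributions of `w + w'` cancel. Evaluated on `ψ (D v̄) =
  -- v'` it gives `0 - 1` when `u = v`.
  have key : ∀ (x : X ⊕ X ⊕ X) (hx : cylDeg deg x = q),
      linCoeff (Sum.inl u) q (Ψ.toFun q (gen x q hx)) -
        linCoeff (Sum.inr (Sum.inl u)) q (Ψ.toFun q (gen x q hx)) =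
      if x = Sum.inl u then 1 else 0 := by
    rintro (w | w | w) hx
    · rw [h0, linCoeff_gen, linCoeff_gen]
      simp
    · have hw : deg w = q := hx
      have e0 := fun y => linCoeff_gen (degX := cylDeg deg) (Sum.inl w) y hw
      have e1 := fun y => linCoeff_gen (degX := cylDeg deg) (Sum.inr (Sum.inl w)) y hw
      refine (congrArg₂ (· - ·) (Z.base.linCoeff_hasExp w q hw (h1 w hw) (by simp))
        (Z.base.linCoeff_hasExp w q hw (h1 w hw) (by simp))).trans ?_
      refine (congrArg₂ (· - ·) (congrArg₂ (· + ·) (e0 _) (e1 _))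
        (congrArg₂ (· + ·) (e0 _) (e1 _))).trans ?_
      simp
    · rw [h2, linCoeff_gen, linCoeff_gen]
      simp
  have hmap := fun z => linCoeff_map (Ψ.toFun q) (fun f hf => Ψ.map_lcs 1 hf) y z
  have h1 := congrArg₂ (· - ·) (hmap (Sum.inl u)) (hmap (Sum.inr (Sum.inl u)))
  simp only [← Finset.sum_sub_distrib, ← mul_sub, key, mul_ite, mul_one, mul_zero] at h1
  rw [Finset.sum_eq_single ⟨Sum.inl u, hu⟩] at h1
  · rw [if_pos rfl, hψ, linCoeff_gen, linCoeff_gen] at h1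
    rw [← h1]
    by_cases huv : v = u
    · simp [huv]
    · simp [huv]
  · rintro ⟨x, hx⟩ _ hne
    rw [if_neg]
    rintro rfl
    exact hne rfl
  · simp

/-- The morphism `𝕃̂(V ⊕ V' ⊕ sV') → 𝕃̂(V ⊕ V̂ ⊕ V̄)` with `v ↦ v̂`, `v' ↦ D v̄` and `sv' ↦ v̄`. -/
def unrollMap : LieMap (freeLie (cylDeg deg)) (freeLie (cylDeg deg)) :=
  lift fun x => match x with
    | Sum.inl v => cylGen₁ v (deg v) rfl
    | Sum.inr (Sum.inl v) => Z.D.toFun (add_neg_cancel_right _ 1) (cylGen₂ v (deg v + 1) rfl)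
    | Sum.inr (Sum.inr v) => cylGen₂ v (deg v + 1) rfl

lemma unrollMap_base (v : X) (p : ℤ) (h : deg v = p) :
    Z.unrollMap.toFun p (cylGen₀ v p h) = cylGen₁ v p h := by
  subst h
  exact lift_gen _ (Sum.inl v)

lemma unrollMap_prime (v : X) {p q : ℤ} (h : deg v = p) (h' : deg v + 1 = q) (hq : q + -1 = p) :
    Z.unrollMap.toFun p (cylGen₁ v p h) = Z.D.toFun hq (cylGen₂ v q h') := by
  subst h h'
  exact lift_gen _ (Sum.inr (Sum.inl v))

lemma unrollMap_susp (v : X) (p : ℤ) (h : deg v + 1 = p) :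
    Z.unrollMap.toFun p (cylGen₂ v p h) = cylGen₂ v p h := by
  subst h
  exact lift_gen _ (Sum.inr (Sum.inr v))

lemma unrollMap_lam₀ (p : ℤ) (f : (freeLie deg).obj p) :
    Z.unrollMap.toFun p (Z.lam₀.toFun p f) = Z.ι₁.toFun p f := by
  refine lieMap_ext (freeLie_isComplete _) (Z.unrollMap.comp (lieMap Z.lam₀)) (lieMap Z.ι₁)
    (fun v => ?_) p f
  refine (congrArg _ (Z.lam₀_gen v _ rfl)).trans ((Z.unrollMap_base v _ rfl).trans ?_)
  exact (Z.ι₁_gen v _ rfl).symm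

lemma unrollMap_bijective (p : ℤ) : Function.Bijective (Z.unrollMap.toFun p) := by
  classical
  have key : ∀ (v u : X) (p : ℤ) (h : cylDeg deg (Sum.inr (Sum.inl v)) = p),
      linCoeff (Sum.inl u) p (Z.unrollMap.toFun p (gen (Sum.inr (Sum.inl v)) p h)) =
        if v = u then -1 else 0 := by
    intro v u p h
    have h' : deg v = p := h
    refine (congrArg _ (Z.unrollMap_prime v h' rfl (by omega))).trans ?_
    rw [Z.linCoeff_D_bar]
  -- `v` goes to `v̂`, and `v'` goes to `D v̄` with diagonal term `-v`, so the first two blocks are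
  -- exchanged.
  let e : X ⊕ X ⊕ X ≃ X ⊕ X ⊕ X :=
    { toFun := fun x => match x with
        | Sum.inl v => Sum.inr (Sum.inl v)
        | Sum.inr (Sum.inl v) => Sum.inl v
        | Sum.inr (Sum.inr v) => Sum.inr (Sum.inr v)
      invFun := fun x => match x with
        | Sum.inl v => Sum.inr (Sum.inl v)
        | Sum.inr (Sum.inl v) => Sum.inl v
        | Sum.inr (Sum.inr v) => Sum.inr (Sum.inr v)
      left_inv := by rintro (v | v | v) <;> rfl
      right_inv := by rintro (v | v | v) <;> rfl }
  refine bijective_of_triangular Z.unrollMap e (by rintro (v | v | v) <;> rfl)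
    (Set.range fun v => Sum.inr (Sum.inl v)) ?_ (fun _ => -1) (by simp) ?_ ?_ p
  · rintro (v | v | v) hv p h
    · exact Z.unrollMap_base v p h
    · exact absurd ⟨v, rfl⟩ hv
    · exact Z.unrollMap_susp v p h
  · rintro _ ⟨v, rfl⟩ p h
    exact (key v v p h).trans (if_pos rfl)
  · rintro _ ⟨v, rfl⟩ _ ⟨u, rfl⟩ hne p h
    refine (key v u p h).trans (if_neg ?_)
    rintro rfl
    exact hne rfl

/-- The isomorphism `𝕃̂(V ⊕ V' ⊕ sV') ≅ Cyl` with `v ↦ v̂`, `v' ↦ D v̄` and `sv' ↦ v̄`. -/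
def unroll : freeCDGL Z.d ≅ freeCDGL Z.D :=
  isoOfBijective (freeHomMk (δ := Z.d) (C := freeCDGL Z.D) Z.unrollMap (by
    rintro (v | v | v)
    · have h1 := hom_map_d Z.lam₀ (rfl : deg v + -1 = _) (gen v (deg v) rfl)
      rw [Z.lam₀_gen] at h1
      refine (congrArg _ h1.symm).trans ((Z.unrollMap_lam₀ _ _).trans ?_)
      refine (hom_map_d Z.ι₁ rfl _).trans (congrArg _ ?_)
      exact (Z.ι₁_gen v _ rfl).trans (Z.unrollMap_base v _ rfl).symm
    · have h1 := Z.unrollMap_prime v rfl rfl (add_neg_cancel_right (deg v) 1)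
      refine (congrArg _ (Z.d_prime v rfl rfl)).trans ((map_zero _).trans ?_)
      refine Eq.trans ?_ (congrArg _ h1.symm)
      exact (Z.D.square_zero _ _ _).symm
    · refine (congrArg _ (Z.d_susp v rfl (by omega) rfl)).trans ?_
      refine (Z.unrollMap_prime v (by omega) rfl rfl).trans (congrArg _ ?_)
      exact (Z.unrollMap_susp v _ rfl).symm)) Z.unrollMap_bijective

/-- This turns a pushout along `ι₁`, where `D` is not explicit, into one along `lam₀`, where every
differential is known. -/
lemma lam₀_unroll : Z.lam₀ ≫ Z.unroll.hom = Z.ι₁ :=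
  CDGL.hom_ext Z.unrollMap_lam₀

end Cylinder

end cylinder

/-! ### Maurer-Cartan elements -/

/-- For `a` of odd degree the Jacobi identity reads `3 [a, [a, a]] = 0`. This is what `d² a = 0`
requires of a Maurer-Cartan generator. -/
lemma GradedLie.bracket_bracket_self (L : GradedLie) {p q r : ℤ} (hp : Odd p) (h : p + p = q)
    (h' : p + q = r) (a : L.obj p) : L.bracket h' a (L.bracket h a a) = 0 := by
  have e := L.jacobi h h h h' (by omega : q + p = r) h' a a a
  have hq : Even (q * p) := by
    rw [← h]
    exact (Even.add_self p).mul_right p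
  rw [L.antisymm (by omega : q + p = r) h', Int.negOnePow_even _ hq,
    Int.negOnePow_odd _ (hp.mul hp)] at e
  have e3 : (3 : ℚ) • L.bracket h' a (L.bracket h a a) = 0 := by
    simp only [one_smul, Units.neg_smul] at e
    have : L.bracket h' a (L.bracket h a a) + L.bracket h' a (L.bracket h a a) +
        L.bracket h' a (L.bracket h a a) = 0 := by
      nth_rewrite 1 [e]
      abel
    rw [← this, show (3 : ℚ) = 1 + 1 + 1 by norm_num, add_smul, add_smul, one_smul]
  exact (smul_eq_zero.mp e3).resolve_left (by norm_num)

namespace CDGL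

lemma isMC_iff {L : CDGL} {a : L.toGradedLie.obj (-1)} {q : ℤ} (h : (-1 : ℤ) + -1 = q) :
    L.IsMC a ↔ L.d.toFun h a = -((1 / 2 : ℚ) • L.toGradedLie.bracket h a a) := by
  obtain rfl : q = -2 := by omega
  rfl

lemma IsMC.map {L M : CDGL} (f : L ⟶ M) {a : L.toGradedLie.obj (-1)} (h : L.IsMC a) :
    M.IsMC (f.toFun (-1) a) := by
  rw [isMC_iff rfl] at h ⊢
  rw [← hom_map_d, h, map_neg, map_smul, hom_map_bracket]

lemma IsMC.of_injective {L M : CDGL} (f : L ⟶ M) (hf : ∀ p, Function.Injective (f.toFun p))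
    {a : L.toGradedLie.obj (-1)} (h : M.IsMC (f.toFun (-1) a)) : L.IsMC a := by
  rw [isMC_iff rfl] at h ⊢
  refine hf _ ?_
  rw [hom_map_d, h, map_neg, map_smul, hom_map_bracket]

end CDGL

/-! ### The canonical model of a contractible complex -/

section canonical

variable {J : Type} [Fintype J]

/-- Degrees of the generators `a`, `z_j`, `w_j` of the canonical model. -/
def canDeg (deg : J → ℤ) : Unit ⊕ J ⊕ J → ℤ :=
  Sum.elim (fun _ => -1) (Sum.elim deg fun j => deg j + 1)

variable {deg : J → ℤ}

/-- The Maurer-Cartan generator `a`. -/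
def canApex (deg : J → ℤ) : (freeLie (canDeg deg)).obj (-1) :=
  FreeLie.gen (deg := canDeg deg) (Sum.inl ()) (-1) rfl

/-- The generator `z_j`, the boundary of `w_j`. -/
def canZ (j : J) (p : ℤ) (h : deg j = p) : (freeLie (canDeg deg)).obj p :=
  FreeLie.gen (deg := canDeg deg) (Sum.inr (Sum.inl j)) p h

/-- The generator `w_j`. -/
def canW (j : J) (p : ℤ) (h : deg j + 1 = p) : (freeLie (canDeg deg)).obj p :=
  FreeLie.gen (deg := canDeg deg) (Sum.inr (Sum.inr j)) p h

/-- The derivation with `d a = -½ [a, a]`, `d z_j = 0`, `d w_j = z_j`. -/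
def canDerivation (deg : J → ℤ) : (freeLie (canDeg deg)).Derivation (-1) :=
  derivation (-1) fun x => match x with
    | Sum.inl _ => -((1 / 2 : ℚ) • (freeLie (canDeg deg)).bracket rfl (canApex deg) (canApex deg))
    | Sum.inr (Sum.inl _) => 0
    | Sum.inr (Sum.inr j) => canZ j (deg j + 1 + -1) (by omega)

lemma canDerivation_apex {q : ℤ} (h : (-1 : ℤ) + -1 = q) :
    (canDerivation deg).toFun h (canApex deg) =
      -((1 / 2 : ℚ) • (freeLie (canDeg deg)).bracket h (canApex deg) (canApex deg)) := by
  subst h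
  exact derivation_gen (degX := canDeg deg) (-1) _ (Sum.inl ())

lemma canDerivation_z (j : J) {p q : ℤ} (hp : deg j = p) (h : p + -1 = q) :
    (canDerivation deg).toFun h (canZ j p hp) = 0 := by
  subst hp h
  exact derivation_gen (degX := canDeg deg) (-1) _ (Sum.inr (Sum.inl j))

lemma canDerivation_w (j : J) {p q : ℤ} (hp : deg j + 1 = p) (hq : deg j = q) (h : p + -1 = q) :
    (canDerivation deg).toFun h (canW j p hp) = canZ j q hq := by
  subst hp h
  exact derivation_gen (degX := canDeg deg) (-1) _ (Sum.inr (Sum.inr j))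

/-- The differential of the canonical model. -/
def canDiff (deg : J → ℤ) : (freeLie (canDeg deg)).Differential where
  toDerivation := canDerivation deg
  square_zero := fun h h' f => by
    refine square_zero_of_gen (by decide) (canDerivation deg) ?_ h h' f
    rintro (u | j | j)
    · refine (congrArg _ (canDerivation_apex rfl)).trans ?_
      change (canDerivation deg).toFun (rfl : (-1 : ℤ) + -1 + -1 = -1 + -1 + -1) _ = 0
      -- Once `d a` is substituted, every term of `d² a` is a multiple of `[a, [a, a]]`.
      rw [map_neg, map_smul, (canDerivation deg).leibniz rfl rfl rfl rfl rfl rfl,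
        canDerivation_apex, (freeLie (canDeg deg)).antisymm _ (rfl : (-1 : ℤ) + (-1 + -1) = _)]
      simp only [map_neg, map_smul, bracket_bracket_self _ (by decide : Odd (-1 : ℤ))]
      simp
    · exact (congrArg _ (canDerivation_z j rfl rfl)).trans (map_zero _)
    · exact (congrArg _ (canDerivation_w j rfl (by omega) rfl)).trans (canDerivation_z j _ rfl)

lemma isMC_canApex : (freeCDGL (canDiff deg)).IsMC (canApex deg) :=
  canDerivation_apex _

section hom

variable {Y : Type} {degY : Y → ℤ} {δ : (freeLie degY).Differential}
  (α : (freeLie degY).obj (-1)) (ω : ∀ j, (freeLie degY).obj (deg j + 1))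

/-- The morphism of graded Lie algebras with `a ↦ α`, `w_j ↦ ω_j`, `z_j ↦ d ω_j`. -/
def canLift (δ : (freeLie degY).Differential) (α : (freeLie degY).obj (-1))
    (ω : ∀ j, (freeLie degY).obj (deg j + 1)) : LieMap (freeLie (canDeg deg)) (freeLie degY) :=
  lift fun x => match x with
    | Sum.inl _ => α
    | Sum.inr (Sum.inl j) => δ.toFun (add_neg_cancel_right _ 1) (ω j)
    | Sum.inr (Sum.inr j) => ω j

lemma canLift_apex : (canLift δ α ω).toFun (-1) (canApex deg) = α :=
  lift_gen (degX := canDeg deg) _ (Sum.inl ())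

lemma canLift_w (j : J) : (canLift δ α ω).toFun _ (canW j _ rfl) = ω j :=
  lift_gen (degX := canDeg deg) _ (Sum.inr (Sum.inr j))

lemma canLift_z (j : J) {p : ℤ} (h : deg j = p) (h' : deg j + 1 + -1 = p) :
    (canLift δ α ω).toFun p (canZ j p h) = δ.toFun h' (ω j) := by
  subst h
  exact lift_gen (degX := canDeg deg) _ (Sum.inr (Sum.inl j))

/-- The morphism of differential graded Lie algebras with `a ↦ α`, `w_j ↦ ω_j`. -/
def canHom [Finite Y] (hα : (freeCDGL δ).IsMC α) : freeCDGL (canDiff deg) ⟶ freeCDGL δ :=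
  freeHomMk (δ := canDiff deg) (C := freeCDGL δ) (canLift δ α ω) (by
    rintro (u | j | j)
    · refine (congrArg _ (canDerivation_apex rfl)).trans ?_
      change (canLift δ α ω).toFun (-1 + -1) _ = δ.toFun rfl ((canLift δ α ω).toFun (-1) (canApex deg))
      rw [map_neg, map_smul, LieMap.map_bracket, canLift_apex]
      exact ((isMC_iff (L := freeCDGL δ) rfl).mp hα).symm
    · refine (congrArg _ (canDerivation_z j rfl rfl)).trans ((map_zero _).trans ?_)
      refine Eq.trans ?_ (congrArg _ (canLift_z α ω j rfl (by omega)).symm)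
      exact (δ.square_zero _ _ _).symm
    · refine (congrArg _ (canDerivation_w j rfl (by omega) rfl)).trans ?_
      exact (canLift_z α ω j _ rfl).trans (congrArg _ (canLift_w α ω j).symm))

end hom

/-- The values on the `z_j = d w_j` are forced by compatibility with the differentials. -/
lemma can_hom_ext {C : CDGL} {f g : freeCDGL (canDiff deg) ⟶ C}
    (ha : f.toFun (-1) (canApex deg) = g.toFun (-1) (canApex deg))
    (hw : ∀ j, f.toFun _ (canW j _ rfl) = g.toFun _ (canW j _ rfl)) : f = g := by
  refine freeCDGL_hom_ext ?_
  rintro (u | j | j)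
  · exact ha
  · have e : ∀ f : freeCDGL (canDiff deg) ⟶ C, f.toFun (deg j) (canZ j _ rfl) =
        C.d.toFun (add_neg_cancel_right _ 1) (f.toFun _ (canW j _ rfl)) := fun f =>
      (congrArg _ (canDerivation_w j rfl rfl _).symm).trans
        (hom_map_d f (add_neg_cancel_right _ 1) (canW j _ rfl))
    exact (e f).trans ((congrArg _ (hw j)).trans (e g).symm)
  · exact hw j

end canonical

/-! ### Morphisms out of `𝕃̂(V ⊕ V' ⊕ sV')` -/

namespace Cylinder

variable {X : Type} [Fintype X] {deg : X → ℤ} {δ : (freeLie deg).Differential} (Z : Cylinder δ)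
  {Y : Type} [Finite Y] {degY : Y → ℤ} {δY : (freeLie degY).Differential}
  (κ : freeCDGL δ ⟶ freeCDGL δY) (ω : ∀ v, (freeLie degY).obj (deg v + 1))

/-- The morphism of graded Lie algebras with `v ↦ κ v`, `v' ↦ d ω_v`, `sv' ↦ ω_v`. -/
def descMap {δ : (freeLie deg).Differential} {δY : (freeLie degY).Differential}
    (κ : freeCDGL δ ⟶ freeCDGL δY) (ω : ∀ v, (freeLie degY).obj (deg v + 1)) :
    LieMap (freeLie (cylDeg deg)) (freeLie degY) :=
  lift fun x => match x with
    | Sum.inl v => κ.toFun _ (gen v (deg v) rfl)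
    | Sum.inr (Sum.inl v) => δY.toFun (add_neg_cancel_right _ 1) (ω v)
    | Sum.inr (Sum.inr v) => ω v

lemma descMap_base (v : X) :
    (descMap κ ω).toFun _ (cylGen₀ v _ rfl) = κ.toFun _ (gen v (deg v) rfl) :=
  lift_gen (degX := cylDeg deg) _ (Sum.inl v)

lemma descMap_prime (v : X) {p : ℤ} (h : deg v = p) (h' : deg v + 1 + -1 = p) :
    (descMap κ ω).toFun p (cylGen₁ v p h) = δY.toFun h' (ω v) := by
  subst h
  exact lift_gen (degX := cylDeg deg) _ (Sum.inr (Sum.inl v))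

lemma descMap_susp (v : X) : (descMap κ ω).toFun _ (cylGen₂ v _ rfl) = ω v :=
  lift_gen (degX := cylDeg deg) _ (Sum.inr (Sum.inr v))

lemma descMap_lam₀ (p : ℤ) (f : (freeLie deg).obj p) :
    (descMap κ ω).toFun p (Z.lam₀.toFun p f) = κ.toFun p f := by
  refine lieMap_ext (freeLie_isComplete _) ((descMap κ ω).comp (lieMap Z.lam₀)) (lieMap κ)
    (fun v => ?_) p f
  exact (congrArg _ (Z.lam₀_gen v _ rfl)).trans (descMap_base κ ω v)

/-- The morphism of differential graded Lie algebras with `v ↦ κ v`, `sv' ↦ ω_v`. -/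
def desc : freeCDGL Z.d ⟶ freeCDGL δY :=
  freeHomMk (δ := Z.d) (C := freeCDGL δY) (descMap κ ω) (by
    rintro (v | v | v)
    · have h1 := hom_map_d Z.lam₀ (rfl : deg v + -1 = _) (gen v (deg v) rfl)
      rw [Z.lam₀_gen] at h1
      refine (congrArg _ h1.symm).trans ((Z.descMap_lam₀ κ ω _ _).trans ?_)
      exact (hom_map_d κ rfl _).trans (congrArg _ (descMap_base κ ω v).symm)
    · refine (congrArg _ (Z.d_prime v rfl rfl)).trans ((map_zero _).trans ?_)
      refine Eq.trans ?_ (congrArg _ (descMap_prime κ ω v rfl (by omega)).symm)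
      exact (δY.square_zero _ _ _).symm
    · refine (congrArg _ (Z.d_susp v rfl (by omega) rfl)).trans ?_
      exact (descMap_prime κ ω v _ rfl).trans (congrArg _ (descMap_susp κ ω v).symm))

lemma lam₀_desc : Z.lam₀ ≫ Z.desc κ ω = κ := CDGL.hom_ext (Z.descMap_lam₀ κ ω)

/-- Morphisms out of `𝕃̂(V ⊕ V' ⊕ sV')` are determined by their values on `V` and `sV'`. -/
lemma hom_ext {C : CDGL} {f g : freeCDGL Z.d ⟶ C}
    (hv : ∀ v, f.toFun _ (cylGen₀ v (deg v) rfl) = g.toFun _ (cylGen₀ v (deg v) rfl))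
    (hs : ∀ v, f.toFun _ (cylGen₂ v _ rfl) = g.toFun _ (cylGen₂ v _ rfl)) : f = g := by
  refine freeCDGL_hom_ext ?_
  rintro (v | v | v)
  · exact hv v
  · have e : ∀ f : freeCDGL Z.d ⟶ C, f.toFun (deg v) (cylGen₁ v _ rfl) =
        C.d.toFun (add_neg_cancel_right _ 1) (f.toFun _ (cylGen₂ v _ rfl)) := fun f =>
      (congrArg _ (Z.d_susp v rfl rfl _).symm).trans
        (hom_map_d f (add_neg_cancel_right _ 1) (cylGen₂ v _ rfl))
    exact (e f).trans ((congrArg _ (hs v)).trans (e g).symm)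
  · exact hs v

end Cylinder

/-! ### Relabelling of generators -/

section relabel

variable {X Y : Type} [Fintype X] {degX : X → ℤ} {degY : Y → ℤ} (f : X → Y)
  (hdeg : ∀ x, degY (f x) = degX x)

/-- The morphism that is induced by a map of generators. -/
def relabel (f : X → Y) (hdeg : ∀ x, degY (f x) = degX x) :
    LieMap (freeLie degX) (freeLie degY) :=
  lift fun x => gen (f x) _ (hdeg x)

lemma relabel_gen (x : X) (p : ℤ) (h : degX x = p) :
    (relabel f hdeg).toFun p (gen x p h) = gen (f x) p ((hdeg x).trans h) := by
  subst h
  exact lift_gen _ x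

/-- A left inverse is the morphism of graded Lie algebras that sends the generators outside the
image of `f` to zero. -/
lemma relabel_injective [Fintype Y] (hf : Function.Injective f) (p : ℤ) :
    Function.Injective ((relabel f hdeg).toFun p) := by
  classical
  let r : LieMap (freeLie degY) (freeLie degX) := lift fun y =>
    if h : ∃ x, f x = y then gen h.choose _ (by rw [← hdeg, h.choose_spec]) else 0
  refine Function.LeftInverse.injective (g := r.toFun p) fun x => ?_
  refine lieMap_ext (freeLie_isComplete degX) (r.comp (relabel f hdeg)) (LieMap.id _)
    (fun x => ?_) p x
  change r.toFun _ ((relabel f hdeg).toFun _ (gen x _ rfl)) = gen x _ rfl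
  rw [relabel_gen]
  have key : ∀ q (h : degY (f x) = q) (h' : degX x = q),
      r.toFun q (gen (f x) q h) = gen x q h' := by
    rintro _ rfl h'
    have hx : ∃ x', f x' = f x := ⟨x, rfl⟩
    refine (lift_gen _ (f x)).trans ?_
    rw [dif_pos hx]
    congr 1
    exact hf hx.choose_spec
  exact key _ _ rfl

lemma linCoeff_relabel (hf : Function.Injective f) (x : X) (p : ℤ) (g : (freeLie degX).obj p) :
    linCoeff (f x) p ((relabel f hdeg).toFun p g) = linCoeff x p g := by
  classical
  rw [linCoeff_map _ (fun g hg => (relabel f hdeg).map_lcs 1 hg)]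
  by_cases hx : degX x = p
  · rw [Finset.sum_eq_single ⟨x, hx⟩]
    · rw [relabel_gen, linCoeff_gen, if_pos rfl, mul_one]
    · rintro ⟨y, hy⟩ _ hne
      rw [relabel_gen, linCoeff_gen, if_neg, mul_zero]
      exact fun h => hne (Subtype.ext (hf h))
    · simp
  · rw [linCoeff_eq_zero_of_ne g hx]
    refine Finset.sum_eq_zero ?_
    rintro ⟨y, hy⟩ _
    rw [relabel_gen, linCoeff_gen, if_neg, mul_zero]
    intro h
    exact hx (hf h ▸ hy)

end relabel

namespace SimplexModels

variable (M : SimplexModels) {n : ℕ} {K : PreAbstractSimplicialComplex (Fin (n + 1))}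

/-! ### Models of complexes -/

instance (K : PreAbstractSimplicialComplex (Fin (n + 1))) : Fintype K.faces :=
  Fintype.ofFinite _

/-- A simplex of `K` as a simplex of `Δⁿ`. -/
def toFull (σ : K.faces) : (fullSimplex n).faces :=
  ⟨σ.1, (K.isRelLowerSet_faces σ.2).1⟩

lemma toFull_injective : Function.Injective (toFull (K := K)) := fun _ _ h =>
  Subtype.ext (congrArg (fun s => s.1) h)

lemma nonempty_of_mem (σ : K.faces) : σ.1.Nonempty := (K.isRelLowerSet_faces σ.2).1

lemma mem_of_subset (σ : K.faces) {t : Finset (Fin (n + 1))} (h : t ⊆ σ.1) (ht : t.Nonempty) :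
    t ∈ K.faces := (K.isRelLowerSet_faces σ.2).2 h ht

/-- The inclusion of `𝕃̂(s⁻¹C_*(K))` into `𝕃̂(s⁻¹C_*(Δⁿ))`. -/
def incl (K : PreAbstractSimplicialComplex (Fin (n + 1))) :
    LieMap (freeLie (simplexDeg K)) (freeLie (simplexDeg (fullSimplex n))) :=
  relabel toFull fun _ => rfl

lemma incl_gen (σ : K.faces) (p : ℤ) (h : simplexDeg K σ = p) :
    (incl K).toFun p (gen σ p h) = gen (toFull σ) p h :=
  relabel_gen _ _ σ p h

lemma incl_injective (p : ℤ) : Function.Injective ((incl K).toFun p) :=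
  relabel_injective _ _ toFull_injective p

/-- The image of a simplex under the injection of the vertices of a face. -/
def faceMap (σ : K.faces) {m : ℕ} (hm : σ.1.card = m + 1) (τ : (fullSimplex m).faces) : K.faces :=
  ⟨τ.1.map (σ.1.orderEmbOfFin hm).toEmbedding, mem_of_subset σ
    ((Finset.map_subset_map.mpr (Finset.subset_univ _)).trans
      (Finset.map_orderEmbOfFin_univ σ.1 hm).subset) (Finset.Nonempty.map τ.2)⟩

/-- The top simplex of `Δᵐ`. -/
def topFace (m : ℕ) : (fullSimplex m).faces := ⟨Finset.univ, Finset.univ_nonempty⟩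

lemma eq_point (σ : (fullSimplex 0).faces) : σ = point := by
  refine Subtype.ext (Finset.eq_singleton_iff_nonempty_unique_mem.mpr ⟨σ.2, fun x _ => ?_⟩)
  exact Subsingleton.elim (α := Fin 1) _ _

lemma faceMap_topFace (σ : K.faces) {m : ℕ} (hm : σ.1.card = m + 1) :
    faceMap σ hm (topFace m) = σ :=
  Subtype.ext (Finset.map_orderEmbOfFin_univ σ.1 hm)

lemma simplexDeg_faceMap (σ : K.faces) {m : ℕ} (hm : σ.1.card = m + 1)
    (τ : (fullSimplex m).faces) : simplexDeg K (faceMap σ hm τ) = simplexDeg _ τ := by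
  simp [simplexDeg, faceMap]

/-- Numbering the vertices of `σ` in increasing order gives an injection to which naturality
applies. The resulting morphism factors through the algebra on `K`, since all faces of `σ` belong to
`K`. -/
lemma exists_faceHom (σ : K.faces) {m : ℕ} (hm : σ.1.card = m + 1) :
    ∃ φ : M.simplex m ⟶ M.simplex n, ∀ p f, φ.toFun p f =
      (incl K).toFun p ((relabel (faceMap σ hm) (simplexDeg_faceMap σ hm)).toFun p f) := by
  obtain ⟨φ, hφ⟩ := M.natural m n (σ.1.orderEmbOfFin hm)
  refine ⟨φ, lieMap_ext (freeLie_isComplete _) (lieMap φ)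
    ((incl K).comp (relabel (faceMap σ hm) (simplexDeg_faceMap σ hm))) fun τ => ?_⟩
  refine (hφ τ (toFull (faceMap σ hm τ)) rfl _ rfl (simplexDeg_faceMap σ hm τ)).trans ?_
  change _ = (incl K).toFun _ ((relabel _ _).toFun _ _)
  rw [relabel_gen, incl_gen]

/-- `σ` is the image of the top simplex of some `Δᵐ`, so by naturality the differential of its
generator is a series in the faces of `σ`. This is why the differential of `Δⁿ` restricts to
subcomplexes. -/
lemma exists_diff (σ : K.faces) : ∃ D : (freeLie (simplexDeg K)).obj (simplexDeg K σ + -1),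
    (incl K).toFun _ D = (M.diff n).toFun rfl (gen (toFull σ) (simplexDeg K σ) rfl) := by
  obtain ⟨m, hm⟩ : ∃ m, σ.1.card = m + 1 :=
    ⟨σ.1.card - 1, by have := (nonempty_of_mem σ).card_pos; omega⟩
  obtain ⟨φ, hφ⟩ := M.exists_faceHom σ hm
  have hd : simplexDeg _ (topFace m) = simplexDeg K σ := by
    rw [← simplexDeg_faceMap σ hm, faceMap_topFace]
  refine ⟨_, (hφ _ ((M.diff m).toFun rfl (gen (topFace m) _ hd))).symm.trans ?_⟩
  refine (hom_map_d φ rfl (gen (topFace m) _ hd)).trans (congrArg _ ?_)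
  refine (hφ _ _).trans ?_
  rw [relabel_gen, incl_gen]
  congr 1
  rw [faceMap_topFace]

theorem exists_isModelOf (K : PreAbstractSimplicialComplex (Fin (n + 1))) :
    ∃ δ, M.IsModelOf K δ := by
  choose D hD using M.exists_diff (K := K)
  have hc : ∀ {p q : ℤ} (h : p + -1 = q) (f : (freeLie (simplexDeg K)).obj p),
      (incl K).toFun q ((derivation (-1) D).toFun h f) =
        (M.diff n).toFun h ((incl K).toFun p f) := by
    refine lieMap_comm_derivation (freeLie_isComplete _) (incl K) (derivation (-1) D)
      (M.diff n).toDerivation fun σ => ?_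
    rw [derivation_gen, incl_gen, hD]
  let δ : (freeLie (simplexDeg K)).Differential :=
    { toDerivation := derivation (-1) D
      square_zero := fun h h' x => incl_injective _ (by
        rw [hc, hc, (M.diff n).square_zero, map_zero]) }
  refine ⟨δ, homMk (L := freeCDGL δ) (M := M.simplex n) (incl K) hc, ?_⟩
  rintro σ ⟨τ, hτ⟩ rfl p hσ hτ
  exact incl_gen σ p hσ

variable {M} {δ : (freeLie (simplexDeg K)).Differential}

lemma IsModelOf.incl_d (h : M.IsModelOf K δ) {p q : ℤ} (hpq : p + -1 = q)
    (f : (freeLie (simplexDeg K)).obj p) :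
    (incl K).toFun q (δ.toFun hpq f) = (M.diff n).toFun hpq ((incl K).toFun p f) := by
  obtain ⟨φ, hφ⟩ := h
  have e : ∀ p (f : (freeLie (simplexDeg K)).obj p), φ.toFun p f = (incl K).toFun p f :=
    lieMap_ext (freeLie_isComplete _) (lieMap φ) (incl K) fun σ =>
      (hφ σ (toFull σ) rfl _ rfl rfl).trans (incl_gen σ _ rfl).symm
  have := hom_map_d φ hpq f
  exact (e _ _).symm.trans (this.trans (congrArg _ (e _ _)))

/-- The linear part of the differential of a model. -/
lemma IsModelOf.linCoeff_d (h : M.IsModelOf K δ) (σ τ : K.faces) {p q : ℤ}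
    (hp : simplexDeg K σ = p) (hq : p + -1 = q) :
    linCoeff τ q (δ.toFun hq (gen σ p hp)) =
      ∑ v ∈ σ.1, if τ.1 = σ.1.erase v then (-1 : ℚ) ^ (σ.1.filter (· < v)).card else 0 := by
  subst hp
  refine (linCoeff_relabel (degY := simplexDeg (fullSimplex n)) toFull (fun _ => rfl)
    toFull_injective τ q _).symm.trans ?_
  change linCoeff (toFull τ) q ((incl K).toFun _ _) = _
  rw [h.incl_d, incl_gen]
  exact M.linear n (toFull σ) (toFull τ) hq

/-- The generators of vertices are Maurer-Cartan elements. -/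
lemma IsModelOf.isMC_vertex (h : M.IsModelOf K δ) (σ : K.faces) (hσ : simplexDeg K σ = -1) :
    (freeCDGL δ).IsMC (gen σ (-1) hσ) := by
  refine IsMC.of_injective (homMk (L := freeCDGL δ) (M := M.simplex n) (incl K) h.incl_d)
    incl_injective ?_
  have hm : σ.1.card = 0 + 1 := by
    have : (σ.1.card : ℤ) - 2 = -1 := hσ
    omega
  obtain ⟨φ, hφ⟩ := M.exists_faceHom σ hm
  have := M.isMC.map φ
  have e : φ.toFun (-1) pointGen = (incl K).toFun (-1) (gen σ (-1) hσ) := by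
    refine (hφ _ _).trans ?_
    rw [pointGen, relabel_gen]
    congr 2
    rw [← eq_point (topFace 0), faceMap_topFace]
  rw [e] at this
  exact this

/-! ### The collapse to a point -/

/-- The only letter has degree `-1`, so words of length `l` have degree `-l`. In degrees at least
`-1` this leaves words of length at most one, and the empty word has coefficient zero. -/
lemma point_model_eq_zero {q : ℤ} (hq : -1 ≤ q)
    {f : (freeLie (simplexDeg (fullSimplex 0))).obj q} (hf : linCoeff point q f = 0) : f = 0 := by
  refine Subtype.ext (funext fun w => ?_)
  by_contra hw
  have hs := lieSeries_homogeneous f.2 hw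
  have hl : ∀ w : List (fullSimplex 0).faces,
      (w.map (simplexDeg (fullSimplex 0))).sum = -(w.length : ℤ) := by
    intro w
    induction w with
    | nil => rfl
    | cons x w ih =>
      rw [List.map_cons, List.sum_cons, ih, eq_point x]
      simp [simplexDeg, point]
  rw [hl] at hs
  match w, hw, hs with
  | [], hw, _ => exact hw (lieSeries_nil f.2)
  | [x], hw, _ => rw [eq_point x] at hw; exact hw hf
  | _ :: _ :: _, _, hs => simp at hs; omega

/-- The value of the collapse map on a generator. -/
def collapseVal (σ : K.faces) : (freeLie (simplexDeg (fullSimplex 0))).obj (simplexDeg K σ) :=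
  if h : simplexDeg K σ = -1 then gen point _ (by rw [h]; simp [simplexDeg, point]) else 0

/-- The collapse map. -/
def collapseMap (K : PreAbstractSimplicialComplex (Fin (n + 1))) :
    LieMap (freeLie (simplexDeg K)) (freeLie (simplexDeg (fullSimplex 0))) :=
  lift collapseVal

lemma collapseMap_vertex (σ : K.faces) (hσ : simplexDeg K σ = -1) :
    (collapseMap K).toFun (-1) (gen σ (-1) hσ) = pointGen := by
  have : ∀ p (hp : simplexDeg K σ = p) (h : p = -1), (collapseMap K).toFun p (gen σ p hp) =
      gen point p (by rw [h]; simp [simplexDeg, point]) := by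
    rintro _ rfl h
    exact (lift_gen _ σ).trans (dif_pos h)
  exact this (-1) hσ rfl

lemma collapseMap_other (σ : K.faces) {p : ℤ} (hσ : simplexDeg K σ = p) (hp : p ≠ -1) :
    (collapseMap K).toFun p (gen σ p hσ) = 0 := by
  subst hσ
  exact (lift_gen _ σ).trans (dif_neg hp)

lemma neg_one_le_simplexDeg (σ : K.faces) : -1 ≤ simplexDeg K σ := by
  have := (nonempty_of_mem σ).card_pos
  simp only [simplexDeg]
  omega

/-- The sum of the coefficients of the boundary of an edge vanishes. -/
lemma IsModelOf.sum_boundary_edge (h : M.IsModelOf K δ) (σ : K.faces) {p : ℤ}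
    (hp : simplexDeg K σ = p) (hq : p + -1 = -1) :
    ∑ τ : {τ : K.faces // simplexDeg K τ = -1}, linCoeff τ.1 (-1) (δ.toFun hq (gen σ p hp)) = 0 := by
  have hc : σ.1.card = 2 := by
    have : (σ.1.card : ℤ) - 2 = p := hp
    omega
  simp only [h.linCoeff_d σ _ hp hq]
  rw [Finset.sum_comm]
  have e : ∀ v ∈ σ.1, ∑ τ : {τ : K.faces // simplexDeg K τ = -1},
      (if τ.1.1 = σ.1.erase v then (-1 : ℚ) ^ (σ.1.filter (· < v)).card else 0) =
        (-1 : ℚ) ^ (σ.1.filter (· < v)).card := by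
    intro v hv
    have hcard : (σ.1.erase v).card = 1 := by rw [Finset.card_erase_of_mem hv, hc]
    have hmem : σ.1.erase v ∈ K.faces := mem_of_subset σ (Finset.erase_subset _ _)
      (Finset.card_pos.mp (by omega))
    rw [Finset.sum_eq_single ⟨⟨σ.1.erase v, hmem⟩, by simp [simplexDeg, hcard]⟩]
    · rw [if_pos rfl]
    · rintro ⟨⟨τ, hτ⟩, hd⟩ _ hne
      rw [if_neg]
      rintro rfl
      exact hne rfl
    · simp
  rw [Finset.sum_congr rfl e]
  -- For `a < b` the two signs are `1` and `-1`; the unordered pair is sorted afterwards.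
  have key : ∀ a b : Fin (n + 1), a < b → ∑ v ∈ ({a, b} : Finset (Fin (n + 1))),
      (-1 : ℚ) ^ (({a, b} : Finset (Fin (n + 1))).filter (· < v)).card = 0 := by
    intro a b hab
    rw [Finset.sum_pair hab.ne, Finset.filter_insert, Finset.filter_insert,
      Finset.filter_singleton, Finset.filter_singleton]
    simp [hab, hab.not_gt]
  obtain ⟨a, b, hab, hs⟩ := Finset.card_eq_two.mp hc
  rw [hs]
  rcases lt_or_gt_of_ne hab with hlt | hlt
  · exact key a b hlt
  · rw [Finset.pair_comm]
    exact key b a hlt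

/-- Vertices are Maurer-Cartan elements on both sides. Every other generator goes to zero, so its
boundary must too: for edges the coefficients of the boundary cancel, and in higher dimension the
target vanishes for degree reasons. -/
theorem IsModelOf.exists_isCollapse (h : M.IsModelOf K δ) :
    ∃ ρ : freeCDGL δ ⟶ M.simplex 0, M.IsCollapse ρ := by
  classical
  refine ⟨freeHomMk (δ := δ) (C := M.simplex 0) (collapseMap K) fun σ => ?_,
    collapseMap_vertex, fun σ p hσ hp => collapseMap_other σ hσ hp⟩
  suffices H : ∀ p q (hp : simplexDeg K σ = p) (hq : p + -1 = q),
      (collapseMap K).toFun q (δ.toFun hq (gen σ p hp)) =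
        (M.diff 0).toFun hq ((collapseMap K).toFun p (gen σ p hp)) from H _ _ rfl rfl
  intro p q hp hq
  by_cases hp1 : p = -1
  · subst hp1
    rw [collapseMap_vertex]
    refine (congrArg _ ((isMC_iff (L := freeCDGL δ) hq).mp (h.isMC_vertex σ hp))).trans ?_
    refine Eq.trans ?_ ((isMC_iff (L := M.simplex 0) hq).mp M.isMC).symm
    change (collapseMap K).toFun q (-((1 / 2 : ℚ) •
      (freeLie (simplexDeg K)).bracket hq (gen σ (-1) hp) (gen σ (-1) hp))) = _
    rw [map_neg, map_smul, LieMap.map_bracket, collapseMap_vertex]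
    rfl
  · rw [collapseMap_other σ hp hp1, map_zero]
    have hp0 : -1 ≤ p := hp ▸ neg_one_le_simplexDeg σ
    refine point_model_eq_zero (by omega) ?_
    by_cases hq1 : q = -1
    · subst hq1
      rw [linCoeff_map _ (fun g hg => (collapseMap K).map_lcs 1 hg)]
      simp only [collapseMap_vertex]
      have : linCoeff point (-1) pointGen = 1 := by rw [pointGen, linCoeff_gen, if_pos rfl]
      simp only [this, mul_one]
      exact h.sum_boundary_edge σ hp hq
    · refine linCoeff_eq_zero_of_ne _ fun hd => hq1 ?_
      rw [← hd]
      simp [simplexDeg, point]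

end SimplexModels

namespace SimplexModels

variable (M : SimplexModels) {n : ℕ} {K : PreAbstractSimplicialComplex (Fin (n + 1))}

/-! ### The cone as a pushout -/

lemma point_hom_ext {C : CDGL} {f g : M.simplex 0 ⟶ C}
    (h : f.toFun (-1) pointGen = g.toFun (-1) pointGen) : f = g := by
  refine freeCDGL_hom_ext fun σ => ?_
  obtain rfl := eq_point σ
  exact h

/-- The morphism of graded Lie algebras `𝕃̂(a) → 𝕃̂(a, z_j, w_j)` with `a ↦ a`. -/
def pointMap {J : Type} (deg : J → ℤ) :
    LieMap (freeLie (simplexDeg (fullSimplex 0))) (freeLie (canDeg deg)) :=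
  relabel (fun _ => Sum.inl ()) fun σ => by rw [eq_point σ]; rfl

lemma pointMap_pointGen {J : Type} (deg : J → ℤ) :
    (pointMap deg).toFun (-1) pointGen = canApex deg :=
  relabel_gen _ _ _ _ _

/-- The morphism from the model of a point to the canonical model. -/
def pointHom {J : Type} [Fintype J] (deg : J → ℤ) :
    M.simplex 0 ⟶ freeCDGL (canDiff deg) :=
  freeHomMk (δ := M.diff 0) (C := freeCDGL (canDiff deg)) (pointMap deg) (fun σ => by
    obtain rfl := eq_point σ
    change (pointMap deg).toFun (-1 + -1) ((M.diff 0).toFun rfl pointGen) =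
      (canDiff deg).toFun rfl ((pointMap deg).toFun (-1) pointGen)
    refine (congrArg _ ((isMC_iff (L := M.simplex 0) rfl).mp M.isMC)).trans ?_
    rw [pointMap_pointGen]
    refine Eq.trans ?_ ((isMC_iff (L := freeCDGL (canDiff deg)) rfl).mp isMC_canApex).symm
    change (pointMap deg).toFun (-1 + -1) (-((1 / 2 : ℚ) •
      (freeLie (simplexDeg (fullSimplex 0))).bracket rfl pointGen pointGen)) = _
    rw [map_neg, map_smul, LieMap.map_bracket, pointMap_pointGen]
    rfl)

lemma pointHom_pointGen {J : Type} [Fintype J] (deg : J → ℤ) :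
    (M.pointHom deg).toFun (-1) pointGen = canApex deg := pointMap_pointGen deg

/-- The retraction of the canonical model onto the model of a point. -/
def retraction {J : Type} [Fintype J] (deg : J → ℤ) :
    freeCDGL (canDiff deg) ⟶ M.simplex 0 :=
  canHom (δ := M.diff 0) pointGen (fun _ => 0) M.isMC

lemma pointHom_retraction {J : Type} [Fintype J] (deg : J → ℤ) :
    M.pointHom deg ≫ M.retraction deg = 𝟙 _ := by
  refine M.point_hom_ext ?_
  refine (congrArg ((M.retraction deg).toFun (-1)) (M.pointHom_pointGen deg)).trans ?_
  exact canLift_apex (δ := M.diff 0) pointGen fun _ => 0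

variable {M} {δ : (freeLie (simplexDeg K)).Differential}

/-- The morphism from `𝕃̂(V ⊕ V' ⊕ sV')` to the canonical model. -/
def coneLeg (Z : Cylinder δ) (ρ : freeCDGL δ ⟶ M.simplex 0) :
    freeCDGL Z.d ⟶ freeCDGL (canDiff (simplexDeg K)) :=
  Z.desc (ρ ≫ M.pointHom _) fun σ => canW σ _ rfl

lemma coneLeg_base (Z : Cylinder δ) (ρ : freeCDGL δ ⟶ M.simplex 0) (σ : K.faces) :
    (coneLeg Z ρ).toFun _ (cylGen₀ σ _ rfl) =
      (M.pointHom (simplexDeg K)).toFun _ (ρ.toFun _ (gen σ (simplexDeg K σ) rfl)) :=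
  Cylinder.descMap_base (ρ ≫ M.pointHom _) _ σ

lemma coneLeg_susp (Z : Cylinder δ) (ρ : freeCDGL δ ⟶ M.simplex 0) (σ : K.faces) :
    (coneLeg Z ρ).toFun _ (cylGen₂ σ (simplexDeg K σ + 1) rfl) = canW σ _ rfl :=
  Cylinder.descMap_susp (ρ ≫ M.pointHom _) (fun σ => canW σ _ rfl) σ

/-- `lift` takes values in free algebras while `C` is arbitrary, so the descent is routed through
`𝕃̂(V ⊕ V' ⊕ sV')`: there `a` goes to a vertex `v` of `K`, which is Maurer-Cartan, and `w_σ` to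
`sσ'`; then `f` is applied. Since the collapse sends `v` to `a`, the condition `w` gives `f v = h
a`. -/
lemma exists_coneDesc (hδ : M.IsModelOf K δ) (Z : Cylinder δ) {ρ : freeCDGL δ ⟶ M.simplex 0}
    (hρ : M.IsCollapse ρ) {C : CDGL} (f : freeCDGL Z.d ⟶ C) (h : M.simplex 0 ⟶ C)
    (w : Z.lam₀ ≫ f = ρ ≫ h) :
    ∃ l : freeCDGL (canDiff (simplexDeg K)) ⟶ C, coneLeg Z ρ ≫ l = f ∧ M.pointHom _ ≫ l = h := by
  have hf : ∀ (σ : K.faces) p (hp : simplexDeg K σ = p), f.toFun p (cylGen₀ σ p hp) =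
      h.toFun p (ρ.toFun p (gen σ p hp)) := by
    intro σ p hp
    refine (congrArg _ (Z.lam₀_gen σ p hp).symm).trans ?_
    exact congrArg (fun k : freeCDGL δ ⟶ C => k.toFun p (gen σ p hp)) w
  rcases isEmpty_or_nonempty K.faces with hK | ⟨⟨σ₀⟩⟩
  -- Without simplices no vertex is available, but then there are no pairs `z, w` either and the
  -- retraction onto the model of the point does the job.
  · refine ⟨M.retraction _ ≫ h, Z.hom_ext (fun σ => isEmptyElim σ) (fun σ => isEmptyElim σ), ?_⟩
    rw [← Category.assoc, pointHom_retraction, Category.id_comp]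
  · obtain ⟨x, hx⟩ := nonempty_of_mem σ₀
    let v : K.faces := ⟨{x}, mem_of_subset σ₀ (Finset.singleton_subset_iff.mpr hx)
      (Finset.singleton_nonempty x)⟩
    have hv : simplexDeg K v = -1 := by simp [simplexDeg, v]
    have hmc : (freeCDGL Z.d).IsMC (cylGen₀ v (-1) hv) := by
      have := (hδ.isMC_vertex v hv).map Z.lam₀
      rwa [Z.lam₀_gen] at this
    obtain ⟨l, hla, hlw⟩ : ∃ l : freeCDGL (canDiff (simplexDeg K)) ⟶ C,
        l.toFun (-1) (canApex (simplexDeg K)) = h.toFun (-1) pointGen ∧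
        ∀ σ, l.toFun _ (canW σ _ rfl) = f.toFun _ (cylGen₂ σ (simplexDeg K σ + 1) rfl) := by
      refine ⟨canHom (δ := Z.d) (cylGen₀ v (-1) hv) (fun σ => cylGen₂ σ _ rfl) hmc ≫ f, ?_,
        fun σ => congrArg (f.toFun _) (canLift_w (δ := Z.d) _ _ σ)⟩
      refine (congrArg (f.toFun (-1)) (canLift_apex (δ := Z.d) _ _)).trans ?_
      rw [hf v (-1) hv, hρ.1]
    have hpt : l.toFun (-1) ((M.pointHom (simplexDeg K)).toFun (-1) pointGen) =
        h.toFun (-1) pointGen := (congrArg (l.toFun (-1)) (M.pointHom_pointGen _)).trans hla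
    refine ⟨l, Z.hom_ext (fun σ => ?_) (fun σ => ?_), M.point_hom_ext hpt⟩
    · refine (congrArg (l.toFun _) (coneLeg_base Z ρ σ)).trans ((Eq.trans ?_ (hf σ _ rfl).symm))
      suffices H : ∀ p (hp : simplexDeg K σ = p),
          l.toFun p ((M.pointHom (simplexDeg K)).toFun p (ρ.toFun p (gen σ p hp))) =
          h.toFun p (ρ.toFun p (gen σ p hp)) from H _ rfl
      intro p hp
      by_cases hp1 : p = -1
      · subst hp1
        rw [hρ.1]
        exact hpt
      · rw [hρ.2 σ p hp hp1]
        simp only [map_zero]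
    · exact (congrArg (l.toFun _) (coneLeg_susp Z ρ σ)).trans (hlw σ)

theorem isPushout_lam₀ (hδ : M.IsModelOf K δ) (Z : Cylinder δ) {ρ : freeCDGL δ ⟶ M.simplex 0}
    (hρ : M.IsCollapse ρ) :
    IsPushout Z.lam₀ ρ (coneLeg Z ρ) (M.pointHom (simplexDeg K)) := by
  have w : Z.lam₀ ≫ coneLeg Z ρ = ρ ≫ M.pointHom (simplexDeg K) := Z.lam₀_desc _ _
  have H := fun s : Limits.PushoutCocone Z.lam₀ ρ =>
    exists_coneDesc hδ Z hρ s.inl s.inr s.condition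
  choose l hl hl' using H
  refine ⟨⟨w⟩, ⟨Limits.PushoutCocone.IsColimit.mk w l hl hl' fun s m hm hm' => ?_⟩⟩
  refine can_hom_ext ?_ fun σ => ?_
  · have e := congrArg (fun k : M.simplex 0 ⟶ s.pt => k.toFun (-1) pointGen) (hm'.trans (hl' s).symm)
    have e' : ∀ m : freeCDGL (canDiff (simplexDeg K)) ⟶ s.pt,
        (M.pointHom (simplexDeg K) ≫ m).toFun (-1) pointGen = m.toFun (-1) (canApex _) :=
      fun m => congrArg _ (M.pointHom_pointGen _)
    exact (e' m).symm.trans (e.trans (e' _))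
  · have e := congrArg (fun k : freeCDGL Z.d ⟶ s.pt =>
      k.toFun _ (cylGen₂ σ (simplexDeg K σ + 1) rfl)) (hm.trans (hl s).symm)
    have e' : ∀ m : freeCDGL (canDiff (simplexDeg K)) ⟶ s.pt,
        (coneLeg Z ρ ≫ m).toFun _ (cylGen₂ σ (simplexDeg K σ + 1) rfl) =
          m.toFun _ (canW σ _ rfl) :=
      fun m => congrArg _ (coneLeg_susp Z ρ σ)
    exact (e' m).symm.trans (e.trans (e' _))

theorem isPushout_ι₁ (hδ : M.IsModelOf K δ) (Z : Cylinder δ) {ρ : freeCDGL δ ⟶ M.simplex 0}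
    (hρ : M.IsCollapse ρ) :
    IsPushout Z.ι₁ ρ (Z.unroll.inv ≫ coneLeg Z ρ) (M.pointHom (simplexDeg K)) := by
  refine (isPushout_lam₀ hδ Z hρ).of_iso (Iso.refl _) Z.unroll (Iso.refl _) (Iso.refl _)
    ?_ ?_ ?_ ?_
  · rw [Z.lam₀_unroll, Iso.refl_hom, Category.id_comp]
  · simp
  · simp
  · simp

theorem IsModelOf.isCone_can (hδ : M.IsModelOf K δ) :
    M.IsCone δ (freeCDGL (canDiff (simplexDeg K))) := by
  obtain ⟨Z⟩ := exists_cylinder δ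
  obtain ⟨ρ, hρ⟩ := hδ.exists_isCollapse
  exact ⟨Z, ρ, _, _, hρ, isPushout_ι₁ hδ Z hρ⟩

/-- The pushout square is available for whichever cylinder and collapse map produced `C`, so the
cone does not depend on these choices. -/
theorem IsModelOf.iso_of_isCone (hδ : M.IsModelOf K δ) {C : CDGL} (hC : M.IsCone δ C) :
    Nonempty (C ≅ freeCDGL (canDiff (simplexDeg K))) := by
  obtain ⟨Z, ρ, f, g, hρ, hp⟩ := hC
  exact ⟨hp.isoIsPushout _ _ (isPushout_ι₁ hδ Z hρ)⟩

/-! ### The model of the simplicial cone -/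

lemma castSucc_mem_map {t : Finset (Fin (n + 1))} {x : Fin (n + 1)} :
    x.castSucc ∈ t.map Fin.castSuccEmb ↔ x ∈ t := by
  simp

lemma last_notMem_map (t : Finset (Fin (n + 1))) :
    Fin.last (n + 1) ∉ t.map Fin.castSuccEmb := by
  simp [Fin.castSucc_ne_last]

lemma map_subset_insert {s t : Finset (Fin (n + 1))}
    (h : t.map Fin.castSuccEmb ⊆ insert (Fin.last (n + 1)) (s.map Fin.castSuccEmb)) : t ⊆ s := by
  intro x hx
  have := h (castSucc_mem_map.mpr hx)
  rw [Finset.mem_insert] at this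
  exact castSucc_mem_map.mp (this.resolve_left (Fin.castSucc_ne_last x))

/-- The simplices of the cone: the apex, the simplices of `K`, and their joins with the apex. -/
def coneFace (K : PreAbstractSimplicialComplex (Fin (n + 1))) :
    Unit ⊕ K.faces ⊕ K.faces → (coneComplex K).faces
  | Sum.inl _ => ⟨{Fin.last (n + 1)}, Finset.singleton_nonempty _, fun t ht h => by
      obtain ⟨x, hx⟩ := ht
      have := h (castSucc_mem_map.mpr hx)
      exact absurd (Finset.mem_singleton.mp this) (Fin.castSucc_ne_last x)⟩
  | Sum.inr (Sum.inl σ) => ⟨σ.1.map Fin.castSuccEmb, (nonempty_of_mem σ).map, fun _ ht h =>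
      mem_of_subset σ (map_subset_insert (h.trans (Finset.subset_insert _ _))) ht⟩
  | Sum.inr (Sum.inr σ) => ⟨insert (Fin.last (n + 1)) (σ.1.map Fin.castSuccEmb),
      Finset.insert_nonempty _ _, fun _ ht h => mem_of_subset σ (map_subset_insert h) ht⟩

/-- The three kinds of simplices are told apart by whether they contain the apex and whether they
contain another vertex. -/
lemma coneFace_injective : Function.Injective (coneFace K) := by
  have hl : ∀ {a b : (coneComplex K).faces}, a = b →
      (Fin.last (n + 1) ∈ a.1 ↔ Fin.last (n + 1) ∈ b.1) := by rintro a _ rfl; rfl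
  have hc : ∀ {a b : (coneComplex K).faces}, a = b → ∀ x : Fin (n + 1),
      (x.castSucc ∈ a.1 ↔ x.castSucc ∈ b.1) := by rintro a _ rfl x; rfl
  rintro (a | a | a) (b | b | b) h
  · rfl
  · exact absurd ((hl h).mp (Finset.mem_singleton_self _)) (last_notMem_map _)
  · obtain ⟨x, hx⟩ := nonempty_of_mem b
    have := (hc h x).mpr (Finset.mem_insert_of_mem (castSucc_mem_map.mpr hx))
    exact absurd (Finset.mem_singleton.mp this) (Fin.castSucc_ne_last x)
  · exact absurd ((hl h).mpr (Finset.mem_singleton_self _)) (last_notMem_map _)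
  · have : a = b := Subtype.ext (Finset.map_injective _ (congrArg (fun s => s.1) h))
    rw [this]
  · exact absurd ((hl h).mpr (Finset.mem_insert_self _ _)) (last_notMem_map _)
  · obtain ⟨x, hx⟩ := nonempty_of_mem a
    have := (hc h x).mp (Finset.mem_insert_of_mem (castSucc_mem_map.mpr hx))
    exact absurd (Finset.mem_singleton.mp this) (Fin.castSucc_ne_last x)
  · exact absurd ((hl h).mp (Finset.mem_insert_self _ _)) (last_notMem_map _)
  · have : a = b := Subtype.ext (Finset.Subset.antisymm
      (map_subset_insert ((Finset.subset_insert _ _).trans (congrArg (fun s => s.1) h).subset))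
      (map_subset_insert ((Finset.subset_insert _ _).trans (congrArg (fun s => s.1) h).superset)))
    rw [this]

lemma coneFace_surjective : Function.Surjective (coneFace K) := by
  rintro ⟨s, hs, hsK⟩
  let t : Finset (Fin (n + 1)) := Finset.univ.filter fun x => x.castSucc ∈ s
  have ht : ∀ x, x ∈ t ↔ x.castSucc ∈ s := fun x => by simp [t]
  have hts : t.map Fin.castSuccEmb ⊆ s := by
    intro y hy
    obtain ⟨x, hx, rfl⟩ := Finset.mem_map.mp hy
    exact (ht x).mp hx
  have hst : ∀ y ∈ s, y ≠ Fin.last (n + 1) → y ∈ t.map Fin.castSuccEmb := by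
    intro y hy hne
    obtain ⟨x, rfl⟩ := Fin.exists_castSucc_eq.mpr hne
    exact castSucc_mem_map.mpr ((ht x).mpr hy)
  by_cases hl : Fin.last (n + 1) ∈ s
  · rcases t.eq_empty_or_nonempty with h0 | h0
    · refine ⟨Sum.inl (), Subtype.ext (Finset.Subset.antisymm
        (Finset.singleton_subset_iff.mpr hl) fun y hy => ?_)⟩
      refine Finset.mem_singleton.mpr (by_contra fun hne => ?_)
      have := hst y hy hne
      rw [h0] at this
      simp at this
    · refine ⟨Sum.inr (Sum.inr ⟨t, hsK t h0 hts⟩), Subtype.ext (Finset.Subset.antisymm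
        (Finset.insert_subset hl hts) fun y hy => ?_)⟩
      by_cases hne : y = Fin.last (n + 1)
      · exact Finset.mem_insert.mpr (Or.inl hne)
      · exact Finset.mem_insert_of_mem (hst y hy hne)
  · have h0 : s = t.map Fin.castSuccEmb := Finset.Subset.antisymm
      (fun y hy => hst y hy fun h => hl (h ▸ hy)) hts
    have h1 : t.Nonempty := by
      rw [h0] at hs
      exact Finset.map_nonempty.mp hs
    exact ⟨Sum.inr (Sum.inl ⟨t, hsK t h1 hts⟩), Subtype.ext h0.symm⟩

lemma simplexDeg_coneFace (x : Unit ⊕ K.faces ⊕ K.faces) :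
    simplexDeg (coneComplex K) (coneFace K x) = canDeg (simplexDeg K) x := by
  rcases x with x | σ | σ
  · simp [simplexDeg, coneFace, canDeg]
  · simp [simplexDeg, coneFace, canDeg]
  · have : (insert (Fin.last (n + 1)) (σ.1.map Fin.castSuccEmb)).card = σ.1.card + 1 := by
      rw [Finset.card_insert_of_notMem (last_notMem_map _), Finset.card_map]
    simp only [simplexDeg, coneFace, canDeg, Sum.elim_inr, this]
    push_cast
    ring

/-- A facet of a join lacks the apex only if the apex is the vertex removed. This is the source of
triangularity. -/
lemma coneFace_eq_erase_iff (σ τ : K.faces) {v : Fin (n + 1 + 1)}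
    (hv : v ∈ (coneFace K (Sum.inr (Sum.inr σ))).1) :
    (coneFace K (Sum.inr (Sum.inl τ))).1 = (coneFace K (Sum.inr (Sum.inr σ))).1.erase v ↔
      v = Fin.last (n + 1) ∧ τ = σ := by
  change τ.1.map Fin.castSuccEmb = (insert (Fin.last (n + 1)) (σ.1.map Fin.castSuccEmb)).erase v ↔ _
  constructor
  · intro h
    have hl : v = Fin.last (n + 1) := by
      by_contra hne
      refine last_notMem_map τ.1 ?_
      rw [h]
      exact Finset.mem_erase.mpr ⟨Ne.symm hne, Finset.mem_insert_self _ _⟩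
    subst hl
    rw [Finset.erase_insert (last_notMem_map _)] at h
    exact ⟨rfl, Subtype.ext (Finset.map_injective _ h)⟩
  · rintro ⟨rfl, rfl⟩
    rw [Finset.erase_insert (last_notMem_map _)]

theorem iso_cone_model {δ' : (freeLie (simplexDeg (coneComplex K))).Differential}
    (h : M.IsModelOf (coneComplex K) δ') :
    Nonempty (freeCDGL (canDiff (simplexDeg K)) ≅ freeCDGL δ') := by
  classical
  have hd := simplexDeg_coneFace (K := K)
  let α : (freeLie (simplexDeg (coneComplex K))).obj (-1) :=
    gen (coneFace K (Sum.inl ())) (-1) (hd (Sum.inl ()))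
  let ω : ∀ σ : K.faces, (freeLie (simplexDeg (coneComplex K))).obj (simplexDeg K σ + 1) :=
    fun σ => gen (coneFace K (Sum.inr (Sum.inr σ))) _ (hd (Sum.inr (Sum.inr σ)))
  have hα : (freeCDGL δ').IsMC α := h.isMC_vertex _ _
  -- Among the generators of `K`, the linear part of the boundary of the join of `σ` with the apex
  -- sees only `σ`: the sum over removed vertices reduces to the removal of the apex.
  have key : ∀ (σ τ : K.faces) (p : ℤ) (hp : canDeg (simplexDeg K) (Sum.inr (Sum.inl σ)) = p),
      linCoeff (coneFace K (Sum.inr (Sum.inl τ))) p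
        ((canLift δ' α ω).toFun p (gen (Sum.inr (Sum.inl σ)) p hp)) =
      if τ = σ then (-1 : ℚ) ^ ((coneFace K (Sum.inr (Sum.inr σ))).1.filter
        (· < Fin.last (n + 1))).card else 0 := by
    intro σ τ p hp
    have hp' : simplexDeg K σ = p := hp
    refine (congrArg _ (canLift_z α ω σ hp' (by omega))).trans ?_
    refine (h.linCoeff_d (coneFace K (Sum.inr (Sum.inr σ))) (coneFace K (Sum.inr (Sum.inl τ)))
      (p := simplexDeg K σ + 1) (q := p) (hd (Sum.inr (Sum.inr σ))) (by omega)).trans ?_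
    rw [Finset.sum_eq_single (Fin.last (n + 1))]
    · have := coneFace_eq_erase_iff σ τ (Finset.mem_insert_self _ _)
      simp only [true_and] at this
      simp only [this]
    · intro v hv hne
      rw [if_neg]
      exact fun h => hne ((coneFace_eq_erase_iff σ τ hv).mp h).1
    · intro hn
      exact absurd (Finset.mem_insert_self _ _) hn
  refine ⟨isoOfBijective (canHom (δ := δ') α ω hα) ?_⟩
  refine bijective_of_triangular (canLift δ' α ω)
    (Equiv.ofBijective _ ⟨coneFace_injective, coneFace_surjective⟩) hd
    (Set.range fun σ => Sum.inr (Sum.inl σ)) ?_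
    -- The diagonal entries are signs of which only the nonvanishing matters; the values `1` off the
    -- `z_σ` are placeholders.
    (fun x => Sum.elim (fun _ => 1) (Sum.elim (fun σ => (-1 : ℚ) ^
      ((coneFace K (Sum.inr (Sum.inr σ))).1.filter (· < Fin.last (n + 1))).card) fun _ => 1) x)
    ?_ ?_ ?_
  · rintro (u | σ | σ) hσ p hp
    · subst hp
      exact canLift_apex α ω
    · exact absurd ⟨σ, rfl⟩ hσ
    · subst hp
      exact canLift_w α ω σ
  · rintro _ ⟨σ, rfl⟩
    exact pow_ne_zero _ (by norm_num)
  · rintro _ ⟨σ, rfl⟩ p hp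
    exact (key σ σ p hp).trans (if_pos rfl)
  · rintro _ ⟨σ, rfl⟩ _ ⟨τ, rfl⟩ hne p hp
    refine (key σ τ p hp).trans (if_neg ?_)
    rintro rfl
    exact hne rfl

lemma coneComplex_fullSimplex (n : ℕ) : coneComplex (fullSimplex n) = fullSimplex (n + 1) := by
  refine SetLike.ext fun s => ?_
  exact ⟨fun h => h.1, fun h => ⟨h, fun _ ht _ => ht⟩⟩

lemma isModelOf_fullSimplex (M : SimplexModels) (n : ℕ) :
    M.IsModelOf (fullSimplex n) (M.diff n) := by
  refine ⟨𝟙 (M.simplex n), ?_⟩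
  rintro σ τ h p hσ hτ
  obtain rfl : τ = σ := Subtype.ext h
  rfl

theorem iso_simplex_succ (M : SimplexModels) (n : ℕ) :
    Nonempty (freeCDGL (canDiff (simplexDeg (fullSimplex n))) ≅ M.simplex (n + 1)) := by
  -- The type of the differential depends on the complex, so the identification of the cone on `Δⁿ`
  -- with `Δⁿ⁺¹` is substituted while both complex and differential are still variables.
  have key : ∀ (K' : PreAbstractSimplicialComplex (Fin (n + 1 + 1)))
      (δ' : (freeLie (simplexDeg K')).Differential), coneComplex (fullSimplex n) = K' →
      M.IsModelOf K' δ' →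
      Nonempty (freeCDGL (canDiff (simplexDeg (fullSimplex n))) ≅ freeCDGL δ') := by
    rintro _ δ' rfl h
    exact iso_cone_model h
  exact key _ _ (coneComplex_fullSimplex n) (M.isModelOf_fullSimplex (n + 1))

end SimplexModels

end

theorem mainTheorem6 (M : SimplexModels) :
    (∀ n : ℕ, (∃ C : CDGL, M.IsCone (M.diff n) C) ∧
      ∀ C : CDGL, M.IsCone (M.diff n) C → Nonempty (M.simplex (n + 1) ≅ C)) ∧
    (∀ (n : ℕ) (K : PreAbstractSimplicialComplex (Fin (n + 1))),
      (∃ δ, M.IsModelOf K δ) ∧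
      ∀ (δ : (freeLie (simplexDeg K)).Differential)
        (δ' : (freeLie (simplexDeg (coneComplex K))).Differential),
        M.IsModelOf K δ → M.IsModelOf (coneComplex K) δ' →
        (∃ C : CDGL, M.IsCone δ C) ∧
        ∀ C : CDGL, M.IsCone δ C → Nonempty (C ≅ freeCDGL δ')) := by
  refine ⟨fun n => ⟨⟨_, (M.isModelOf_fullSimplex n).isCone_can⟩, fun C hC => ?_⟩,
    fun n K => ⟨M.exists_isModelOf K, fun δ δ' hδ hδ' => ⟨⟨_, hδ.isCone_can⟩, fun C hC => ?_⟩⟩⟩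
  · obtain ⟨e⟩ := (M.isModelOf_fullSimplex n).iso_of_isCone hC
    obtain ⟨e'⟩ := M.iso_simplex_succ n
    exact ⟨(e ≪≫ e').symm⟩
  · obtain ⟨e⟩ := hδ.iso_of_isCone hC
    obtain ⟨e'⟩ := SimplexModels.iso_cone_model hδ'
    exact ⟨e ≪≫ e'⟩
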